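/- Let $k$ be a field and let $R$ be a functor from commutative $k$-algebras to dg categories (cohomological grading, differential of degree $+1$) such that $R(B)$ is $B$-linear and, for a morphism $B\to B'$ of $k$-algebras, the dg functor $R(B)\to R(B')$ is semilinear. Assume the representability hypotheses: (1) the functor $\mathrm{ob}(R):B\mapsto \mathrm{ob}(R(B))$ is represented by a $k$-scheme $O$; (2) for every $i\in\mathbb Z$ the functor $R^i$ is represented by a vector bundle $V^i$ (of finite rank) on $O\times_k O$: for every $k$-algebra $B$ and all $x,y\in \mathrm{ob}(R(B))$, the $B$-module $R(B)^i(x,y)$ is identified, linearly and naturally in $B$, with the sections of $V^i$ over $(x,y):\mathrm{Spec}(B)\to O\times_k O$. For a dg category $\mathcal A$, the coherent nerve $NC(\mathcal A)$ is the simplicial set whose $n$-simplices consist of objects $X_0,\dots,X_n$ of $\mathcal A$ and, for each sequence $0\le i_0\le\dots\le i_k\le n$ with $k\ge1$, an element $\alpha(i_0,\dots,i_k)\in\mathcal A^{1-k}(X_{i_0},X_{i_k})$, such that $\alpha(i,i)=1_{X_i}$; $\alpha(i_0,\dots,i_k)=0$ if $k\ge2$ and $i_j=i_{j+1}$ for some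 $j$; and $$d\,\alpha(i_0,\dots,i_k)=\sum_{0<j<k}(-1)^{k-j-1}\bigl(\alpha(i_j,\dots,i_k)\,\alpha(i_0,\dots,i_j)-\alpha(i_0,\dots,\widehat{i_j},\dots,i_k)\bigr).$$ Let $NC^*(\mathcal A)\subset NC(\mathcal A)$ be the simplicial subset of those simplices for which every $\alpha(i_0,i_1)$ is an equivalence, i.e. a closed morphism of degree $0$ that is invertible up to homotopy. Put $\overline X(B)=NC(R(B))$ and $X(B)=NC^*(R(B))$. For a functor $Y$ from commutative $k$-algebras to simplicial sets, $n\ge 2$ and $0\le l\le n$, let $\mathrm{Match}_{\Lambda^n_l}(Y)$ be the functor sending $B$ to the set of families $(f_i)_{0\le i\le n,\ i\ne l}$ of elements of $Y_{n-1}(B)$ with $\partial_i f_j=\partial_{j-1}f_i$ for all $i<j$ different from $l$. We say that $Y$ satisfies $G.P_{n,l}$ if $Y_n$ and $\mathrm{Match}_{\Lambda^n_l}(Y)$ are represented by $k$-schemes and the morphism of schemes $\mu:Y_n\to\mathrm{Match}_{\Lambda^n_l}(Y)$, which sends a simplex to the family of its faces $\partial_i$, $i\neq l$, is smooth and surjective.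 Theorem. Both $X$ and $\overline X$ are simplicial schemes over $k$ (each $X_n$ and each $\overline X_n$ is represented by a $k$-scheme), and both satisfy $G.P_{n,l}$ for all integers $n,l$ with $0<l<n$. -/

import Mathlib

open CategoryTheory AlgebraicGeometry MonoidalCategory CartesianMonoidalCategory Opposite Simplicial

universe u

/-! ### Differential graded categories -/

/-- A `B`-linear differential graded category, with cohomological grading by `ℤ`: the complexes of
morphisms `Hom _ x y` have a differential of degree `+1`, composition is `B`-bilinear and satisfies
the graded Leibniz rule. The equations between degrees are arguments of `d` and `comp`. -/
structure DGCat (B : Type u) [CommRing B] where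
  Obj : Type u
  Hom : ℤ → Obj → Obj → Type u
  [addCommGroup : ∀ p x y, AddCommGroup (Hom p x y)]
  [module : ∀ p x y, Module B (Hom p x y)]
  d : ∀ {x y : Obj} {p q : ℤ}, p + 1 = q → (Hom p x y →ₗ[B] Hom q x y)
  comp : ∀ {x y z : Obj} {p q r : ℤ}, p + q = r → (Hom q y z →ₗ[B] Hom p x y →ₗ[B] Hom r x z)
  id : ∀ x : Obj, Hom 0 x x
  d_d : ∀ {x y : Obj} {p q r : ℤ} (hp : p + 1 = q) (hq : q + 1 = r) (f : Hom p x y),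
    d hq (d hp f) = 0
  id_comp : ∀ {x y : Obj} {p : ℤ} (f : Hom p x y), comp (add_zero p) (id y) f = f
  comp_id : ∀ {x y : Obj} {p : ℤ} (f : Hom p x y), comp (zero_add p) f (id x) = f
  assoc : ∀ {x y z w : Obj} {p q r pq qr s : ℤ} (hpq : p + q = pq) (hqr : q + r = qr)
    (h : pq + r = s) (h' : p + qr = s) (f : Hom p x y) (g : Hom q y z) (e : Hom r z w),
    comp h e (comp hpq g f) = comp h' (comp hqr e g) f
  leibniz : ∀ {x y z : Obj} {p q r p' q' r' : ℤ} (h : p + q = r) (hp : p + 1 = p')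
    (hq : q + 1 = q') (hr : r + 1 = r') (h₁ : p + q' = r') (h₂ : p' + q = r')
    (g : Hom q y z) (f : Hom p x y),
    d hr (comp h g f) = comp h₁ (d hq g) f + q.negOnePow • comp h₂ g (d hp f)

attribute [instance] DGCat.addCommGroup DGCat.module

namespace DGCat

variable {B : Type u} [CommRing B] (A : DGCat B)

/-- A closed morphism `f` of degree `0` is an equivalence when it is invertible up to homotopy:
there are a closed `a` of degree `0` in the other direction and `h`, `g` of degree `-1`
with `f a = 1 + d h` and `a f = 1 + d g`. -/
def IsEquivalence {x y : A.Obj} (f : A.Hom 0 x y) : Prop :=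
  A.d (zero_add 1) f = 0 ∧ ∃ (a : A.Hom 0 y x) (h : A.Hom (-1) y y) (g : A.Hom (-1) x x),
    A.d (zero_add 1) a = 0 ∧
    A.comp (zero_add 0) f a = A.id y + A.d (neg_add_cancel 1) h ∧
    A.comp (zero_add 0) a f = A.id x + A.d (neg_add_cancel 1) g

end DGCat

/-- A (strict) dg functor from a `B`-linear dg category to a `C`-linear one, which is semilinear
along a ring homomorphism `φ : B → C`. -/
@[ext]
structure DGFunctor {B C : Type u} [CommRing B] [CommRing C] (φ : B →+* C)
    (A : DGCat B) (A' : DGCat C) where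
  obj : A.Obj → A'.Obj
  map : ∀ {p : ℤ} {x y : A.Obj}, A.Hom p x y →ₛₗ[φ] A'.Hom p (obj x) (obj y)
  map_d : ∀ {x y : A.Obj} {p q : ℤ} (h : p + 1 = q) (f : A.Hom p x y),
    map (A.d h f) = A'.d h (map f)
  map_id : ∀ x : A.Obj, map (A.id x) = A'.id (obj x)
  map_comp : ∀ {x y z : A.Obj} {p q r : ℤ} (h : p + q = r) (g : A.Hom q y z) (f : A.Hom p x y),
    map (A.comp h g f) = A'.comp h (map g) (map f)

namespace DGFunctor

variable {B C D : Type u} [CommRing B] [CommRing C] [CommRing D]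

/-- The identity dg functor. -/
def refl (A : DGCat B) : DGFunctor (RingHom.id B) A A where
  obj x := x
  map := LinearMap.id
  map_d _ _ := rfl
  map_id _ := rfl
  map_comp _ _ _ := rfl

/-- Composition of dg functors (first `F`, then `G`). -/
def trans {φ : B →+* C} {ψ : C →+* D} {A : DGCat B} {A' : DGCat C} {A'' : DGCat D}
    (F : DGFunctor φ A A') (G : DGFunctor ψ A' A'') : DGFunctor (ψ.comp φ) A A'' where
  obj x := G.obj (F.obj x)
  map :=
    { toFun := fun f => G.map (F.map f)
      map_add' := fun f g => by simp
      map_smul' := fun b f => by simp [LinearMap.map_smulₛₗ] }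
  map_d h f := by simp [F.map_d, G.map_d]
  map_id x := by simp [F.map_id, G.map_id]
  map_comp h g f := by simp [F.map_comp, G.map_comp]

theorem isEquivalence_map {φ : B →+* C} {A : DGCat B} {A' : DGCat C} (F : DGFunctor φ A A')
    {x y : A.Obj} {f : A.Hom 0 x y} (hf : A.IsEquivalence f) : A'.IsEquivalence (F.map f) := by
  obtain ⟨h0, a, h, g, ha, h1, h2⟩ := hf
  refine ⟨by rw [← F.map_d, h0, map_zero], F.map a, F.map h, F.map g, ?_, ?_, ?_⟩
  · rw [← F.map_d, ha, map_zero]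
  · rw [← F.map_comp, h1, map_add, F.map_id, F.map_d]
  · rw [← F.map_comp, h2, map_add, F.map_id, F.map_d]

end DGFunctor

/-! ### The coherent nerve -/

/-- A weakly increasing sequence `i = i₀ ≤ i₁ ≤ ⋯ ≤ i_k = j` of elements of `{0, …, n}`, `k ≥ 1`,
with first term `i` and last term `j`; `inner` is the list `i₁, …, i_{k-1}`, of length `k - 1`. -/
@[ext]
structure Chain (n : ℕ) (i j : Fin (n + 1)) where
  inner : List (Fin (n + 1))
  sorted : (i :: (inner ++ [j])).Pairwise (· ≤ ·)

namespace Chain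

variable {m n : ℕ} {i j : Fin (n + 1)}

/-- The sequence `i ≤ j`. -/
def edge (h : i ≤ j) : Chain n i j := ⟨[], by simpa using h⟩

/-- The terms of the sequence. -/
def vertices (c : Chain n i j) : List (Fin (n + 1)) := i :: (c.inner ++ [j])

/-- The sequence `i₀, …, i_{s+1}`. -/
def front (c : Chain n i j) (s : Fin c.inner.length) : Chain n i c.inner[s] :=
  ⟨c.inner.take s, by
    refine c.sorted.sublist (List.Sublist.cons_cons _ ?_)
    have h : c.inner.take s ++ [c.inner[s]] = c.inner.take (s + 1) := by simp
    rw [h]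
    exact (List.take_sublist _ _).trans (List.sublist_append_left _ _)⟩

/-- The sequence `i_{s+1}, …, i_k`. -/
def back (c : Chain n i j) (s : Fin c.inner.length) : Chain n c.inner[s] j :=
  ⟨c.inner.drop (s + 1), by
    refine c.sorted.sublist (List.Sublist.cons _ ?_)
    rw [← List.cons_append]
    refine List.Sublist.append_right ?_ _
    have h : c.inner[s] :: c.inner.drop (s + 1) = c.inner.drop s := by simp
    rw [h]
    exact List.drop_sublist _ _⟩

/-- The sequence with the term `i_{s+1}` removed. -/
def face (c : Chain n i j) (s : Fin c.inner.length) : Chain n i j :=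
  ⟨c.inner.eraseIdx s,
    c.sorted.sublist (List.Sublist.cons_cons _
      (List.Sublist.append_right (List.eraseIdx_sublist _ _) _))⟩

/-- The image of a sequence under a weakly increasing map. -/
def map {i j : Fin (m + 1)} (c : Chain m i j) (θ : Fin (m + 1) →o Fin (n + 1)) :
    Chain n (θ i) (θ j) :=
  ⟨c.inner.map θ, by
    have h : θ i :: (c.inner.map θ ++ [θ j]) = (i :: (c.inner ++ [j])).map θ := by simp
    rw [h]
    exact c.sorted.map θ fun _ _ hab => θ.monotone hab⟩

theorem length_front_add_back (c : Chain n i j) (s : Fin c.inner.length) :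
    (c.front s).inner.length + (c.back s).inner.length + 1 = c.inner.length := by
  have := s.2
  simp only [front, back, List.length_take, List.length_drop]
  omega

theorem length_face (c : Chain n i j) (s : Fin c.inner.length) :
    (c.face s).inner.length + 1 = c.inner.length := by
  have := s.2
  simp only [face, List.length_eraseIdx]
  split_ifs
  omega

theorem not_nodup_map {i j : Fin (m + 1)} (c : Chain m i j) (θ : Fin (m + 1) →o Fin (n + 1))
    (h : ¬ c.vertices.Nodup) : ¬ (c.map θ).vertices.Nodup := by
  have h' : (c.map θ).vertices = c.vertices.map θ := by simp [vertices, map]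
  rw [h']
  exact fun hn => h (List.Nodup.of_map _ hn)

end Chain

/-- An `n`-simplex of the coherent nerve of a dg category `A`, that is a strictly unital weak
functor to `A` from the linearisation of the ordered set `{0, …, n}`, in explicit form: objects
`X₀, …, X_n` and, for every sequence `i₀ ≤ ⋯ ≤ i_k` with `k ≥ 1`, a morphism
`α(i₀, …, i_k) : X_{i₀} ⟶ X_{i_k}` of degree `1 - k`. -/
@[ext]
structure NCSimplex {B : Type u} [CommRing B] (A : DGCat B) (n : ℕ) where
  obj : Fin (n + 1) → A.Obj
  hom : ∀ {i j : Fin (n + 1)} (c : Chain n i j) (p : ℤ), p + c.inner.length = 0 →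
    A.Hom p (obj i) (obj j)
  /-- `α(i, i) = 1`. -/
  unit : ∀ i : Fin (n + 1), hom (Chain.edge (le_refl i)) 0 (by simp [Chain.edge]) = A.id (obj i)
  /-- `α(i₀, …, i_k) = 0` if `k ≥ 2` and two consecutive terms are equal. -/
  degenerate : ∀ {i j : Fin (n + 1)} (c : Chain n i j) (p : ℤ) (hp : p + c.inner.length = 0),
    c.inner ≠ [] → ¬ c.vertices.Nodup → hom c p hp = 0
  /-- `d α(i₀, …, i_k) = ∑_{0 < l < k} (-1) ^ (k - l - 1) *
  (α(i_l, …, i_k) α(i₀, …, i_l) - α(i₀, …, i_k without i_l))`; here `l = s + 1`. -/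
  differential : ∀ {i j : Fin (n + 1)} (c : Chain n i j) (p q : ℤ) (hp : p + c.inner.length = 0)
    (hq : p + 1 = q),
    A.d hq (hom c p hp) = ∑ s : Fin c.inner.length, ((-1 : ℤ) ^ (c.back s).inner.length) •
      (A.comp (p := -(c.front s).inner.length) (q := -(c.back s).inner.length)
          (by have := c.length_front_add_back s; omega)
          (hom (c.back s) _ (neg_add_cancel _)) (hom (c.front s) _ (neg_add_cancel _))
        - hom (c.face s) q (by have := c.length_face s; omega))

namespace NCSimplex

variable {B C D : Type u} [CommRing B] [CommRing C] [CommRing D] {A : DGCat B}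

theorem comp_hom_congr {n : ℕ} (α : NCSimplex A n) {i v w j : Fin (n + 1)} {r : ℤ} (h : v = w)
    (a : Chain n i v) (b : Chain n v j) (a' : Chain n i w) (b' : Chain n w j)
    (ha : a.inner = a'.inner) (hb : b.inner = b'.inner) {p q p' q' : ℤ} (hp hq hp' hq')
    (hr : p + q = r) (hr' : p' + q' = r) :
    A.comp hr (α.hom b q hq) (α.hom a p hp) = A.comp hr' (α.hom b' q' hq') (α.hom a' p' hp') := by
  subst h
  obtain rfl : a = a' := Chain.ext ha
  obtain rfl : b = b' := Chain.ext hb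
  obtain rfl : p = p' := by omega
  obtain rfl : q = q' := by omega
  rfl

/-- The restriction of a simplex along a weakly increasing map. -/
def restrict {m n : ℕ} (α : NCSimplex A n) (θ : Fin (m + 1) →o Fin (n + 1)) : NCSimplex A m where
  obj i := α.obj (θ i)
  hom c p hp := α.hom (c.map θ) p (by simpa [Chain.map] using hp)
  unit i := α.unit (θ i)
  degenerate c p hp h h' := α.degenerate _ _ _ (by simpa [Chain.map] using h)
    (c.not_nodup_map θ h')
  differential {i j} c p q hp hq := by
    rw [α.differential]
    have hl : (c.map θ).inner.length = c.inner.length := by simp [Chain.map]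
    refine Fintype.sum_equiv (finCongr hl) _ _ fun s => ?_
    generalize ht' : finCongr hl s = t
    have ht : (s : ℕ) = t := by rw [← ht']; rfl
    have hb : ((c.map θ).back s).inner = ((c.back t).map θ).inner := by
      simp [Chain.back, Chain.map, List.map_drop, ht]
    have hf : ((c.map θ).front s).inner = ((c.front t).map θ).inner := by
      simp [Chain.front, Chain.map, List.map_take, ht]
    have hc : (c.map θ).face s = (c.face t).map θ := by
      ext1
      simp [Chain.face, Chain.map, List.eraseIdx_map, ht]
    have hs : ((c.map θ).back s).inner.length = (c.back t).inner.length := by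
      simp [Chain.back, hl, ht]
    have hv : (c.map θ).inner[s] = θ c.inner[t] := by
      obtain rfl : s = finCongr hl.symm t := Fin.ext ht
      simp only [Chain.map, Fin.getElem_fin, List.getElem_map]
      rfl
    congr 1
    · rw [hs]
    · congr 1
      · exact α.comp_hom_congr hv _ _ _ _ hf hb _ _ _ _ _ _
      · congr 1

theorem restrict_id {n : ℕ} (α : NCSimplex A n) : α.restrict OrderHom.id = α := by
  refine NCSimplex.ext rfl (heq_of_eq ?_)
  funext i j c p hp
  have h : c.map OrderHom.id = c := Chain.ext (by simp [Chain.map])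
  have key : ∀ (c' : Chain n i j) (hp' : p + c'.inner.length = 0), c' = c →
      α.hom c' p hp' = α.hom c p hp := by
    rintro _ _ rfl
    rfl
  exact key _ _ h

theorem restrict_restrict {l m n : ℕ} (α : NCSimplex A n) (θ : Fin (m + 1) →o Fin (n + 1))
    (θ' : Fin (l + 1) →o Fin (m + 1)) :
    (α.restrict θ).restrict θ' = α.restrict (θ.comp θ') := by
  refine NCSimplex.ext rfl (heq_of_eq ?_)
  funext i j c p hp
  have h : (c.map θ').map θ = c.map (θ.comp θ') := Chain.ext (by simp [Chain.map])
  have key : ∀ (c' c'' : Chain n (θ (θ' i)) (θ (θ' j))) (hp' : p + c'.inner.length = 0)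
      (hp'' : p + c''.inner.length = 0), c' = c'' → α.hom c' p hp' = α.hom c'' p hp'' := by
    rintro _ _ _ _ rfl
    rfl
  exact key _ _ _ _ h

/-- The image of a simplex under a dg functor. -/
def mapFunctor {n : ℕ} {φ : B →+* C} {A' : DGCat C} (α : NCSimplex A n) (F : DGFunctor φ A A') :
    NCSimplex A' n where
  obj i := F.obj (α.obj i)
  hom c p hp := F.map (α.hom c p hp)
  unit i := by rw [α.unit, F.map_id]
  degenerate c p hp h h' := by rw [α.degenerate c p hp h h', map_zero]
  differential c p q hp hq := by
    rw [← F.map_d, α.differential, map_sum]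
    refine Finset.sum_congr rfl fun s _ => ?_
    rw [map_zsmul, map_sub, F.map_comp]

/-- All the edges `α(i₀, i₁)` of the simplex are equivalences. -/
def EdgesInvertible {n : ℕ} (α : NCSimplex A n) : Prop :=
  ∀ (i j : Fin (n + 1)) (h : i ≤ j),
    A.IsEquivalence (α.hom (Chain.edge h) 0 (by simp [Chain.edge]))

theorem EdgesInvertible.restrict {m n : ℕ} {α : NCSimplex A n} (h : α.EdgesInvertible)
    (θ : Fin (m + 1) →o Fin (n + 1)) : (α.restrict θ).EdgesInvertible :=
  fun i j hij => h (θ i) (θ j) (θ.monotone hij)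

theorem EdgesInvertible.mapFunctor {n : ℕ} {φ : B →+* C} {A' : DGCat C} {α : NCSimplex A n}
    (h : α.EdgesInvertible) (F : DGFunctor φ A A') : (α.mapFunctor F).EdgesInvertible :=
  fun i j hij => F.isEquivalence_map (h i j hij)

end NCSimplex

/-- The coherent nerve `NC(A)` of a dg category. -/
def NC {B : Type u} [CommRing B] (A : DGCat B) : SSet.{u} where
  obj Δ := NCSimplex A Δ.unop.len
  map θ := ↾fun α => α.restrict θ.unop.toOrderHom
  map_id Δ := by
    apply ConcreteCategory.hom_ext
    exact fun α => α.restrict_id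
  map_comp θ θ' := by
    apply ConcreteCategory.hom_ext
    exact fun α => (α.restrict_restrict θ.unop.toOrderHom θ'.unop.toOrderHom).symm

/-- The simplicial subset `NC*(A)` of `NC(A)` of the simplices all of whose edges are
equivalences. -/
def NCStar {B : Type u} [CommRing B] (A : DGCat B) : SSet.{u} where
  obj Δ := {α : NCSimplex A Δ.unop.len // α.EdgesInvertible}
  map θ := ↾fun α => ⟨α.1.restrict θ.unop.toOrderHom, α.2.restrict θ.unop.toOrderHom⟩
  map_id Δ := by
    apply ConcreteCategory.hom_ext
    exact fun α => Subtype.ext α.1.restrict_id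
  map_comp θ θ' := by
    apply ConcreteCategory.hom_ext
    exact fun α => Subtype.ext
      (α.1.restrict_restrict θ.unop.toOrderHom θ'.unop.toOrderHom).symm

/-! ### Functors from commutative algebras to dg categories -/

/-- A functor `R` from commutative `k`-algebras to dg categories such that `R(B)` is `B`-linear and
the dg functor attached to a morphism `f` of `k`-algebras is semilinear along `f`. -/
structure DGFamily (k : Type u) [Field k] where
  obj : ∀ B : CommAlgCat.{u} k, DGCat B
  map : ∀ {B C : CommAlgCat.{u} k} (f : B ⟶ C), DGFunctor (f.hom : B →+* C) (obj B) (obj C)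
  map_id : ∀ B : CommAlgCat.{u} k, map (𝟙 B) = DGFunctor.refl (obj B)
  map_comp : ∀ {B C D : CommAlgCat.{u} k} (f : B ⟶ C) (g : C ⟶ D),
    map (f ≫ g) = (map f).trans (map g)

namespace DGFamily

variable {k : Type u} [Field k] (R : DGFamily k)

/-- The functor `ob(R)`. -/
def ob : CommAlgCat.{u} k ⥤ Type u where
  obj B := (R.obj B).Obj
  map f := ↾(R.map f).obj
  map_id B := by
    rw [R.map_id]
    rfl
  map_comp f g := by
    rw [R.map_comp]
    rfl

/-- The functor `X̄ = NC ∘ R` from commutative `k`-algebras to simplicial sets. -/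
def Xbar : CommAlgCat.{u} k ⥤ SSet.{u} where
  obj B := NC (R.obj B)
  map f := { app := fun _ => ↾fun α => α.mapFunctor (R.map f) }
  map_id B := by
    rw [R.map_id]
    rfl
  map_comp f g := by
    rw [R.map_comp]
    rfl

/-- The functor `X = NC* ∘ R` from commutative `k`-algebras to simplicial sets. -/
def X : CommAlgCat.{u} k ⥤ SSet.{u} where
  obj B := NCStar (R.obj B)
  map f := { app := fun _ => ↾fun α => ⟨α.1.mapFunctor (R.map f), α.2.mapFunctor (R.map f)⟩ }
  map_id B := by
    rw [R.map_id]
    rfl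
  map_comp f g := by
    rw [R.map_comp]
    rfl

end DGFamily

/-! ### Functors of points, vector bundles and representability -/

section Points

variable {k : Type u} [Field k]

/-- The set of `B`-valued points of a `k`-scheme `S`: morphisms of `k`-schemes `Spec B ⟶ S`. -/
abbrev Pt (S : Over (Spec (.of k))) (B : CommAlgCat.{u} k) : Type u :=
  (algSpec (.of k)).obj (op B) ⟶ S

/-- The image of a point under a morphism of `k`-algebras. -/
noncomputable abbrev Pt.res {S : Over (Spec (.of k))} {B C : CommAlgCat.{u} k} (s : Pt S B)
    (f : B ⟶ C) : Pt S C :=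
  (algSpec (.of k)).map f.op ≫ s

/-- The functor of points, on commutative `k`-algebras, of a `k`-scheme. -/
noncomputable def points (S : Over (Spec (.of k))) : CommAlgCat.{u} k ⥤ Type u where
  obj B := Pt S B
  map f := ↾fun s => s.res f

/-- The natural transformation between functors of points induced by a morphism of `k`-schemes. -/
noncomputable def pointsMap {S T : Over (Spec (.of k))} (f : S ⟶ T) : points S ⟶ points T where
  app B := ↾fun s : Pt S B => s ≫ f

/-- The set of sections of `p : E ⟶ S` over a point `s` of `S`. -/
def SectionsOver {E S : Over (Spec (.of k))} (p : E ⟶ S) {B : CommAlgCat.{u} k} (s : Pt S B) :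
    Type u :=
  {v : Pt E B // v ≫ p = s}

/-- The pullback of a section along a morphism of `k`-algebras. -/
noncomputable def SectionsOver.res {E S : Over (Spec (.of k))} {p : E ⟶ S} {B C : CommAlgCat.{u} k}
    {s : Pt S B} (v : SectionsOver p s) (f : B ⟶ C) : SectionsOver p (s.res f) :=
  ⟨v.1.res f, by rw [Pt.res, Category.assoc, v.2]⟩

/-- A vector bundle (of finite rank, in the geometric sense) on a `k`-scheme `S`: a scheme `total`
over `S` with a structure of `B`-module on the sections over every `B`-valued point of `S`,
compatible with pullbacks, which is locally on `S` linearly isomorphic to an affine space. The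
isomorphism with the affine space of dimension `r` over the open subset `U` is given on the points
with values in `k`-algebras, which amounts to an isomorphism of schemes over `U`. -/
structure GeomVectorBundle (S : Over (Spec (.of k))) where
  total : Over (Spec (.of k))
  proj : total ⟶ S
  [addCommGroup : ∀ {B : CommAlgCat.{u} k} (s : Pt S B), AddCommGroup (SectionsOver proj s)]
  [module : ∀ {B : CommAlgCat.{u} k} (s : Pt S B), Module B (SectionsOver proj s)]
  res_add : ∀ {B C : CommAlgCat.{u} k} (f : B ⟶ C) (s : Pt S B) (v w : SectionsOver proj s),
    (v + w).res f = v.res f + w.res f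
  res_smul : ∀ {B C : CommAlgCat.{u} k} (f : B ⟶ C) (s : Pt S B) (b : B)
    (v : SectionsOver proj s), (b • v).res f = f.hom b • v.res f
  locallyTrivial : ∀ x : S.left, ∃ (U : S.left.Opens) (r : ℕ)
    (t : ∀ {B : CommAlgCat.{u} k} (s : Pt S B), s.left ⁻¹ᵁ U = ⊤ →
      (SectionsOver proj s ≃ₗ[B] (Fin r → B))),
    x ∈ U ∧ ∀ {B C : CommAlgCat.{u} k} (f : B ⟶ C) (s : Pt S B) (hs : s.left ⁻¹ᵁ U = ⊤)
      (hs' : (s.res f).left ⁻¹ᵁ U = ⊤) (v : SectionsOver proj s),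
      t (s.res f) hs' (v.res f) = fun a => f.hom (t s hs v a)

attribute [instance] GeomVectorBundle.addCommGroup GeomVectorBundle.module

/-- The representability hypotheses: `ob(R)` is represented by a `k`-scheme `O` and, for every
`i`, the functor `Rⁱ` is represented by a vector bundle `V` on `O × O`, in the sense that
`Rⁱ(B)(x, y)` is, linearly and naturally in `B`, the module of sections of `V` over the point
`(x, y) : Spec B ⟶ O × O`. -/
def DGFamily.REPR (R : DGFamily k) : Prop :=
  ∃ (O : Over (Spec (.of k))) (e : R.ob ≅ points O), ∀ i : ℤ,
    ∃ (V : GeomVectorBundle (O ⊗ O))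
      (t : ∀ {B : CommAlgCat.{u} k} (x y : (R.obj B).Obj), (R.obj B).Hom i x y ≃ₗ[B]
        SectionsOver V.proj (lift (e.hom.app B x : Pt O B) (e.hom.app B y : Pt O B))),
      ∀ {B C : CommAlgCat.{u} k} (f : B ⟶ C) (x y : (R.obj B).Obj) (a : (R.obj B).Hom i x y),
        (t _ _ ((R.map f).map a)).1 = (t x y a).1.res f

/-! ### Simplicial schemes and the Grothendieck–Pridham conditions -/

/-- The functor `X_n` of `n`-simplices. -/
def level (X : CommAlgCat.{u} k ⥤ SSet.{u}) (n : ℕ) : CommAlgCat.{u} k ⥤ Type u :=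
  X ⋙ (evaluation _ _).obj (op ⦋n⦌)

/-- A functor from commutative `k`-algebras to simplicial sets is a simplicial scheme when each
`X_n` is represented by a `k`-scheme (the simplicial structure of these schemes is then determined,
by the Yoneda lemma). -/
def IsSimplicialScheme (X : CommAlgCat.{u} k ⥤ SSet.{u}) : Prop :=
  ∀ n : ℕ, ∃ S : Over (Spec (.of k)), Nonempty (level X n ≅ points S)

/-- The matching functor of the horn `Λ^{n+2}_l`: families `(f_i)` for `i ≠ l` in `{0, …, n + 2}`
of `(n+1)`-simplices with `∂_i f_j = ∂_{j-1} f_i` for `i < j`. Here the pairs `i < j` are written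
`i.castSucc < j.succ` with `i ≤ j`. -/
def Match (X : CommAlgCat.{u} k ⥤ SSet.{u}) (n : ℕ) (l : Fin (n + 3)) :
    CommAlgCat.{u} k ⥤ Type u where
  obj B := {f : ∀ i : Fin (n + 3), i ≠ l → (X.obj B) _⦋n + 1⦌ //
    ∀ (i j : Fin (n + 2)) (hi : i.castSucc ≠ l) (hj : j.succ ≠ l), i ≤ j →
      (X.obj B).δ i (f j.succ hj) = (X.obj B).δ j (f i.castSucc hi)}
  map φ := ↾fun f => ⟨fun i hi => (X.map φ).app _ (f.1 i hi), fun i j hi hj hij => by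
    have h := congrArg ((X.map φ).app _) (f.2 i j hi hj hij)
    exact (SSet.δ_naturality_apply (X.map φ) i _).symm.trans
      (h.trans (SSet.δ_naturality_apply (X.map φ) j _))⟩
  map_id B := by
    rw [X.map_id]
    rfl
  map_comp f g := by
    rw [X.map_comp]
    rfl

/-- The matching map `μ : X_{n+2} ⟶ Match`, which sends a simplex to the family of its faces. -/
def matchMap (X : CommAlgCat.{u} k ⥤ SSet.{u}) (n : ℕ) (l : Fin (n + 3)) :
    level X (n + 2) ⟶ Match X n l where
  app B := ↾fun x => ⟨fun i _ => (X.obj B).δ i x, fun i j _ _ hij =>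
    SSet.δ_comp_δ_apply hij x⟩
  naturality B C φ := by
    apply ConcreteCategory.hom_ext
    exact fun x => Subtype.ext (funext fun i => funext fun _ =>
      (SSet.δ_naturality_apply (X.map φ) i x).symm)

/-- The condition `G.P_{n+2, l}`: the functors `X_{n+2}` and `Match` are represented by `k`-schemes
and the matching morphism between these schemes is smooth and surjective. -/
def GP (X : CommAlgCat.{u} k ⥤ SSet.{u}) (n : ℕ) (l : Fin (n + 3)) : Prop :=
  ∃ (S T : Over (Spec (.of k))) (eS : level X (n + 2) ≅ points S) (eT : Match X n l ≅ points T)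
    (f : S ⟶ T), eS.hom ≫ pointsMap f = matchMap X n l ≫ eT.hom ∧
      AlgebraicGeometry.Smooth f.left ∧ AlgebraicGeometry.Surjective f.left

end Points

/-!
A simplex of the coherent nerve amounts to objects `X i` and morphisms `α i j s`, for `i < j` and
finite sets `s` strictly between `i` and `j`, whose differentials are given by a universal formula
`MorFamily.bd` (`NCSimplex.ofFamily`, `NCSimplex.ext_family`). The faces of an inner horn
`Λ^{n+2}_l` determine all of these morphisms except two, which go from the first vertex to the last
one: the top morphism, where `s` consists of all inner vertices, and the one where `l` is removed
from `s`. The equation for the top morphism expresses the second of these as the differential of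
the first up to terms that are known, and then the equation for the second follows from
`d ∘ d = 0` (`MorFamily.sum_bd_bd`, `MorFamily.d_bd`). So a filler of the horn is the same as an
arbitrary morphism of degree `-(n + 1)` from the first vertex to the last one
(`NCSimplex.exists_filler`, `NCSimplex.eq_of_face_of_top`). In terms of schemes, the matching map
`μ` is a base change of the projection of the vector bundle that represents these morphisms, hence
smooth, and surjective because of the zero section (`gp_of_existsUnique`). The same holds for `X`
in place of `X̄`, since the edges of a simplex are equivalences if those of the faces of an inner
horn are (`NCSimplex.EdgesInvertible.of_face`). The matching functor of a horn is a finite limit of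
functors in lower levels, so by induction everything is representable as soon as the levels `0` and
`1` are (`isSimplicialScheme_of_gp`).

The objects form the level `0` of both nerves, and the level `1` of `X̄` consists of the closed
morphisms of degree `0`, a closed condition on the points of a vector bundle. It remains to see that
the equivalences form an open subscheme of this scheme (`DGFamily.REPR.isRep_X_one`), for which two
facts are needed (`IsRep.of_openCondition`).

* Being an equivalence is local on `Spec B`. A closed morphism `f` is an equivalence if and only if
  a linear system of equations for `(a, h, g)`, with coefficients that depend on `f`, is solvable.
  The sections of a vector bundle over the points of a scheme are quasi-coherent
  (`GeomVectorBundle.exists_pow_smul_eq_zero`, `GeomVectorBundle.exists_pull_eq`), and solvability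
  of a linear system between quasi-coherent modules is a local condition
  (`DGFamily.REPR.isEquivalence_of_span`).
* Being an equivalence spreads out from a field-valued point `Spec K ⟶ Spec A` to a neighbourhood
  (`DGFamily.REPR.exists_isEquivalence_map`). After localization all modules of morphisms that are
  involved are free. The cone of the composition with `f` is acyclic over `K`, and a determinant
  with indeterminate entries shows that over `A` every cycle becomes a boundary after multiplication
  with some `t` that does not vanish in `K` (`Matrix.exists_mulVec_eq_smul`). This gives `a` such
  that `f a` is homotopic to `t`, and likewise `f'` such that `a f'` is homotopic to some `t'`.
  Where `t` and `t'` are invertible, `f` is an equivalence.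
-/

/-! ### Functors of points and morphisms of schemes -/

section PointsFullyFaithful

variable {k : Type u} [Field k]

/-- The functor of points, as a functor from `k`-schemes to functors on `k`-algebras. -/
noncomputable def pointsFunctor (k : Type u) [Field k] :
    Over (Spec (.of k)) ⥤ CommAlgCat.{u} k ⥤ Type u where
  obj := points
  map := pointsMap
  map_id S := by
    ext B s
    exact Category.comp_id (s : Pt S B)
  map_comp f g := by
    ext B s
    exact (Category.assoc (s : Pt _ B) f g).symm

theorem exists_algSpec_iso (W : Over (Spec (.of k))) [IsAffine W.left] :
    ∃ B : CommAlgCat.{u} k, Nonempty ((algSpec (.of k)).obj (op B) ≅ W) := by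
  obtain ⟨B, ⟨e⟩⟩ := (essImage_algSpec (R := .of k) (G := W)).2 inferInstance
  exact ⟨B.unop, ⟨e⟩⟩

instance (B : CommAlgCat.{u} k) : IsAffine ((algSpec (.of k)).obj (op B)).left :=
  inferInstanceAs (IsAffine (Spec (.of B)))

/-- The action of a transformation of functors of points on a point. -/
noncomputable def pointsApp {S T : Over (Spec (.of k))} (τ : points S ⟶ points T)
    {B : CommAlgCat.{u} k} (s : Pt S B) : Pt T B :=
  τ.app B s

theorem points_naturality {S T : Over (Spec (.of k))} (τ : points S ⟶ points T)
    {B C : CommAlgCat.{u} k} (g : (algSpec (.of k)).obj (op C) ⟶ (algSpec (.of k)).obj (op B))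
    (s : Pt S B) : pointsApp τ (g ≫ s) = g ≫ pointsApp τ s := by
  obtain ⟨f, rfl⟩ := (algSpec.instFull (R := .of k)).map_surjective g
  exact NatTrans.naturality_apply τ f.unop s

/-- The value of a transformation of functors of points at a point with values in an arbitrary
affine `k`-scheme. -/
noncomputable def affinePoint {S T : Over (Spec (.of k))} (τ : points S ⟶ points T)
    (W : Over (Spec (.of k))) [IsAffine W.left] (s : W ⟶ S) : W ⟶ T :=
  (exists_algSpec_iso W).choose_spec.some.inv ≫
    pointsApp τ ((exists_algSpec_iso W).choose_spec.some.hom ≫ s)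

theorem affinePoint_comp {S T : Over (Spec (.of k))} (τ : points S ⟶ points T)
    {W W' : Over (Spec (.of k))} [IsAffine W.left] [IsAffine W'.left] (g : W' ⟶ W) (s : W ⟶ S) :
    affinePoint τ W' (g ≫ s) = g ≫ affinePoint τ W s := by
  have h := points_naturality τ ((exists_algSpec_iso W').choose_spec.some.hom ≫ g ≫
    (exists_algSpec_iso W).choose_spec.some.inv)
    ((exists_algSpec_iso W).choose_spec.some.hom ≫ s)
  simp only [Category.assoc, Iso.inv_hom_id_assoc] at h
  rw [affinePoint, h, Iso.inv_hom_id_assoc, affinePoint]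

theorem affinePoint_algSpec {S T : Over (Spec (.of k))} (τ : points S ⟶ points T)
    {B : CommAlgCat.{u} k} (s : Pt S B) :
    affinePoint τ ((algSpec (.of k)).obj (op B)) s = pointsApp τ s := by
  rw [affinePoint, points_naturality, Iso.inv_hom_id_assoc]

/-- Morphisms out of a `k`-scheme can be compared locally, on small affine opens. -/
theorem over_hom_ext_local {S T : Over (Spec (.of k))} {f g : S ⟶ T}
    (h : ∀ x : S.left, ∃ U : S.left.Opens, x ∈ U ∧ U.ι ≫ f.left = U.ι ≫ g.left) : f = g :=
  Over.OverMorphism.ext (Scheme.hom_ext_of_forall _ _ h)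

/-- An open subscheme of a `k`-scheme, as a `k`-scheme. -/
noncomputable abbrev openOver (S : Over (Spec (.of k))) (U : S.left.Opens) : Over (Spec (.of k)) :=
  Over.mk (U.ι ≫ S.hom)

/-- The inclusion of an open subscheme. -/
noncomputable abbrev openOverι (S : Over (Spec (.of k))) (U : S.left.Opens) : openOver S U ⟶ S :=
  Over.homMk U.ι

instance (S : Over (Spec (.of k))) (U : S.left.affineOpens) : IsAffine (openOver S U.1).left := U.2

instance (S : Over (Spec (.of k))) (U : S.left.directedAffineCover.I₀) :
    IsAffine (openOver S U.1).left := U.2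

/-- A transformation between functors of points is induced by a morphism of schemes, which is glued
from its values at the affine open subschemes of the source. -/
theorem exists_pointsMap_eq {S T : Over (Spec (.of k))} (τ : points S ⟶ points T) :
    ∃ f : S ⟶ T, pointsMap f = τ := by
  let g : ∀ U : S.left.directedAffineCover.I₀, S.left.directedAffineCover.X U ⟶ T.left :=
    fun U => (affinePoint τ (openOver S U.1) (openOverι S U.1)).left
  let f : S ⟶ T := Scheme.OpenCover.glueMorphismsOverOfLocallyDirected S.left.directedAffineCover g
    (fun {U V} hUV => by
      let r : openOver S U.1 ⟶ openOver S V.1 := Over.homMk (S.left.homOfLE (leOfHom hUV)) (by simp)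
      have hr : r ≫ openOverι S V.1 = openOverι S U.1 := by ext1; simp [r]
      have := affinePoint_comp τ r (openOverι S V.1)
      rw [hr] at this
      simp only [g, this]
      rfl)
    (fun U => Over.w (affinePoint τ (openOver S U.1) (openOverι S U.1)))
  have hf : ∀ U : S.left.affineOpens, openOverι S U.1 ≫ f =
      affinePoint τ (openOver S U.1) (openOverι S U.1) := fun U => by
    ext1
    exact Scheme.OpenCover.map_glueMorphismsOverOfLocallyDirected_left _ g _ _ U
  refine ⟨f, ?_⟩
  ext B s
  change Pt S B at s
  change s ≫ f = pointsApp τ s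
  rw [← affinePoint_algSpec]
  apply over_hom_ext_local
  intro x
  obtain ⟨U, hU, hxU, -⟩ := exists_isAffineOpen_mem_and_subset (x := s.left x) (U := ⊤) trivial
  obtain ⟨V, hV, hxV, hVU⟩ := exists_isAffineOpen_mem_and_subset (x := x) (U := s.left ⁻¹ᵁ U) hxU
  refine ⟨V, hxV, ?_⟩
  let V' : Over (Spec (.of k)) := openOver ((algSpec (.of k)).obj (op B)) V
  let ι : V' ⟶ (algSpec (.of k)).obj (op B) := openOverι _ V
  have : IsAffine V'.left := hV
  have : IsAffine (openOver S U).left := hU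
  let q : V' ⟶ openOver S U := Over.homMk (IsOpenImmersion.lift U.ι (V.ι ≫ s.left) (by
      rintro _ ⟨y, rfl⟩
      simpa using! hVU y.2)) (by
      exact (Category.assoc _ _ _).symm.trans ((congrArg (· ≫ S.hom)
        (IsOpenImmersion.lift_fac _ _ _)).trans ((Category.assoc _ _ _).trans
          (congrArg (V.ι ≫ ·) (Over.w s)))))
  have hq : q ≫ openOverι S U = ι ≫ s := by
    ext1
    exact IsOpenImmersion.lift_fac _ _ _
  have key : ι ≫ (s ≫ f) = ι ≫ affinePoint τ _ s := by
    rw [← affinePoint_comp, ← hq, affinePoint_comp, ← hf ⟨U, hU⟩, ← Category.assoc, ← Category.assoc,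
      hq]
  exact congrArg CommaMorphism.left key

theorem pointsMap_injective {S T : Over (Spec (.of k))} {f g : S ⟶ T}
    (h : pointsMap f = pointsMap g) : f = g := by
  apply over_hom_ext_local
  intro x
  obtain ⟨U, hU, hxU, -⟩ := exists_isAffineOpen_mem_and_subset (x := x) (U := ⊤) trivial
  refine ⟨U, hxU, ?_⟩
  have : IsAffine (openOver S U).left := hU
  obtain ⟨B, ⟨e⟩⟩ := exists_algSpec_iso (openOver S U)
  have h1 : (e.hom ≫ openOverι S U) ≫ f = (e.hom ≫ openOverι S U) ≫ g :=
    ConcreteCategory.congr_hom (congrArg (fun t => NatTrans.app t B) h)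
      (e.hom ≫ openOverι S U : Pt S B)
  rw [Category.assoc, Category.assoc, cancel_epi] at h1
  exact congrArg CommaMorphism.left h1

instance : (pointsFunctor k).Full := ⟨fun τ => exists_pointsMap_eq τ⟩

instance : (pointsFunctor k).Faithful := ⟨fun h => pointsMap_injective h⟩

end PointsFullyFaithful

/-! ### Representable functors -/

section Representable

variable {k : Type u} [Field k]

/-- A functor on `k`-algebras is representable when it is isomorphic to the functor of points of a
`k`-scheme. -/
def IsRep (F : CommAlgCat.{u} k ⥤ Type u) : Prop :=
  ∃ S : Over (Spec (.of k)), Nonempty (F ≅ points S)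

/-- A transformation of functors to types, given by its components. -/
abbrev natTransOf {F G : CommAlgCat.{u} k ⥤ Type u} (app : ∀ B, F.obj B → G.obj B)
    (h : ∀ {B C : CommAlgCat.{u} k} (f : B ⟶ C) (x : F.obj B),
      app C (F.map f x) = G.map f (app B x)) : F ⟶ G where
  app B := ↾(app B)
  naturality B C f := by
    apply ConcreteCategory.hom_ext
    exact fun x => h f x

theorem isIso_of_bijective {F G : CommAlgCat.{u} k ⥤ Type u} (η : F ⟶ G)
    (h : ∀ B, Function.Bijective (η.app B)) : IsIso η := by
  have (B : CommAlgCat.{u} k) : IsIso (η.app B) := (isIso_iff_bijective _).2 (h B)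
  exact NatIso.isIso_of_isIso_app η

theorem IsRep.of_bijective {F G : CommAlgCat.{u} k ⥤ Type u} (hG : IsRep G) (η : F ⟶ G)
    (h : ∀ B, Function.Bijective (η.app B)) : IsRep F := by
  obtain ⟨S, ⟨e⟩⟩ := hG
  have := isIso_of_bijective η h
  exact ⟨S, ⟨asIso η ≪≫ e⟩⟩

/-- The product of a family of functors to types. -/
def piFunctor {ι : Type} (F : ι → CommAlgCat.{u} k ⥤ Type u) : CommAlgCat.{u} k ⥤ Type u where
  obj B := ∀ i, (F i).obj B
  map f := ↾fun x i => (F i).map f (x i)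
  map_id B := by
    apply ConcreteCategory.hom_ext
    exact fun x => funext fun i => (F i).map_id_apply B (x i)
  map_comp f g := by
    apply ConcreteCategory.hom_ext
    exact fun x => funext fun i => Functor.map_comp_apply (F i) f g (x i)

/-- The equalizer of two transformations between functors to types. -/
def eqFunctor {F G : CommAlgCat.{u} k ⥤ Type u} (a b : F ⟶ G) : CommAlgCat.{u} k ⥤ Type u where
  obj B := {x : F.obj B // a.app B x = b.app B x}
  map f := ↾fun x => ⟨F.map f x.1, by
    rw [NatTrans.naturality_apply, NatTrans.naturality_apply, x.2]⟩
  map_id B := by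
    apply ConcreteCategory.hom_ext
    exact fun x => Subtype.ext (F.map_id_apply B x.1)
  map_comp f g := by
    apply ConcreteCategory.hom_ext
    exact fun x => Subtype.ext (Functor.map_comp_apply F f g x.1)

theorem IsRep.pi {ι : Type} [Finite ι] {F : ι → CommAlgCat.{u} k ⥤ Type u}
    (hF : ∀ i, IsRep (F i)) : IsRep (piFunctor F) := by
  choose S e using hF
  have e i := (e i).some
  let η : piFunctor F ⟶ points (∏ᶜ S) := natTransOf
    (fun B x => (Limits.Pi.lift fun i => ((e i).hom.app B (x i) : Pt (S i) B) : Pt (∏ᶜ S) B))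
    (fun {B C} f x => by
      refine Limits.Pi.hom_ext (f := S) _ _ fun i => ?_
      refine (Limits.Pi.lift_π _ _).trans ?_
      refine Eq.trans ?_ (Category.assoc _ _ _).symm
      refine Eq.trans ?_ (congrArg _ (Limits.Pi.lift_π _ _).symm)
      exact NatTrans.naturality_apply (e i).hom f (x i))
  have hη (B) (x : ∀ i, (F i).obj B) (i : ι) : (η.app B x : Pt (∏ᶜ S) B) ≫ Limits.Pi.π S i =
      ((e i).hom.app B (x i) : Pt (S i) B) := Limits.Pi.lift_π _ _
  refine (IsRep.of_bijective ⟨_, ⟨Iso.refl _⟩⟩ η) fun B => ⟨fun x y h => ?_, fun s => ?_⟩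
  · funext i
    apply ((isIso_iff_bijective ((e i).hom.app B)).1 inferInstance).1
    exact (hη B x i).symm.trans
      ((congrArg (fun t : Pt (∏ᶜ S) B => t ≫ Limits.Pi.π S i) h).trans (hη B y i))
  · refine ⟨fun i => (e i).inv.app B ((s : Pt (∏ᶜ S) B) ≫ Limits.Pi.π S i : Pt (S i) B), ?_⟩
    refine Limits.Pi.hom_ext (f := S) _ _ fun i => ?_
    refine (hη B _ i).trans ?_
    exact Iso.inv_hom_id_app_apply (e i) B _

/-- Pointwise pullbacks of functors of points are represented by pullbacks of schemes. -/
theorem IsRep.pullback {F G : CommAlgCat.{u} k ⥤ Type u} {T V S : Over (Spec (.of k))}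
    (p : F ⟶ G) (a : F ⟶ points V) (b : G ⟶ points S) (π : V ⟶ S)
    (w : a ≫ pointsMap π = p ≫ b)
    (h : ∀ B (y : G.obj B) (v : Pt V B), v ≫ π = (b.app B y : Pt S B) →
      ∃! x : F.obj B, p.app B x = y ∧ a.app B x = v)
    (e : G ≅ points T) :
    ∃ (P : Over (Spec (.of k))) (e' : F ≅ points P) (f : P ⟶ T) (g : P ⟶ V) (b' : T ⟶ S),
      e'.hom ≫ pointsMap f = p ≫ e.hom ∧ IsPullback f g b' π := by
  obtain ⟨b', hb'⟩ := exists_pointsMap_eq (e.inv ≫ b)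
  have hb (B) (y : G.obj B) : (e.hom.app B y : Pt T B) ≫ b' = (b.app B y : Pt S B) := by
    have := ConcreteCategory.congr_hom (congrArg (fun t => NatTrans.app t B) hb') (e.hom.app B y)
    refine this.trans ?_
    simp
  have hw (B) (x : F.obj B) : (a.app B x : Pt V B) ≫ π = (b.app B (p.app B x) : Pt S B) :=
    ConcreteCategory.congr_hom (congrArg (fun t => NatTrans.app t B) w) x
  let η : F ⟶ points (Limits.pullback b' π) := natTransOf
    (fun B x => (Limits.pullback.lift (e.hom.app B (p.app B x) : Pt T B)
      (a.app B x : Pt V B) (by rw [hb, hw]) : Pt (Limits.pullback b' π) B))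
    (fun {B C} f x => by
      refine Limits.pullback.hom_ext (f := b') (g := π) ?_ ?_
      · refine (Limits.pullback.lift_fst _ _ _).trans ?_
        refine Eq.trans ?_ (Category.assoc _ _ _).symm
        refine Eq.trans ?_ (congrArg _ (Limits.pullback.lift_fst _ _ _).symm)
        exact NatTrans.naturality_apply (p ≫ e.hom) f x
      · refine (Limits.pullback.lift_snd _ _ _).trans ?_
        refine Eq.trans ?_ (Category.assoc _ _ _).symm
        refine Eq.trans ?_ (congrArg _ (Limits.pullback.lift_snd _ _ _).symm)
        exact NatTrans.naturality_apply a f x)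
  have hη1 (B) (x : F.obj B) : (η.app B x : Pt (Limits.pullback b' π) B) ≫
      Limits.pullback.fst b' π = (e.hom.app B (p.app B x) : Pt T B) :=
    Limits.pullback.lift_fst _ _ _
  have hη2 (B) (x : F.obj B) : (η.app B x : Pt (Limits.pullback b' π) B) ≫
      Limits.pullback.snd b' π = (a.app B x : Pt V B) :=
    Limits.pullback.lift_snd _ _ _
  have : IsIso η := by
    refine isIso_of_bijective _ fun B => ⟨fun x x' hx => ?_, fun s => ?_⟩
    · have h1 : (e.hom.app B (p.app B x) : Pt T B) = (e.hom.app B (p.app B x') : Pt T B) := by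
        rw [← hη1, ← hη1, hx]
      have h1' := ((isIso_iff_bijective (e.hom.app B)).1 inferInstance).1 h1
      have h2 : (a.app B x : Pt V B) = (a.app B x' : Pt V B) := by
        rw [← hη2, ← hη2, hx]
      exact (h B (p.app B x') (a.app B x') (hw _ _)).unique ⟨h1', h2⟩ ⟨rfl, rfl⟩
    · change Pt (Limits.pullback b' π) B at s
      obtain ⟨y, hy⟩ := ((isIso_iff_bijective (e.hom.app B)).1 inferInstance).2
        (s ≫ Limits.pullback.fst b' π : Pt T B)
      obtain ⟨x, ⟨hx1, hx2⟩, -⟩ := h B y (s ≫ Limits.pullback.snd b' π) (by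
        rw [← hb, hy, Category.assoc, Category.assoc, Limits.pullback.condition])
      refine ⟨x, Limits.pullback.hom_ext (f := b') (g := π) ?_ ?_⟩
      · exact (hη1 B x).trans ((congrArg (e.hom.app B) hx1).trans hy)
      · exact (hη2 B x).trans hx2
  refine ⟨_, asIso η, Limits.pullback.fst b' π, Limits.pullback.snd b' π, b', ?_,
    IsPullback.of_hasPullback b' π⟩
  ext B x
  exact hη1 B x

/-- An equalizer of functors is the pullback of the diagonal of the target. -/
theorem IsRep.eqFunctor {F G : CommAlgCat.{u} k ⥤ Type u} (hF : IsRep F) (hG : IsRep G)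
    (a b : F ⟶ G) : IsRep (eqFunctor a b) := by
  obtain ⟨S, ⟨e⟩⟩ := hF
  obtain ⟨T, ⟨e'⟩⟩ := hG
  have hm (B) (x : F.obj B) (y : F.obj B) : (lift (e'.hom.app B (a.app B x) : Pt T B)
      (e'.hom.app B (b.app B y) : Pt T B) : Pt (T ⊗ T) B) ≫ fst T T =
      (e'.hom.app B (a.app B x) : Pt T B) := lift_fst _ _
  let p : _root_.eqFunctor a b ⟶ F := { app := fun B => ↾Subtype.val }
  obtain ⟨P, f, -⟩ := IsRep.pullback p (p ≫ a ≫ e'.hom)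
    (natTransOf (fun B x => (lift (e'.hom.app B (a.app B x) : Pt T B)
        (e'.hom.app B (b.app B x) : Pt T B) : Pt (T ⊗ T) B))
      (fun {B C} f x => by
        refine CartesianMonoidalCategory.hom_ext (X := T) (Y := T) _ _ ?_ ?_
        · refine (lift_fst _ _).trans ?_
          refine Eq.trans ?_ (Category.assoc _ _ _).symm
          refine Eq.trans ?_ (congrArg _ (lift_fst _ _).symm)
          exact NatTrans.naturality_apply (a ≫ e'.hom) f x
        · refine (lift_snd _ _).trans ?_
          refine Eq.trans ?_ (Category.assoc _ _ _).symm
          refine Eq.trans ?_ (congrArg _ (lift_snd _ _).symm)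
          exact NatTrans.naturality_apply (b ≫ e'.hom) f x) : F ⟶ points (T ⊗ T))
    (lift (𝟙 T) (𝟙 T)) (by
      ext B x
      refine CartesianMonoidalCategory.hom_ext (X := T) (Y := T) _ _ ?_ ?_
      · refine (Category.assoc _ _ _).trans ?_
        refine (congrArg _ (lift_fst _ _)).trans ?_
        exact (Category.comp_id _).trans (lift_fst _ _).symm
      · refine (Category.assoc _ _ _).trans ?_
        refine (congrArg _ (lift_snd _ _)).trans ?_
        refine (Category.comp_id _).trans (Eq.trans ?_ (lift_snd _ _).symm)
        exact congrArg (e'.hom.app B) x.2)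
    (fun B y v hv => by
      have h1 : v = (e'.hom.app B (a.app B y) : Pt T B) := by
        have := congrArg (fun t : Pt (T ⊗ T) B => t ≫ fst T T) hv
        refine Eq.trans ?_ (this.trans (lift_fst _ _))
        simp
      have h2 : v = (e'.hom.app B (b.app B y) : Pt T B) := by
        have := congrArg (fun t : Pt (T ⊗ T) B => t ≫ snd T T) hv
        refine Eq.trans ?_ (this.trans (lift_snd _ _))
        simp
      refine ⟨⟨y, ((isIso_iff_bijective (e'.hom.app B)).1 inferInstance).1 (h1.symm.trans h2)⟩,
        ⟨rfl, h1.symm⟩, ?_⟩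
      rintro x ⟨hx, -⟩
      exact Subtype.ext hx) e
  exact ⟨P, ⟨f⟩⟩

end Representable

/-! ### Open subfunctors -/

section OpenPoints

variable {k : Type u} [Field k]

theorem preimage_comp_openOverι {S : Over (Spec (.of k))} (U : S.left.Opens)
    {W : Over (Spec (.of k))} (s : W ⟶ openOver S U) : (s ≫ openOverι S U).left ⁻¹ᵁ U = ⊤ := by
  change (s.left ≫ U.ι) ⁻¹ᵁ U = ⊤
  rw [Scheme.Hom.comp_preimage, Scheme.Opens.ι_preimage_self, Scheme.Hom.preimage_top]

/-- A morphism that lands in an open subscheme factors through it. -/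
noncomputable def liftOpen {S : Over (Spec (.of k))} (U : S.left.Opens) {W : Over (Spec (.of k))}
    (s : W ⟶ S) (h : s.left ⁻¹ᵁ U = ⊤) : W ⟶ openOver S U :=
  Over.homMk (IsOpenImmersion.lift U.ι s.left (by
      intro z hz
      obtain ⟨y, rfl⟩ := hz
      rw [Scheme.Opens.range_ι]
      have : y ∈ s.left ⁻¹ᵁ U := h ▸ trivial
      exact this)) ((IsOpenImmersion.lift_fac_assoc _ _ _ _).trans (Over.w s))

@[simp]
theorem liftOpen_ι {S : Over (Spec (.of k))} (U : S.left.Opens) {W : Over (Spec (.of k))}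
    (s : W ⟶ S) (h : s.left ⁻¹ᵁ U = ⊤) : liftOpen U s h ≫ openOverι S U = s := by
  ext1
  exact IsOpenImmersion.lift_fac _ _ _

theorem openOver_hom_ext {S : Over (Spec (.of k))} (U : S.left.Opens) {W : Over (Spec (.of k))}
    {s t : W ⟶ openOver S U} (h : s ≫ openOverι S U = t ≫ openOverι S U) : s = t := by
  ext1
  have := congrArg CommaMorphism.left h
  exact (cancel_mono U.ι).1 this

/-- A functor which embeds into the functor of points of `S`, with image the points that land in an
open subset, is representable. -/
theorem IsRep.of_open {F : CommAlgCat.{u} k ⥤ Type u} {S : Over (Spec (.of k))} (η : F ⟶ points S)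
    (U : S.left.Opens) (hinj : ∀ B, Function.Injective (η.app B))
    (hU : ∀ B (s : Pt S B), (∃ x, (η.app B x : Pt S B) = s) ↔ s.left ⁻¹ᵁ U = ⊤) : IsRep F := by
  have hx (B) (x : F.obj B) : (η.app B x : Pt S B).left ⁻¹ᵁ U = ⊤ := (hU B _).1 ⟨x, rfl⟩
  refine IsRep.of_bijective (G := points (openOver S U)) ⟨_, ⟨Iso.refl _⟩⟩
    (natTransOf (fun B x => (liftOpen U (η.app B x : Pt S B) (hx B x) : Pt (openOver S U) B))
      fun {B C} f x => openOver_hom_ext U ?_) fun B => ⟨fun x y h => ?_, fun s => ?_⟩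
  · refine (liftOpen_ι _ _ _).trans ?_
    refine Eq.trans ?_ (Category.assoc _ _ _).symm
    refine Eq.trans ?_ (congrArg _ (liftOpen_ι _ _ _).symm)
    exact NatTrans.naturality_apply η f x
  · apply hinj B
    have := congrArg (fun t : Pt (openOver S U) B => t ≫ openOverι S U) h
    exact (liftOpen_ι U (η.app B x : Pt S B) (hx B x)).symm.trans
      (this.trans (liftOpen_ι U (η.app B y : Pt S B) (hx B y)))
  · obtain ⟨x, h⟩ := (hU B _).2 (preimage_comp_openOverι U (s : Pt (openOver S U) B))
    exact ⟨x, openOver_hom_ext U ((liftOpen_ι U (η.app B x : Pt S B) (hx B x)).trans h)⟩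

end OpenPoints

/-! ### Smooth morphisms and functors of points -/

section Smooth

open AlgebraicGeometry.AffineSpace

instance isZariskiLocalAtTarget_smooth : IsZariskiLocalAtTarget @AlgebraicGeometry.Smooth.{u} :=
  HasRingHomProperty.instIsZariskiLocalAtTarget (P := @AlgebraicGeometry.Smooth.{u})
    (Q := RingHom.Smooth)

instance smooth_affineSpace {n : Type u} [Finite n] (S : Scheme.{u}) :
    AlgebraicGeometry.Smooth (𝔸(n; S) ↘ S) :=
  (smooth_isStableUnderBaseChange.{u}).of_isPullback (P := @AlgebraicGeometry.Smooth)
    (IsPullback.of_hasPullback _ _).flip <| by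
  have := Limits.isIso_of_isTerminal specULiftZIsTerminal.{u} Limits.terminalIsTerminal
    (Limits.terminal.from _)
  rw [← Limits.terminal.comp_from (Spec.map (CommRingCat.ofHom MvPolynomial.C))]
  have : AlgebraicGeometry.Smooth (Spec.map (CommRingCat.ofHom
      (MvPolynomial.C : ULift.{u} ℤ →+* MvPolynomial n (ULift.{u} ℤ)))) := by
    rw [HasRingHomProperty.Spec_iff (P := @AlgebraicGeometry.Smooth), RingHom.Smooth]
    convert! (⟨inferInstance, inferInstance⟩ :
      Algebra.Smooth (ULift.{u} ℤ) (MvPolynomial n (ULift.{u} ℤ)))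
    exact Algebra.algebra_ext _ _ fun _ ↦ rfl
  infer_instance

variable {k : Type u} [Field k]

/-- The affine space of dimension `r` over a `k`-scheme, as a `k`-scheme. -/
noncomputable abbrev affineOver (S : Over (Spec (.of k))) (r : ℕ) : Over (Spec (.of k)) :=
  Over.mk (𝔸(ULift.{u} (Fin r); S.left) ↘ S.left ≫ S.hom)

/-- The projection of the affine space. -/
noncomputable abbrev affineOverProj (S : Over (Spec (.of k))) (r : ℕ) : affineOver S r ⟶ S :=
  Over.homMk (𝔸(ULift.{u} (Fin r); S.left) ↘ S.left)

/-- Global functions on the spectrum of an algebra. -/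
noncomputable def globalSections (B : CommAlgCat.{u} k) :
    Γ(((algSpec (.of k)).obj (op B)).left, ⊤) ≃+* B :=
  (Scheme.ΓSpecIso (.of B)).commRingCatIsoToRingEquiv

theorem globalSections_map {B C : CommAlgCat.{u} k} (f : B ⟶ C)
    (x : Γ(((algSpec (.of k)).obj (op B)).left, ⊤)) :
    globalSections C (((algSpec (.of k)).map f.op).left.appTop x) = f.hom (globalSections B x) :=
  ConcreteCategory.congr_hom (Scheme.ΓSpecIso_naturality
    (CommRingCat.ofHom (f.hom : B →+* C))) x

/-- The coordinates of a point of an affine space. -/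
noncomputable def affineCoord {S : Over (Spec (.of k))} {r : ℕ} {B : CommAlgCat.{u} k}
    (a : Pt (affineOver S r) B) (i : Fin r) : B :=
  globalSections B (a.left.appTop (coord S.left ⟨i⟩))

theorem affineCoord_res {S : Over (Spec (.of k))} {r : ℕ} {B C : CommAlgCat.{u} k}
    (a : Pt (affineOver S r) B) (f : B ⟶ C) (i : Fin r) :
    affineCoord (a.res f) i = f.hom (affineCoord a i) := by
  rw [affineCoord, affineCoord, ← globalSections_map]
  rfl

theorem affineOver_ext {S : Over (Spec (.of k))} {r : ℕ} {B : CommAlgCat.{u} k}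
    {a b : Pt (affineOver S r) B} (h : a ≫ affineOverProj S r = b ≫ affineOverProj S r)
    (h' : affineCoord a = affineCoord b) : a = b := by
  ext1
  refine AffineSpace.hom_ext (congrArg CommaMorphism.left h) fun i => ?_
  exact (globalSections B).injective (congrFun h' i.down)

theorem exists_affineOver {S : Over (Spec (.of k))} {r : ℕ} {B : CommAlgCat.{u} k}
    (s : Pt S B) (v : Fin r → B) :
    ∃ a : Pt (affineOver S r) B, a ≫ affineOverProj S r = s ∧ affineCoord a = v := by
  refine ⟨Over.homMk (homOfVector s.left fun i => (globalSections B).symm (v i.down)) ?_, ?_, ?_⟩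
  · exact (homOfVector_over_assoc _ _ _).trans (Over.w s)
  · ext1
    simp
  · funext i
    refine (congrArg (globalSections B) (homOfVector_appTop_coord _ _ _)).trans ?_
    simp

/-- A morphism is smooth if, locally on the target, its functor of points is a relative affine
space. -/
theorem smooth_of_locally_affineSpace {S T : Over (Spec (.of k))} (f : S ⟶ T)
    (h : ∀ x : T.left, ∃ (U : T.left.Opens) (r : ℕ)
      (t : ∀ {B : CommAlgCat.{u} k} (s : Pt T B), s.left ⁻¹ᵁ U = ⊤ →
        (SectionsOver f s ≃ (Fin r → B))),
      x ∈ U ∧ ∀ {B C : CommAlgCat.{u} k} (φ : B ⟶ C) (s : Pt T B) (hs : s.left ⁻¹ᵁ U = ⊤)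
        (hs' : (s.res φ).left ⁻¹ᵁ U = ⊤) (v : SectionsOver f s),
        t (s.res φ) hs' (v.res φ) = fun a => φ.hom (t s hs v a)) :
    AlgebraicGeometry.Smooth f.left := by
  refine IsZariskiLocalAtTarget.of_forall_exists_morphismRestrict fun x => ?_
  obtain ⟨U, r, t, hxU, ht⟩ := h x
  refine ⟨U, hxU, ?_⟩
  let A := affineOver (openOver T U) r
  let N := openOver S (f.left ⁻¹ᵁ U)
  let q : N ⟶ openOver T U := Over.homMk (f.left ∣_ U) (by
    change (f.left ∣_ U) ≫ U.ι ≫ T.hom = (f.left ⁻¹ᵁ U).ι ≫ S.hom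
    rw [morphismRestrict_ι_assoc]
    exact congrArg _ (Over.w f))
  have hq : q ≫ openOverι T U = openOverι S (f.left ⁻¹ᵁ U) ≫ f := by
    ext1
    simp [q]
  let base {B : CommAlgCat.{u} k} (a : Pt A B) : Pt T B :=
    (a ≫ affineOverProj (openOver T U) r) ≫ openOverι T U
  have hbase {B : CommAlgCat.{u} k} (a : Pt A B) : (base a).left ⁻¹ᵁ U = ⊤ :=
    preimage_comp_openOverι U _
  let sec {B : CommAlgCat.{u} k} (a : Pt A B) : SectionsOver f (base a) :=
    (t (base a) (hbase a)).symm (affineCoord a)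
  have hsec {B : CommAlgCat.{u} k} (a : Pt A B) : (sec a).1.left ⁻¹ᵁ (f.left ⁻¹ᵁ U) = ⊤ := by
    rw [← Scheme.Hom.comp_preimage, ← Over.comp_left, (sec a).2, hbase]
  have hbr {B C : CommAlgCat.{u} k} (φ : B ⟶ C) (a : Pt A B) :
      base (a.res φ) = (base a).res φ := by
    simp only [base, Pt.res, Category.assoc]
  have key {B C : CommAlgCat.{u} k} (φ : B ⟶ C) (a : Pt A B) (s : Pt T C)
      (hs : s.left ⁻¹ᵁ U = ⊤) (e : (base a).res φ = s) :
      ((t s hs).symm (affineCoord (a.res φ))).1 = (sec a).1.res φ := by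
    subst e
    have h1 : (t _ hs).symm (affineCoord (a.res φ)) = (sec a).res φ := by
      rw [Equiv.symm_apply_eq, ht φ (base a) (hbase a) hs]
      funext i
      rw [affineCoord_res]
      simp [sec]
    rw [h1]
    rfl
  let η : points A ⟶ points N := natTransOf
    (fun B a => (liftOpen (f.left ⁻¹ᵁ U) (sec a).1 (hsec a) : Pt N B))
    (fun {B C} φ a => by
      refine openOver_hom_ext _ ?_
      refine (liftOpen_ι _ _ _).trans ?_
      refine Eq.trans ?_ (Category.assoc _ _ _).symm
      refine Eq.trans ?_ (congrArg _ (liftOpen_ι _ _ _).symm)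
      exact key φ a _ _ (hbr φ a).symm)
  have hη {B : CommAlgCat.{u} k} (a : Pt A B) : (η.app B a : Pt N B) ≫ openOverι S (f.left ⁻¹ᵁ U) =
      (sec a).1 := liftOpen_ι _ _ (hsec a)
  have hηq {B : CommAlgCat.{u} k} (a : Pt A B) : (η.app B a : Pt N B) ≫ q =
      a ≫ affineOverProj (openOver T U) r := by
    refine openOver_hom_ext _ ?_
    refine (Category.assoc _ _ _).trans ((congrArg _ hq).trans ?_)
    exact (Category.assoc _ _ _).symm.trans ((congrArg (· ≫ f) (hη a)).trans (sec a).2)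
  have hiso : IsIso η := by
    refine isIso_of_bijective _ fun B => ⟨fun a b hab => ?_, fun n => ?_⟩
    · change Pt A B at a b
      have h0 : a ≫ affineOverProj (openOver T U) r = b ≫ affineOverProj (openOver T U) r := by
        rw [← hηq, ← hηq, hab]
      refine affineOver_ext h0 ?_
      have h1 : (sec a).1 = (sec b).1 := by rw [← hη, ← hη, hab]
      have h2 : base a = base b := congrArg (· ≫ openOverι T U) h0
      have gen : ∀ (s s' : Pt T B) (hs hs') (v v'), s = s' →
          ((t s hs).symm v).1 = ((t s' hs').symm v').1 → v = v' := by
        rintro s _ hs hs' v v' rfl e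
        exact (t s hs).symm.injective (Subtype.ext e)
      exact gen _ _ _ _ _ _ h2 h1
    · change Pt N B at n
      have hn : (n ≫ q) ≫ openOverι T U = (n ≫ openOverι S (f.left ⁻¹ᵁ U)) ≫ f := by
        rw [Category.assoc, hq, Category.assoc]
      let v : SectionsOver f ((n ≫ q) ≫ openOverι T U) := ⟨n ≫ openOverι S (f.left ⁻¹ᵁ U), hn.symm⟩
      obtain ⟨a, ha, hav⟩ := exists_affineOver (n ≫ q) (t _ (preimage_comp_openOverι U (n ≫ q)) v)
      refine ⟨a, openOver_hom_ext _ ((hη a).trans ?_)⟩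
      have gen : ∀ (s s' : Pt T B) (hs hs') (w : Fin r → B) (v' : SectionsOver f s'), s = s' →
          w = t s' hs' v' → ((t s hs).symm w).1 = v'.1 := by
        rintro s _ hs hs' w v' rfl rfl
        simp
      exact gen _ _ _ _ _ v (congrArg (· ≫ openOverι T U) ha) hav
  obtain ⟨g, hg⟩ := exists_pointsMap_eq η
  have hgiso : IsIso g := by
    have : IsIso ((pointsFunctor k).map g) := by
      change IsIso (pointsMap g)
      rw [hg]; exact hiso
    exact isIso_of_reflects_iso g (pointsFunctor k)
  have hgq : g ≫ q = affineOverProj (openOver T U) r := by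
    apply pointsMap_injective
    ext B a
    change Pt A B at a
    refine Eq.trans ?_ (hηq a)
    rw [← hg]
    exact (Category.assoc _ _ _).symm
  have : IsIso g.left := inferInstanceAs (IsIso ((Over.forget _).map g))
  have hq' : q.left = inv g.left ≫ (𝔸(ULift.{u} (Fin r); (openOver T U).left) ↘ _) := by
    rw [IsIso.eq_inv_comp]
    exact congrArg CommaMorphism.left hgq
  change AlgebraicGeometry.Smooth q.left
  rw [hq']
  infer_instance

end Smooth

/-! ### Projections of vector bundles -/

section VectorBundle

variable {k : Type u} [Field k] {S : Over (Spec (.of k))} (V : GeomVectorBundle S)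

theorem GeomVectorBundle.smooth_proj : AlgebraicGeometry.Smooth V.proj.left :=
  smooth_of_locally_affineSpace V.proj fun x => by
    obtain ⟨U, r, t, hx, ht⟩ := V.locallyTrivial x
    exact ⟨U, r, fun s hs => (t s hs).toEquiv, hx, fun f s hs hs' v => ht f s hs hs' v⟩

/-- Every element of a scheme is in the image of a point with values in an algebra, namely its residue
field. -/
theorem exists_residuePoint (S : Over (Spec (.of k))) (x : S.left) :
    ∃ (K : CommAlgCat.{u} k) (s : Pt S K) (y : ((algSpec (.of k)).obj (op K)).left),
      s.left y = x := by
  let W : Over (Spec (.of k)) := Over.mk (S.left.fromSpecResidueField x ≫ S.hom)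
  have : IsAffine W.left := inferInstanceAs (IsAffine (Spec _))
  obtain ⟨K, ⟨e⟩⟩ := exists_algSpec_iso W
  let w : W ⟶ S := Over.homMk (S.left.fromSpecResidueField x)
  obtain ⟨z, hz⟩ : ∃ z : W.left, w.left z = x := by
    have := S.left.range_fromSpecResidueField x
    have hx : x ∈ Set.range (S.left.fromSpecResidueField x) := by rw [this]; rfl
    exact hx
  refine ⟨K, e.hom ≫ w, e.inv.left z, ?_⟩
  rw [← hz, ← Scheme.Hom.comp_apply, ← Over.comp_left]
  simp

/-- The zero section shows that the projection of a vector bundle is surjective. -/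
theorem GeomVectorBundle.surjective_proj : AlgebraicGeometry.Surjective V.proj.left := by
  refine ⟨fun x => ?_⟩
  obtain ⟨K, s, y, hy⟩ := exists_residuePoint S x
  refine ⟨(0 : SectionsOver V.proj s).1.left y, ?_⟩
  rw [← Scheme.Hom.comp_apply, ← Over.comp_left, (0 : SectionsOver V.proj s).2, hy]

end VectorBundle

/-! ### Families of morphisms and the differential equation of the nerve -/

section Families

/-- The elements of a finite set that are smaller than `v`. -/
def below {ι : Type} [LinearOrder ι] (s : Finset ι) (v : ι) : Finset ι := s.filter (· < v)

/-- The elements of a finite set that are larger than `v`. -/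
def above {ι : Type} [LinearOrder ι] (s : Finset ι) (v : ι) : Finset ι := s.filter (v < ·)

section

variable {ι : Type} [LinearOrder ι] {s : Finset ι} {v w : ι}

@[simp] theorem mem_below : w ∈ below s v ↔ w ∈ s ∧ w < v := by simp [below]

@[simp] theorem mem_above : w ∈ above s v ↔ w ∈ s ∧ v < w := by simp [above]

theorem above_above (h : v < w) : above (above s v) w = above s w := by
  ext x
  simp only [mem_above]
  exact ⟨fun h => ⟨h.1.1, h.2⟩, fun h' => ⟨⟨h'.1, h.trans h'.2⟩, h'.2⟩⟩

theorem below_below (h : v < w) : below (below s w) v = below s v := by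
  ext x
  simp only [mem_below]
  exact ⟨fun h => ⟨h.1.1, h.2⟩, fun h' => ⟨⟨h'.1, h'.2.trans h⟩, h'.2⟩⟩

theorem below_above : below (above s v) w = above (below s w) v := by
  ext x; simp only [mem_below, mem_above]; tauto

theorem above_erase : above (s.erase w) v = (above s v).erase w := by
  ext x; simp only [mem_above, Finset.mem_erase]; tauto

theorem below_erase : below (s.erase w) v = (below s v).erase w := by
  ext x; simp only [mem_below, Finset.mem_erase]; tauto

theorem above_erase_of_le (h : v ≤ w) : above (s.erase v) w = above s w := by
  rw [above_erase, Finset.erase_eq_of_notMem]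
  simp [h]

theorem below_erase_of_le (h : v ≤ w) : below (s.erase w) v = below s v := by
  rw [below_erase, Finset.erase_eq_of_notMem]
  simp [h]

theorem card_above (hw : w ∈ s) (h : v < w) :
    (above s v).card = (above s w).card + (above (below s w) v).card + 1 := by
  have h1 : above s v = (above s w ∪ above (below s w) v) ∪ {w} := by
    ext x
    simp only [mem_above, mem_below, Finset.mem_union, Finset.mem_singleton]
    constructor
    · intro hx
      rcases lt_trichotomy x w with h' | h' | h' <;> tauto
    · rintro ((hx | hx) | rfl)
      · exact ⟨hx.1, h.trans hx.2⟩
      · exact ⟨hx.1.1, hx.2⟩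
      · exact ⟨hw, h⟩
  rw [h1, Finset.card_union_of_disjoint, Finset.card_union_of_disjoint, Finset.card_singleton]
  · rw [Finset.disjoint_left]
    intro x
    simp only [mem_above, mem_below]
    exact fun h1 h2 => lt_asymm h1.2 h2.1.2
  · simp

theorem card_above_add_card_below (hv : v ∈ s) :
    (above s v).card + (below s v).card + 1 = s.card := by
  have h1 : s = (above s v ∪ below s v) ∪ {v} := by
    ext x
    simp only [mem_above, mem_below, Finset.mem_union, Finset.mem_singleton]
    constructor
    · intro hx
      rcases lt_trichotomy x v with h' | h' | h' <;> tauto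
    · rintro ((hx | hx) | rfl) <;> tauto
  conv_rhs => rw [h1]
  rw [Finset.card_union_of_disjoint, Finset.card_union_of_disjoint, Finset.card_singleton]
  · rw [Finset.disjoint_left]
    intro x
    simp only [mem_above, mem_below]
    exact fun h1 h2 => lt_asymm h1.2 h2.2
  · simp

theorem erase_eq_union : s.erase v = above s v ∪ below s v := by
  ext x
  simp only [Finset.mem_erase, mem_above, mem_below, Finset.mem_union, ne_iff_lt_or_gt]
  tauto

theorem sum_erase {G : Type u} [AddCommGroup G] (f : ι → G) :
    ∑ w ∈ s.erase v, f w = ∑ w ∈ above s v, f w + ∑ w ∈ below s v, f w := by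
  rw [erase_eq_union, Finset.sum_union]
  rw [Finset.disjoint_left]
  intro x
  simp only [mem_above, mem_below]
  exact fun h1 h2 => lt_asymm h1.2 h2.2

/-- The signs and degrees for the cancellation in `MorFamily.sum_bd_bd`: each of the four terms attached
to a pair `v < w` occurs twice, with opposite signs. -/
theorem pair_cancel {G : Type u} [AddCommGroup G] {n₁ n₂ n₃ n₄ n₅ m : ℕ} {a a' b b' c c' e e' : G}
    (ha : a = a') (hb : b = b') (hc : c = c') (he : e = e') (h₁ : n₁ = n₂ + m + 1) (h₃ : n₃ = n₂)
    (h₄ : n₄ = n₂) (h₅ : n₅ + 1 = n₁) :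
    ((-1 : ℤ) ^ n₁ * (-1) ^ n₃) • (a - b) + ((-1 : ℤ) ^ n₂ * ((-1) ^ n₂ * (-1) ^ m)) • (a' - c) =
      ((-1 : ℤ) ^ n₁ * (-1) ^ n₄) • (c' - e) + ((-1 : ℤ) ^ n₂ * (-1) ^ n₅) • (b' - e') := by
  obtain rfl : n₅ = n₂ + m := by omega
  subst ha hb hc he h₁ h₃ h₄
  have h : (-1 : ℤ) ^ n₄ * (-1) ^ n₄ = 1 := by rw [← mul_pow]; simp
  have e1 : (-1 : ℤ) ^ (n₄ + m + 1) * (-1) ^ n₄ = -(-1) ^ m := by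
    rw [pow_succ, pow_add]; linear_combination (-(-1 : ℤ) ^ m) * h
  have e2 : (-1 : ℤ) ^ n₄ * ((-1) ^ n₄ * (-1) ^ m) = (-1) ^ m := by
    linear_combination ((-1 : ℤ) ^ m) * h
  have e3 : (-1 : ℤ) ^ n₄ * (-1) ^ (n₄ + m) = (-1) ^ m := by
    rw [pow_add]; linear_combination ((-1 : ℤ) ^ m) * h
  rw [e1, e2, e3]
  simp only [neg_smul, smul_sub]
  abel

theorem sum_below_comm {G : Type u} [AddCommGroup G] (f : ι → ι → G) :
    ∑ w ∈ s, ∑ v ∈ below s w, f w v = ∑ v ∈ s, ∑ w ∈ above s v, f w v := by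
  refine Finset.sum_comm' fun x y => ?_
  simp only [mem_above, mem_below]
  tauto

end

variable {B : Type u} [CommRing B]

theorem negOnePow_neg_smul {G : Type u} [AddCommGroup G] (n : ℕ) (x : G) :
    (-(n : ℤ)).negOnePow • x = ((-1 : ℤ) ^ n) • x := by
  rw [Int.negOnePow_neg, Units.smul_def, Int.coe_negOnePow_natCast]

/-- A family of morphisms `α(i, s, j)` of all degrees between the objects `X i` and `X j`, for all
`i`, `j` and all finite sets `s`. It is to be thought of as giving the morphism attached to the
sequence which starts in `i`, runs through `s` and ends in `j`; only the elements in degree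
`-s.card`, where `i < j` and `s` lies between `i` and `j`, have a meaning. -/
abbrev MorFamily (A : DGCat B) {ι : Type} (X : ι → A.Obj) : Type u :=
  ∀ (i j : ι) (_ : Finset ι) (p : ℤ), A.Hom p (X i) (X j)

namespace MorFamily

variable {A : DGCat B} {ι : Type} {X : ι → A.Obj} (α : MorFamily A X)

theorem comp_congr {i v j : ι} {s s' t t' : Finset ι} {p p' q q' r : ℤ} (hs : s = s') (ht : t = t')
    (hp : p = p') (hq : q = q') (hr : p + q = r) (hr' : p' + q' = r) :
    A.comp hr (α v j t q) (α i v s p) = A.comp hr' (α v j t' q') (α i v s' p') := by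
  subst hs ht hp hq
  rfl

theorem comp_comp_congr {i v w j : ι} {s s' t t' z z' : Finset ι} {p p' q q' r r' pq qr m : ℤ}
    (hs : s = s') (ht : t = t') (hz : z = z') (hp : p = p') (hq : q = q') (hr : r = r')
    (hqr : q + r = qr) (h : p + qr = m) (hpq : p' + q' = pq) (h' : pq + r' = m) :
    A.comp h (A.comp hqr (α w j z r) (α v w t q)) (α i v s p) =
      A.comp h' (α w j z' r') (A.comp hpq (α v w t' q') (α i v s' p')) := by
  subst hs ht hz hp hq hr
  exact (A.assoc hpq hqr h' h _ _ _).symm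

variable [LinearOrder ι]

/-- The right-hand side of the differential equation of the coherent nerve. -/
def bd (i j : ι) (s : Finset ι) (q : ℤ) : A.Hom q (X i) (X j) :=
  ∑ v ∈ s, ((-1 : ℤ) ^ (above s v).card) •
    (A.comp (add_neg_cancel_right q ((above s v).card : ℤ)) (α v j (above s v) _)
      (α i v (below s v) _) - α i j (s.erase v) q)

/-- The formal part of `d ∘ d = 0`: the terms of the iterated right-hand side of the differential
equation cancel in pairs. -/
theorem sum_bd_bd (i j : ι) (s : Finset ι) (q : ℤ) :
    ∑ v ∈ s, ((-1 : ℤ) ^ (above s v).card) •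
      (A.comp (by omega : q + ((above s v).card : ℤ) + (-((above s v).card : ℤ) + 1) = q + 1)
          (α.bd v j (above s v) (-((above s v).card : ℤ) + 1)) (α i v (below s v) _) +
        ((-1 : ℤ) ^ (above s v).card) • A.comp
          (by omega : q + ((above s v).card : ℤ) + 1 + -((above s v).card : ℤ) = q + 1)
          (α v j (above s v) _) (α.bd i v (below s v) (q + (above s v).card + 1))) =
    ∑ v ∈ s, ((-1 : ℤ) ^ (above s v).card) • α.bd i j (s.erase v) (q + 1) := by
  simp only [bd, smul_add, Finset.sum_add_distrib, sum_erase, smul_smul, map_sum,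
    map_zsmul, map_sub, LinearMap.sum_apply, LinearMap.smul_apply, LinearMap.sub_apply, Finset.smul_sum]
  -- all terms are indexed by the pairs `v < w` in `s`
  rw [sum_below_comm, sum_below_comm, ← Finset.sum_add_distrib, ← Finset.sum_add_distrib]
  refine Finset.sum_congr rfl fun v hv => ?_
  rw [← Finset.sum_add_distrib, ← Finset.sum_add_distrib]
  refine Finset.sum_congr rfl fun w hw => ?_
  obtain ⟨hws, hvw⟩ := mem_above.1 hw
  have hcard := card_above hws hvw
  have e1 : (above (s.erase v) w).card = (above s w).card := by rw [above_erase_of_le hvw.le]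
  have e2 : (above (s.erase w) v).card + 1 = (above s v).card := by
    rw [above_erase, Finset.card_erase_of_mem hw]
    have := Finset.card_pos.2 ⟨w, hw⟩
    omega
  have e3 : (above (above s v) w).card = (above s w).card := by rw [above_above hvw]
  refine pair_cancel ?_ ?_ ?_ ?_ hcard e3 e1 e2
  · exact α.comp_comp_congr (below_below hvw).symm below_above (above_above hvw)
      (by omega) (by omega) (by omega) _ _ _ _
  · exact α.comp_congr (below_erase_of_le hvw.le).symm above_erase.symm (by omega) (by omega) _ _
  · exact α.comp_congr below_erase.symm (above_erase_of_le hvw.le).symm (by omega) (by omega) _ _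
  · rw [Finset.erase_right_comm]

/-- If the differential equation holds for all the proper parts `(v, j)` and `(i, v)` of `(i, j)`,
then the differential of its right-hand side measures the failure of the equation on the faces. -/
theorem d_bd {i j : ι} {s : Finset ι} {q q' : ℤ} (hq : q + 1 = q')
    (hab : ∀ v ∈ s, ∀ (p p' : ℤ) (h : p + 1 = p'), p + (above s v).card = 0 →
      A.d h (α v j (above s v) p) = α.bd v j (above s v) p')
    (hbe : ∀ v ∈ s, ∀ (p p' : ℤ) (h : p + 1 = p'), p = q + (above s v).card →
      A.d h (α i v (below s v) p) = α.bd i v (below s v) p') :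
    A.d hq (α.bd i j s q) = ∑ v ∈ s, ((-1 : ℤ) ^ (above s v).card) •
      (α.bd i j (s.erase v) q' - A.d hq (α i j (s.erase v) q)) := by
  subst hq
  simp only [smul_sub, Finset.sum_sub_distrib]
  rw [← sum_bd_bd, ← Finset.sum_sub_distrib, bd, map_sum]
  refine Finset.sum_congr rfl fun v hv => ?_
  rw [map_zsmul, map_sub, ← smul_sub]
  congr 2
  rw [A.leibniz _ rfl rfl rfl (by omega) (by omega), hab v hv _ _ _ (by omega),
    hbe v hv _ _ _ rfl, negOnePow_neg_smul]

/-- The right-hand side of the differential equation only depends on the values of the family at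
proper parts and faces. -/
theorem bd_congr {α β : MorFamily A X} {i j : ι} {s : Finset ι} {q : ℤ}
    (h₁ : ∀ v ∈ s, ∀ p, α v j (above s v) p = β v j (above s v) p)
    (h₂ : ∀ v ∈ s, ∀ p, α i v (below s v) p = β i v (below s v) p)
    (h₃ : ∀ v ∈ s, ∀ p, α i j (s.erase v) p = β i j (s.erase v) p) :
    α.bd i j s q = β.bd i j s q :=
  Finset.sum_congr rfl fun v hv => by rw [h₁ v hv, h₂ v hv, h₃ v hv]

end MorFamily

end Families

/-! ### Increasing lists and finite sets -/

section Lists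

variable {ι : Type} [LinearOrder ι] {l : List ι}

theorem toFinset_drop_succ (hl : l.Pairwise (· < ·)) (t : ℕ) (ht : t < l.length) :
    (l.drop (t + 1)).toFinset = above l.toFinset l[t] := by
  rw [List.pairwise_iff_getElem] at hl
  ext x
  rw [List.mem_toFinset, mem_above, List.mem_drop_iff_getElem, List.mem_toFinset,
    List.mem_iff_getElem]
  constructor
  · rintro ⟨j, hj, rfl⟩
    exact ⟨⟨_, _, rfl⟩, hl _ _ _ _ (by omega)⟩
  · rintro ⟨⟨j, hj, rfl⟩, h⟩
    have : t < j := by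
      by_contra hjt
      rcases (not_lt.1 hjt).lt_or_eq with h' | rfl
      · exact lt_asymm h (hl _ _ _ _ h')
      · exact lt_irrefl _ h
    obtain ⟨c, rfl⟩ := Nat.exists_eq_add_of_lt this
    exact ⟨c, by omega, by congr 1; omega⟩

theorem toFinset_take (hl : l.Pairwise (· < ·)) (t : ℕ) (ht : t < l.length) :
    (l.take t).toFinset = below l.toFinset l[t] := by
  rw [List.pairwise_iff_getElem] at hl
  ext x
  rw [List.mem_toFinset, mem_below, List.mem_take_iff_getElem, List.mem_toFinset,
    List.mem_iff_getElem]
  constructor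
  · rintro ⟨j, hj, rfl⟩
    exact ⟨⟨_, _, rfl⟩, hl _ _ _ _ (by omega)⟩
  · rintro ⟨⟨j, hj, rfl⟩, h⟩
    have : j < t := by
      by_contra hjt
      rcases (not_lt.1 hjt).lt_or_eq with h' | rfl
      · exact lt_asymm h (hl _ _ _ _ h')
      · exact lt_irrefl _ h
    exact ⟨j, by omega, rfl⟩

theorem toFinset_eraseIdx (hl : l.Pairwise (· < ·)) (t : ℕ) (ht : t < l.length) :
    (l.eraseIdx t).toFinset = l.toFinset.erase l[t] := by
  have hn : l.Nodup := hl.imp fun h => h.ne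
  ext x
  rw [List.mem_toFinset, Finset.mem_erase, List.mem_eraseIdx_iff_getElem, List.mem_toFinset,
    List.mem_iff_getElem]
  constructor
  · rintro ⟨j, hj, hjt, rfl⟩
    exact ⟨fun h => hjt (hn.getElem_inj_iff.1 h), _, _, rfl⟩
  · rintro ⟨h, j, hj, rfl⟩
    exact ⟨j, hj, fun h' => h (by subst h'; rfl), rfl⟩

theorem sum_toFinset_eq_sum_fin {G : Type u} [AddCommGroup G] (hl : l.Nodup) (f : ι → G) :
    ∑ v ∈ l.toFinset, f v = ∑ t : Fin l.length, f l[t] := by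
  refine (Finset.sum_bij (fun (t : Fin l.length) _ => l[t]) ?_ ?_ ?_ ?_).symm
  · intro t _
    simp
  · intro t _ t' _ h
    exact Fin.ext (hl.getElem_inj_iff.1 h)
  · intro v hv
    obtain ⟨t, ht, rfl⟩ := List.mem_iff_getElem.1 (List.mem_toFinset.1 hv)
    exact ⟨⟨t, ht⟩, Finset.mem_univ _, rfl⟩
  · intro t _
    rfl

end Lists

/-! ### The family of morphisms of a simplex -/

section Strict

/-- The finite set `s` lies strictly between `i` and `j`. -/
def IsBetween {ι : Type} [LinearOrder ι] (i j : ι) (s : Finset ι) : Prop :=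
  i < j ∧ ∀ v ∈ s, i < v ∧ v < j

namespace Chain

variable {n : ℕ} {i j : Fin (n + 1)}

theorem strict_of_nodup {c : Chain n i j} (hc : c.vertices.Nodup) :
    c.vertices.Pairwise (· < ·) := by
  have := List.pairwise_and_iff.2 ⟨c.sorted, hc⟩
  exact this.imp fun h => lt_of_le_of_ne h.1 h.2

theorem inner_strict {c : Chain n i j} (hc : c.vertices.Nodup) : c.inner.Pairwise (· < ·) :=
  (strict_of_nodup hc).sublist ((List.sublist_append_left _ _).trans (List.sublist_cons_self _ _))

theorem isBetween {c : Chain n i j} (hc : c.vertices.Nodup) :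
    IsBetween i j c.inner.toFinset := by
  have h := strict_of_nodup hc
  rw [vertices, List.pairwise_cons, List.pairwise_append] at h
  refine ⟨h.1 j (by simp), fun v hv => ?_⟩
  rw [List.mem_toFinset] at hv
  exact ⟨h.1 v (by simp [hv]), h.2.2.2 v hv j (by simp)⟩

theorem nodup_of_isBetween {c : Chain n i j} (hc : c.inner.Nodup)
    (h : IsBetween i j c.inner.toFinset) : c.vertices.Nodup := by
  rw [vertices, List.nodup_cons, List.nodup_append]
  refine ⟨?_, hc, by simp, ?_⟩
  · intro hi
    rw [List.mem_append, List.mem_singleton] at hi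
    rcases hi with hi | hi
    · exact (h.2 i (List.mem_toFinset.2 hi)).1.false
    · exact h.1.ne hi
  · rintro v hv w hw rfl
    rw [List.mem_singleton] at hw
    subst hw
    exact (h.2 _ (List.mem_toFinset.2 hv)).2.false

/-- The strictly increasing sequence from `i` through `s` to `j`. -/
def ofFinset {s : Finset (Fin (n + 1))} (h : IsBetween i j s) : Chain n i j :=
  ⟨s.sort (· ≤ ·), by
    rw [List.pairwise_cons, List.pairwise_append]
    refine ⟨fun v hv => ?_, s.pairwise_sort _, by simp, fun v hv w hw => ?_⟩
    · rw [List.mem_append, Finset.mem_sort, List.mem_singleton] at hv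
      rcases hv with hv | rfl
      · exact (h.2 v hv).1.le
      · exact h.1.le
    · rw [List.mem_singleton] at hw
      subst hw
      exact (h.2 v ((Finset.mem_sort _).1 hv)).2.le⟩

@[simp]
theorem ofFinset_toFinset {s : Finset (Fin (n + 1))} (h : IsBetween i j s) :
    (ofFinset h).inner.toFinset = s := s.sort_toFinset _

@[simp]
theorem ofFinset_length {s : Finset (Fin (n + 1))} (h : IsBetween i j s) :
    (ofFinset h).inner.length = s.card := s.length_sort _

theorem ofFinset_nodup {s : Finset (Fin (n + 1))} (h : IsBetween i j s) :
    (ofFinset h).vertices.Nodup :=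
  nodup_of_isBetween (s.sort_nodup _) (by simpa using h)

theorem eq_ofFinset {c : Chain n i j} (hc : c.vertices.Nodup) : c = ofFinset (isBetween hc) := by
  refine Chain.ext ?_
  have h1 : c.inner.Pairwise (· ≤ ·) := (inner_strict hc).imp le_of_lt
  refine List.Perm.eq_of_pairwise' h1 (Finset.pairwise_sort c.inner.toFinset (· ≤ ·)) ?_
  refine (List.perm_ext_iff_of_nodup ((inner_strict hc).imp fun h => h.ne)
    (Finset.sort_nodup c.inner.toFinset (· ≤ ·))).2 fun v => ?_
  simp

theorem front_sublist (c : Chain n i j) (s : Fin c.inner.length) :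
    (c.front s).vertices.Sublist c.vertices := by
  refine List.Sublist.cons_cons _ ?_
  have h : c.inner.take s ++ [c.inner[s]] = c.inner.take (s + 1) := by simp
  change (c.inner.take s ++ [c.inner[s]]).Sublist _
  rw [h]
  exact (List.take_sublist _ _).trans (List.sublist_append_left _ _)

theorem back_sublist (c : Chain n i j) (s : Fin c.inner.length) :
    (c.back s).vertices.Sublist c.vertices := by
  refine List.Sublist.cons _ ?_
  change (c.inner[s] :: (c.inner.drop (s + 1) ++ [j])).Sublist _
  rw [← List.cons_append]
  refine List.Sublist.append_right ?_ _
  have h : c.inner[s] :: c.inner.drop (s + 1) = c.inner.drop s := by simp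
  rw [h]
  exact List.drop_sublist _ _

theorem face_sublist (c : Chain n i j) (s : Fin c.inner.length) :
    (c.face s).vertices.Sublist c.vertices :=
  List.Sublist.cons_cons _ (List.Sublist.append_right (List.eraseIdx_sublist _ _) _)

/-- For a strictly increasing sequence, the sum in the definition of the coherent nerve is the
right-hand side `MorFamily.bd` of the differential equation for the associated family. -/
theorem sum_eq_bd {B : Type u} [CommRing B] {A : DGCat B} {X : Fin (n + 1) → A.Obj}
    (hom : ∀ {i j : Fin (n + 1)} (c : Chain n i j) (p : ℤ), p + c.inner.length = 0 →
      A.Hom p (X i) (X j)) (α : MorFamily A X)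
    (hα : ∀ {i j : Fin (n + 1)} (c : Chain n i j) (p : ℤ) (hp : p + c.inner.length = 0),
      c.vertices.Nodup → hom c p hp = α i j c.inner.toFinset p)
    (c : Chain n i j) (hc : c.vertices.Nodup) (q : ℤ) (hq : q + c.inner.length = 1) :
    ∑ s : Fin c.inner.length, ((-1 : ℤ) ^ (c.back s).inner.length) •
      (A.comp (p := -(c.front s).inner.length) (q := -(c.back s).inner.length)
          (by have := c.length_front_add_back s; omega)
          (hom (c.back s) _ (neg_add_cancel _)) (hom (c.front s) _ (neg_add_cancel _))
        - hom (c.face s) q (by have := c.length_face s; omega)) =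
      α.bd i j c.inner.toFinset q := by
  have hl := inner_strict hc
  have hn : c.inner.Nodup := hl.imp fun h => h.ne
  rw [MorFamily.bd, sum_toFinset_eq_sum_fin hn]
  refine Finset.sum_congr rfl fun s _ => ?_
  rw [hα _ _ _ (hc.sublist (c.front_sublist s)), hα _ _ _ (hc.sublist (c.back_sublist s)),
    hα _ _ _ (hc.sublist (c.face_sublist s))]
  have e1 : (c.back s).inner.toFinset = above c.inner.toFinset c.inner[s] :=
    toFinset_drop_succ hl s s.2
  have e2 : (c.front s).inner.toFinset = below c.inner.toFinset c.inner[s] :=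
    toFinset_take hl s s.2
  have e3 : (c.face s).inner.toFinset = c.inner.toFinset.erase c.inner[s] :=
    toFinset_eraseIdx hl s s.2
  have l1 : (above c.inner.toFinset c.inner[s]).card = (c.back s).inner.length := by
    rw [← e1, List.toFinset_card_of_nodup]
    exact hn.sublist (List.drop_sublist _ _)
  have := c.length_front_add_back s
  refine congrArg₂ (· • ·) (by rw [l1]) (congrArg₂ (· - ·) ?_ (by rw [e3]))
  exact α.comp_congr e2 e1 (by omega) (by omega) _ _

end Chain

namespace NCSimplex

variable {B : Type u} [CommRing B] {A : DGCat B} {n : ℕ}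

/-- The family of morphisms attached to the strictly increasing sequences by a simplex. -/
noncomputable def family (σ : NCSimplex A n) : MorFamily A σ.obj := fun i j s p =>
  open Classical in
  if h : IsBetween i j s ∧ p + s.card = 0 then
    σ.hom (Chain.ofFinset h.1) p (by rw [Chain.ofFinset_length]; exact h.2) else 0

theorem family_of_not (σ : NCSimplex A n) {i j : Fin (n + 1)} {s : Finset (Fin (n + 1))} {p : ℤ}
    (h : ¬ (IsBetween i j s ∧ p + s.card = 0)) : σ.family i j s p = 0 := dif_neg h

theorem hom_eq_family (σ : NCSimplex A n) {i j : Fin (n + 1)} (c : Chain n i j) (p : ℤ)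
    (hp : p + c.inner.length = 0) (hc : c.vertices.Nodup) :
    σ.hom c p hp = σ.family i j c.inner.toFinset p := by
  have hn : c.inner.Nodup := (Chain.inner_strict hc).imp fun h => h.ne
  have h : IsBetween i j c.inner.toFinset ∧ p + c.inner.toFinset.card = 0 :=
    ⟨Chain.isBetween hc, by rwa [List.toFinset_card_of_nodup hn]⟩
  rw [family, dif_pos h]
  congr 1
  exact Chain.eq_ofFinset hc

theorem d_family (σ : NCSimplex A n) {i j : Fin (n + 1)} {s : Finset (Fin (n + 1))}
    (hs : IsBetween i j s) {p q : ℤ} (hp : p + s.card = 0) (hq : p + 1 = q) :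
    A.d hq (σ.family i j s p) = σ.family.bd i j s q := by
  have h := Chain.sum_eq_bd σ.hom σ.family (fun c p hp hc => σ.hom_eq_family c p hp hc)
    (Chain.ofFinset hs) (Chain.ofFinset_nodup hs) q (by rw [Chain.ofFinset_length]; omega)
  rw [Chain.ofFinset_toFinset] at h
  rw [← h, ← σ.differential _ p q (by rw [Chain.ofFinset_length]; exact hp) hq,
    hom_eq_family _ _ _ _ (Chain.ofFinset_nodup hs), Chain.ofFinset_toFinset]

end NCSimplex

end Strict

/-! ### Simplices from families of morphisms -/

section OfFamily

variable {B : Type u} [CommRing B] {A : DGCat B} {n : ℕ}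

theorem DGCat.d_id (A : DGCat B) (x : A.Obj) : A.d (zero_add 1) (A.id x) = 0 := by
  have h := A.leibniz (zero_add 0) (zero_add 1) (zero_add 1) (zero_add 1) (zero_add 1) (add_zero 1)
    (A.id x) (A.id x)
  have h1 : A.comp (zero_add 0) (A.id x) (A.id x) = A.id x := A.comp_id _
  rw [h1, A.comp_id, A.id_comp, Int.negOnePow_zero, one_smul] at h
  exact left_eq_add.1 h

/-- The identity, as a morphism between two objects that are equal. -/
def DGCat.idOfEq (A : DGCat B) {x y : A.Obj} {p : ℤ} (h : x = y) (hp : p = 0) : A.Hom p x y :=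
  h ▸ hp ▸ A.id x

namespace Chain

/-- A weakly increasing sequence with a repetition repeats its first term, its last term, or two
consecutive inner terms. -/
theorem exists_eq_of_not_nodup {i j : Fin (n + 1)} (c : Chain n i j) (hne : c.inner ≠ [])
    (h : ¬ c.vertices.Nodup) :
    (∃ h0 : 0 < c.inner.length, c.inner[0] = i) ∨
    (∃ h0 : c.inner.length - 1 < c.inner.length, c.inner[c.inner.length - 1] = j) ∨
    ∃ (a : ℕ) (ha : a + 1 < c.inner.length), c.inner[a] = c.inner[a + 1] := by
  by_contra! hc
  obtain ⟨h1, h2, h3⟩ := hc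
  apply h
  have hpos : 0 < c.inner.length := List.length_pos_iff.2 hne
  have hlt : c.vertices.Pairwise (· < ·) := by
    rw [← List.isChain_iff_pairwise, List.isChain_iff_getElem]
    intro t ht
    have hs := c.sorted
    rw [List.pairwise_iff_getElem] at hs
    have hle := hs t (t + 1) (by simp [vertices] at ht ⊢; omega) ht (by omega)
    refine lt_of_le_of_ne hle ?_
    simp only [vertices, List.length_cons, List.length_append, List.length_nil] at ht
    rcases t with - | t
    · simp only [vertices, List.getElem_cons_zero, List.getElem_cons_succ,
        List.getElem_append_left hpos]
      exact (h1 hpos).symm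
    · simp only [vertices, List.getElem_cons_succ]
      rw [List.getElem_append_left (by omega)]
      by_cases ht' : t + 1 < c.inner.length
      · rw [List.getElem_append_left ht']
        exact h3 t ht'
      · obtain rfl : t = c.inner.length - 1 := by omega
        rw [List.getElem_append_right (by omega)]
        simpa using h2 (by omega)
  exact hlt.imp fun h => h.ne

variable {X : Fin (n + 1) → A.Obj}
    (hom : ∀ {i j : Fin (n + 1)} (c : Chain n i j) (p : ℤ), p + c.inner.length = 0 →
      A.Hom p (X i) (X j))

theorem comp_unit (unit : ∀ i, hom (Chain.edge (le_refl i)) 0 (by simp [Chain.edge]) = A.id (X i))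
    {v w j : Fin (n + 1)} (h : w = v) (e : Chain n v w) (he : e.inner = []) (b : Chain n w j)
    (b' : Chain n v j) (hb : b.inner = b'.inner) {p q r : ℤ} (hp hq hr') (hr : p + q = r) :
    A.comp hr (hom b q hq) (hom e p hp) = hom b' r hr' := by
  subst h
  obtain rfl : e = edge (le_refl w) := Chain.ext he
  obtain rfl : b = b' := Chain.ext hb
  obtain rfl : p = 0 := by simpa [edge] using hp
  obtain rfl : q = r := by omega
  rw [unit]
  exact A.comp_id _

theorem unit_comp (unit : ∀ i, hom (Chain.edge (le_refl i)) 0 (by simp [Chain.edge]) = A.id (X i))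
    {i v w : Fin (n + 1)} (h : v = w) (e : Chain n v w) (he : e.inner = []) (b : Chain n i v)
    (b' : Chain n i w) (hb : b.inner = b'.inner) {p q r : ℤ} (hp hq hr') (hr : q + p = r) :
    A.comp hr (hom e p hp) (hom b q hq) = hom b' r hr' := by
  subst h
  obtain rfl : e = edge (le_refl v) := Chain.ext he
  obtain rfl : b = b' := Chain.ext hb
  obtain rfl : p = 0 := by simpa [edge] using hp
  obtain rfl : q = r := by omega
  rw [unit]
  exact A.id_comp _

/-- For a sequence with a repetition, the terms on the right-hand side of the differential equation
cancel. -/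
theorem sum_eq_zero_of_not_nodup
    (unit : ∀ i, hom (Chain.edge (le_refl i)) 0 (by simp [Chain.edge]) = A.id (X i))
    (deg : ∀ {i j : Fin (n + 1)} (c : Chain n i j) (p : ℤ) (hp : p + c.inner.length = 0),
      c.inner ≠ [] → ¬ c.vertices.Nodup → hom c p hp = 0)
    {i j : Fin (n + 1)} (c : Chain n i j) (hne : c.inner ≠ []) (hc : ¬ c.vertices.Nodup) (q : ℤ)
    (hq : q + c.inner.length = 1) :
    ∑ s : Fin c.inner.length, ((-1 : ℤ) ^ (c.back s).inner.length) •
      (A.comp (p := -(c.front s).inner.length) (q := -(c.back s).inner.length)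
          (by have := c.length_front_add_back s; omega)
          (hom (c.back s) _ (neg_add_cancel _)) (hom (c.front s) _ (neg_add_cancel _))
        - hom (c.face s) q (by have := c.length_face s; omega)) = 0 := by
  have z1 {i j : Fin (n + 1)} (c : Chain n i j) (p : ℤ) (hp : p + c.inner.length = 0)
      (h : i ∈ c.inner) : hom c p hp = 0 :=
    deg c p hp (List.ne_nil_of_mem h) fun hn => (List.nodup_cons.1 hn).1 (by simp [h])
  have z2 {i j : Fin (n + 1)} (c : Chain n i j) (p : ℤ) (hp : p + c.inner.length = 0)
      (h : j ∈ c.inner) : hom c p hp = 0 :=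
    deg c p hp (List.ne_nil_of_mem h) fun hn =>
      (List.nodup_append.1 (List.nodup_cons.1 hn).2).2.2 j h j (by simp) rfl
  have z3 {i j : Fin (n + 1)} (c : Chain n i j) (p : ℤ) (hp : p + c.inner.length = 0)
      (h : ¬ c.inner.Nodup) : hom c p hp = 0 :=
    deg c p hp (by rintro h'; exact h (by simp [h'])) fun hn =>
      h (List.nodup_append.1 (List.nodup_cons.1 hn).2).1
  rcases c.exists_eq_of_not_nodup hne hc with ⟨h0, hi⟩ | ⟨h0, hj⟩ | ⟨a, ha, haa⟩
  -- the first term is repeated: there the product with `1` cancels the face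
  · refine Finset.sum_eq_zero fun s _ => ?_
    obtain ⟨s, hs⟩ := s
    rcases s with - | s
    · rw [comp_unit hom unit hi (c.front ⟨0, hs⟩) (by simp [front]) (c.back ⟨0, hs⟩)
        (c.face ⟨0, hs⟩) (by simp [back, face]) _ _
        (by have := c.length_face ⟨0, hs⟩; omega), sub_self, smul_zero]
    · rw [z1 (c.front ⟨s + 1, hs⟩), z1 (c.face ⟨s + 1, hs⟩), map_zero, sub_zero, smul_zero]
      · exact List.mem_eraseIdx_iff_getElem.2 ⟨0, h0, by simp, hi⟩
      · exact List.mem_take_iff_getElem.2 ⟨0, by simp; omega, hi⟩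
  -- the last term is repeated
  · refine Finset.sum_eq_zero fun s _ => ?_
    obtain ⟨s, hs⟩ := s
    rcases eq_or_ne s (c.inner.length - 1) with rfl | hsl
    · rw [unit_comp hom unit hj (c.back ⟨_, hs⟩) (by simp [back]; omega) (c.front ⟨_, hs⟩)
        (c.face ⟨_, hs⟩) (by
          simp only [front, face]
          rw [List.eraseIdx_eq_take_drop_succ, List.drop_of_length_le (by omega),
            List.append_nil]) _ _
        (by have := c.length_face ⟨_, hs⟩; omega), sub_self, smul_zero]
    · rw [z2 (c.back ⟨s, hs⟩), z2 (c.face ⟨s, hs⟩), map_zero, LinearMap.zero_apply, sub_zero,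
        smul_zero]
      · exact List.mem_eraseIdx_iff_getElem.2 ⟨_, h0, hsl.symm, hj⟩
      · exact List.mem_drop_iff_getElem.2 ⟨c.inner.length - 1 - (s + 1), by dsimp only; omega,
          Eq.trans (by congr 1; dsimp only; omega) hj⟩
  -- two inner terms agree: the two faces which remove one of them are equal and cancel
  · have hdrop (s : ℕ) (hs : s < a) : ¬ (c.inner.drop (s + 1)).Nodup := by
      intro hn
      have := hn.getElem_inj_iff (i := a - (s + 1)) (j := a + 1 - (s + 1))
        (hi := by simp; omega) (hj := by simp; omega)
      simp only [List.getElem_drop] at this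
      have h' := this.1 (by
        have e1 : s + 1 + (a - (s + 1)) = a := by omega
        have e2 : s + 1 + (a + 1 - (s + 1)) = a + 1 := by omega
        simp only [e1, e2, haa])
      omega
    have htake (s : ℕ) (hs : a + 1 < s) : ¬ (c.inner.take s).Nodup := by
      intro hn
      have := hn.getElem_inj_iff (i := a) (j := a + 1)
        (hi := by simp; omega) (hj := by simp; omega)
      simp only [List.getElem_take] at this
      have h' := this.1 haa
      omega
    rw [Finset.sum_eq_add (⟨a, by omega⟩ : Fin c.inner.length) ⟨a + 1, ha⟩ (by simp)
      (fun s _ hs => ?_) (by simp) (by simp)]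
    · rw [z1 (c.back ⟨a, by omega⟩), z2 (c.front ⟨a + 1, ha⟩), map_zero, map_zero,
        LinearMap.zero_apply, zero_sub, zero_sub]
      · have e : c.face ⟨a, by omega⟩ = c.face ⟨a + 1, ha⟩ := by
          refine Chain.ext ?_
          simp only [face, List.eraseIdx_eq_take_drop_succ]
          rw [List.take_succ_eq_append_getElem (by omega), haa, List.drop_eq_getElem_cons ha]
          simp
        have l : (c.back ⟨a, by omega⟩).inner.length = (c.back ⟨a + 1, ha⟩).inner.length + 1 := by
          simp only [back, List.length_drop]
          omega
        simp only [e, l, pow_succ]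
        simp
      · exact List.mem_take_iff_getElem.2 ⟨a, by simp; omega, haa⟩
      · refine List.mem_drop_iff_getElem.2 ⟨0, by simp; omega, ?_⟩
        simpa using haa.symm
    · obtain ⟨s, hs'⟩ := s
      simp only [ne_eq, Fin.mk.injEq] at hs
      rcases lt_or_ge s a with h | h
      · rw [z3 (c.back ⟨s, hs'⟩) _ _ (hdrop s h), z3 (c.face ⟨s, hs'⟩), map_zero,
          LinearMap.zero_apply, sub_zero, smul_zero]
        intro hn
        simp only [face, List.eraseIdx_eq_take_drop_succ] at hn
        exact hdrop s h (hn.sublist (List.sublist_append_right _ _))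
      · have h' : a + 1 < s := by omega
        rw [z3 (c.front ⟨s, hs'⟩) _ _ (htake s h'), z3 (c.face ⟨s, hs'⟩), map_zero,
          sub_zero, smul_zero]
        intro hn
        simp only [face, List.eraseIdx_eq_take_drop_succ] at hn
        exact htake s h' (hn.sublist (List.sublist_append_left _ _))

end Chain

namespace NCSimplex

variable {X : Fin (n + 1) → A.Obj} (α : MorFamily A X)

open Classical in
/-- The extension of a family to all weakly increasing sequences. -/
noncomputable def homOfFamily {i j : Fin (n + 1)} (c : Chain n i j) (p : ℤ)
    (hp : p + c.inner.length = 0) : A.Hom p (X i) (X j) :=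
  if h : c.inner = [] ∧ i = j then A.idOfEq (congrArg X h.2) (by simpa [h.1] using hp)
  else if c.vertices.Nodup then α i j c.inner.toFinset p else 0

theorem homOfFamily_unit (i : Fin (n + 1)) :
    homOfFamily α (Chain.edge (le_refl i)) 0 (by simp [Chain.edge]) = A.id (X i) :=
  dif_pos ⟨rfl, rfl⟩

theorem homOfFamily_of_nodup {i j : Fin (n + 1)} (c : Chain n i j) (p : ℤ)
    (hp : p + c.inner.length = 0) (hc : c.vertices.Nodup) :
    homOfFamily α c p hp = α i j c.inner.toFinset p := by
  rw [homOfFamily, dif_neg, if_pos hc]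
  rintro ⟨-, rfl⟩
  exact (Chain.isBetween hc).1.false

theorem homOfFamily_of_not_nodup {i j : Fin (n + 1)} (c : Chain n i j) (p : ℤ)
    (hp : p + c.inner.length = 0) (hne : c.inner ≠ []) (hc : ¬ c.vertices.Nodup) :
    homOfFamily α c p hp = 0 := by
  rw [homOfFamily, dif_neg (fun h => hne h.1), if_neg hc]

/-- A family which satisfies the differential equation defines a simplex. -/
noncomputable def ofFamily (hα : ∀ (i j : Fin (n + 1)) (s : Finset (Fin (n + 1))) (p q : ℤ)
    (hq : p + 1 = q), IsBetween i j s → p + s.card = 0 → A.d hq (α i j s p) = α.bd i j s q) :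
    NCSimplex A n where
  obj := X
  hom := homOfFamily α
  unit := homOfFamily_unit α
  degenerate := homOfFamily_of_not_nodup α
  differential {i j} c p q hp hq := by
    by_cases hc : c.vertices.Nodup
    · have hn : c.inner.Nodup := (Chain.inner_strict hc).imp fun h => h.ne
      rw [homOfFamily_of_nodup _ _ _ _ hc, hα _ _ _ _ _ _ (Chain.isBetween hc)
        (by rwa [List.toFinset_card_of_nodup hn]), Chain.sum_eq_bd (homOfFamily α) α
        (homOfFamily_of_nodup α) c hc q (by omega)]
    · by_cases hne : c.inner = []
      · have hij : i = j := by
          by_contra hij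
          exact hc (by simp [Chain.vertices, hne, hij])
        subst hij
        obtain rfl : p = 0 := by simpa [hne] using hp
        obtain rfl : c = Chain.edge (le_refl i) := Chain.ext hne
        obtain rfl : q = 1 := by omega
        rw [homOfFamily_unit, A.d_id]
        exact (Fintype.sum_empty (ι := Fin 0) _).symm
      · rw [homOfFamily_of_not_nodup _ _ _ _ hne hc, map_zero,
          Chain.sum_eq_zero_of_not_nodup (homOfFamily α) (homOfFamily_unit α)
          (homOfFamily_of_not_nodup α) c hne hc q (by omega)]

theorem family_ofFamily (hα) {i j : Fin (n + 1)} {s : Finset (Fin (n + 1))} {p : ℤ}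
    (hs : IsBetween i j s) (hp : p + s.card = 0) : (ofFamily α hα).family i j s p = α i j s p := by
  have hp' : p + (Chain.ofFinset hs).inner.length = 0 := by rwa [Chain.ofFinset_length]
  have h := (ofFamily α hα).hom_eq_family (Chain.ofFinset hs) p hp' (Chain.ofFinset_nodup hs)
  rw [Chain.ofFinset_toFinset] at h
  rw [← h]
  refine (homOfFamily_of_nodup α _ _ hp' (Chain.ofFinset_nodup hs)).trans ?_
  rw [Chain.ofFinset_toFinset]

theorem ext_hom {σ τ : NCSimplex A n} (hobj : σ.obj = τ.obj)
    (h : ∀ {i j : Fin (n + 1)} (c : Chain n i j) (p : ℤ) (hp : p + c.inner.length = 0),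
      HEq (σ.hom c p hp) (τ.hom c p hp)) : σ = τ := by
  obtain ⟨X, f, _, _, _⟩ := σ
  obtain ⟨Y, g, _, _, _⟩ := τ
  obtain rfl : X = Y := hobj
  refine NCSimplex.ext rfl (heq_of_eq ?_)
  funext i j c p hp
  exact eq_of_heq (h c p hp)

/-- A simplex is determined by its objects and its family of morphisms. -/
theorem ext_family {σ τ : NCSimplex A n} (hobj : σ.obj = τ.obj)
    (h : ∀ i j s (p : ℤ), IsBetween i j s → p + s.card = 0 →
      (⟨σ.obj i, σ.obj j, σ.family i j s p⟩ : Σ x y, A.Hom p x y) =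
        ⟨τ.obj i, τ.obj j, τ.family i j s p⟩) : σ = τ := by
  have key : ∀ {i j : Fin (n + 1)} (c : Chain n i j) (p : ℤ) (hp : p + c.inner.length = 0),
      HEq (σ.hom c p hp) (τ.hom c p hp) := by
    intro i j c p hp
    by_cases hc : c.vertices.Nodup
    · have hn : c.inner.Nodup := (Chain.inner_strict hc).imp fun h => h.ne
      rw [σ.hom_eq_family _ _ _ hc, τ.hom_eq_family _ _ _ hc]
      have := h i j c.inner.toFinset p (Chain.isBetween hc)
        (by rwa [List.toFinset_card_of_nodup hn])
      have h1 := Sigma.mk.inj this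
      have e1 := h1.1
      have := congrArg (fun e : Σ x y, A.Hom p x y => (⟨(e.1, e.2.1), e.2.2⟩ :
        Σ x : A.Obj × A.Obj, A.Hom p x.1 x.2)) this
      exact (Sigma.mk.inj this).2
    · by_cases hne : c.inner = []
      · have hij : i = j := by
          by_contra hij
          exact hc (by simp [Chain.vertices, hne, hij])
        subst hij
        obtain rfl : p = 0 := by simpa [hne] using hp
        obtain rfl : c = Chain.edge (le_refl i) := Chain.ext hne
        rw [σ.unit, τ.unit, hobj]
      · rw [σ.degenerate _ _ _ hne hc, τ.degenerate _ _ _ hne hc, hobj]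
  exact ext_hom hobj key

end NCSimplex

end OfFamily

/-! ### Homotopies and equivalences -/

section Homotopy

namespace DGCat

variable {B : Type u} [CommRing B] (A : DGCat B) {x y z w : A.Obj}

/-- Two morphisms of degree `0` are homotopic when they differ by the differential of a morphism of
degree `-1`. -/
def Homotopic (f g : A.Hom 0 x y) : Prop := ∃ h : A.Hom (-1) x y, f = g + A.d (neg_add_cancel 1) h

/-- Composition of morphisms of degree `0`. -/
def comp₀ (g : A.Hom 0 y z) (f : A.Hom 0 x y) : A.Hom 0 x z := A.comp (zero_add 0) g f

variable {A}

theorem Homotopic.refl (f : A.Hom 0 x y) : A.Homotopic f f := ⟨0, by simp⟩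

theorem Homotopic.symm {f g : A.Hom 0 x y} (h : A.Homotopic f g) : A.Homotopic g f := by
  obtain ⟨h, rfl⟩ := h
  exact ⟨-h, by simp⟩

theorem Homotopic.trans {f g e : A.Hom 0 x y} (h : A.Homotopic f g) (h' : A.Homotopic g e) :
    A.Homotopic f e := by
  obtain ⟨h, rfl⟩ := h
  obtain ⟨h', rfl⟩ := h'
  exact ⟨h' + h, by simp [add_assoc]⟩

theorem comp₀_assoc (e : A.Hom 0 z w) (g : A.Hom 0 y z) (f : A.Hom 0 x y) :
    A.comp₀ (A.comp₀ e g) f = A.comp₀ e (A.comp₀ g f) :=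
  (A.assoc (zero_add 0) (zero_add 0) (zero_add 0) (zero_add 0) f g e).symm

@[simp] theorem comp₀_id (f : A.Hom 0 x y) : A.comp₀ f (A.id x) = f := A.comp_id f

@[simp] theorem id_comp₀ (f : A.Hom 0 x y) : A.comp₀ (A.id y) f = f := A.id_comp f

theorem d_comp₀ {g : A.Hom 0 y z} {f : A.Hom 0 x y} (hg : A.d (zero_add 1) g = 0)
    (hf : A.d (zero_add 1) f = 0) : A.d (zero_add 1) (A.comp₀ g f) = 0 := by
  rw [comp₀, A.leibniz _ (zero_add 1) (zero_add 1) _ (zero_add 1) (add_zero 1), hg, hf]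
  simp

theorem Homotopic.comp₀_left {f f' : A.Hom 0 x y} (h : A.Homotopic f f') {g : A.Hom 0 y z}
    (hg : A.d (zero_add 1) g = 0) : A.Homotopic (A.comp₀ g f) (A.comp₀ g f') := by
  obtain ⟨h, rfl⟩ := h
  refine ⟨A.comp (add_zero (-1)) g h, ?_⟩
  rw [A.leibniz _ (neg_add_cancel 1) (zero_add 1) _ (neg_add_cancel 1) (zero_add 0), hg]
  simp [comp₀]

theorem Homotopic.comp₀_right {g g' : A.Hom 0 y z} (h : A.Homotopic g g') {f : A.Hom 0 x y}
    (hf : A.d (zero_add 1) f = 0) : A.Homotopic (A.comp₀ g f) (A.comp₀ g' f) := by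
  obtain ⟨h, rfl⟩ := h
  refine ⟨A.comp (zero_add (-1)) h f, ?_⟩
  rw [A.leibniz _ (zero_add 1) (neg_add_cancel 1) _ (zero_add 0) (add_neg_cancel 1), hf]
  simp [comp₀]

theorem Homotopic.d_eq_zero {f g : A.Hom 0 x y} (h : A.Homotopic f g)
    (hg : A.d (zero_add 1) g = 0) : A.d (zero_add 1) f = 0 := by
  obtain ⟨h, rfl⟩ := h
  rw [map_add, hg, A.d_d, add_zero]

theorem Homotopic.smul {f g : A.Hom 0 x y} (h : A.Homotopic f g) (b : B) :
    A.Homotopic (b • f) (b • g) := by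
  obtain ⟨h, rfl⟩ := h
  exact ⟨b • h, by rw [smul_add, map_smul]⟩

theorem isEquivalence_iff {f : A.Hom 0 x y} : A.IsEquivalence f ↔ A.d (zero_add 1) f = 0 ∧
    ∃ a : A.Hom 0 y x, A.d (zero_add 1) a = 0 ∧ A.Homotopic (A.comp₀ f a) (A.id y) ∧
      A.Homotopic (A.comp₀ a f) (A.id x) := by
  constructor
  · rintro ⟨hf, a, h, g, ha, e, e'⟩
    exact ⟨hf, a, ha, ⟨h, e⟩, ⟨g, e'⟩⟩
  · rintro ⟨hf, a, ha, ⟨h, e⟩, ⟨g, e'⟩⟩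
    exact ⟨hf, a, h, g, ha, e, e'⟩

/-- A closed morphism with a left and a right homotopy inverse is an equivalence. -/
theorem isEquivalence_of_inverses {f : A.Hom 0 x y} {a b : A.Hom 0 y x}
    (hf : A.d (zero_add 1) f = 0) (ha : A.d (zero_add 1) a = 0) (hb : A.d (zero_add 1) b = 0)
    (hr : A.Homotopic (A.comp₀ f a) (A.id y)) (hl : A.Homotopic (A.comp₀ b f) (A.id x)) :
    A.IsEquivalence f := by
  refine isEquivalence_iff.2 ⟨hf, a, ha, hr, ?_⟩
  have h1 : A.Homotopic a b := by
    have h := hr.comp₀_left hb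
    rw [← comp₀_assoc, comp₀_id] at h
    have h' := hl.comp₀_right ha
    rw [id_comp₀] at h'
    exact h'.symm.trans h
  exact (h1.comp₀_right hf).trans hl

theorem IsEquivalence.comp₀ {f : A.Hom 0 x y} {g : A.Hom 0 y z} (hg : A.IsEquivalence g)
    (hf : A.IsEquivalence f) : A.IsEquivalence (A.comp₀ g f) := by
  obtain ⟨hg, b, hb, e1, e2⟩ := isEquivalence_iff.1 hg
  obtain ⟨hf, a, ha, e3, e4⟩ := isEquivalence_iff.1 hf
  refine isEquivalence_iff.2 ⟨d_comp₀ hg hf, A.comp₀ a b, d_comp₀ ha hb, ?_, ?_⟩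
  · have h := (e3.comp₀_right hb).comp₀_left hg
    rw [id_comp₀] at h
    simpa only [comp₀_assoc] using h.trans e1
  · have h := (e2.comp₀_right hf).comp₀_left ha
    rw [id_comp₀] at h
    simpa only [comp₀_assoc] using h.trans e4

theorem IsEquivalence.of_homotopic {f f' : A.Hom 0 x y} (hf : A.IsEquivalence f)
    (h : A.Homotopic f' f) : A.IsEquivalence f' := by
  obtain ⟨hf, a, ha, e3, e4⟩ := isEquivalence_iff.1 hf
  exact isEquivalence_iff.2 ⟨h.d_eq_zero hf, a, ha, (h.comp₀_right ha).trans e3,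
    (h.comp₀_left ha).trans e4⟩

theorem isEquivalence_id (x : A.Obj) : A.IsEquivalence (A.id x) :=
  isEquivalence_iff.2 ⟨A.d_id x, A.id x, A.d_id x, by simpa using Homotopic.refl _,
    by simpa using Homotopic.refl _⟩

end DGCat

end Homotopy

/-! ### Modification and restriction of families -/

section Horns

open DGCat

variable {B : Type u} [CommRing B] {A : DGCat B}

namespace MorFamily

variable {ι ι' : Type}

theorem eq_of_sigma {x y : A.Obj} {p : ℤ} {f g : A.Hom p x y}
    (h : (⟨x, y, f⟩ : Σ x y, A.Hom p x y) = ⟨x, y, g⟩) : f = g :=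
  eq_of_heq (Sigma.mk.inj (eq_of_heq (Sigma.mk.inj h).2)).2

section

variable {X : ι → A.Obj} [DecidableEq ι] (α : MorFamily A X)

/-- The family with one of its members replaced. -/
def set (i j : ι) (s : Finset ι) (p : ℤ) (b : A.Hom p (X i) (X j)) : MorFamily A X :=
  Function.update α i (Function.update (α i) j (Function.update (α i j) s
    (Function.update (α i j s) p b)))

theorem set_self (i j : ι) (s : Finset ι) (p : ℤ) (b : A.Hom p (X i) (X j)) :
    α.set i j s p b i j s p = b := by simp [set]

theorem set_of_ne {i j i' j' : ι} {s s' : Finset ι} {p : ℤ} {b : A.Hom p (X i) (X j)}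
    (h : ¬ (i' = i ∧ j' = j ∧ s' = s)) (p' : ℤ) : α.set i j s p b i' j' s' p' = α i' j' s' p' := by
  unfold set
  rcases eq_or_ne i' i with rfl | hi
  · rw [Function.update_self]
    rcases eq_or_ne j' j with rfl | hj
    · rw [Function.update_self, Function.update_of_ne (by tauto)]
    · rw [Function.update_of_ne hj]
  · rw [Function.update_of_ne hi]

end

variable [LinearOrder ι] [LinearOrder ι']

theorem above_map (δ : ι' ↪o ι) (s : Finset ι') (v : ι') :
    above (s.map δ.toEmbedding) (δ v) = (above s v).map δ.toEmbedding := by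
  ext x
  simp only [mem_above, Finset.mem_map]
  constructor
  · rintro ⟨⟨w, hw, rfl⟩, h⟩
    exact ⟨w, ⟨hw, δ.lt_iff_lt.1 h⟩, rfl⟩
  · rintro ⟨w, ⟨hw, h⟩, rfl⟩
    exact ⟨⟨w, hw, rfl⟩, δ.lt_iff_lt.2 h⟩

theorem below_map (δ : ι' ↪o ι) (s : Finset ι') (v : ι') :
    below (s.map δ.toEmbedding) (δ v) = (below s v).map δ.toEmbedding := by
  ext x
  simp only [mem_below, Finset.mem_map]
  constructor
  · rintro ⟨⟨w, hw, rfl⟩, h⟩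
    exact ⟨w, ⟨hw, δ.lt_iff_lt.1 h⟩, rfl⟩
  · rintro ⟨w, ⟨hw, h⟩, rfl⟩
    exact ⟨⟨w, hw, rfl⟩, δ.lt_iff_lt.2 h⟩

theorem bd_map {X : ι → A.Obj} (α : MorFamily A X) (δ : ι' ↪o ι) (i j : ι') (s : Finset ι')
    (q : ℤ) : α.bd (δ i) (δ j) (s.map δ.toEmbedding) q =
      MorFamily.bd (X := X ∘ δ) (fun i j s p => α (δ i) (δ j) (s.map δ.toEmbedding) p) i j s q := by
  rw [bd, bd, Finset.sum_map]
  refine Finset.sum_congr rfl fun v _ => ?_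
  have hc : (above (s.map δ.toEmbedding) (δ.toEmbedding v)).card = (above s v).card :=
    (congrArg Finset.card (above_map δ s v)).trans (Finset.card_map _)
  refine congrArg₂ (· • ·) (by rw [hc]) (congrArg₂ (· - ·) ?_ ?_)
  · exact α.comp_congr (below_map δ s v) (above_map δ s v) (by rw [hc]) (by rw [hc]) _ _
  · rw [Finset.map_erase]

/-- The differential equation holds for a family if it does for its restriction. -/
theorem d_eq_bd_of_restrict {X : ι → A.Obj} {Y : ι' → A.Obj} (α : MorFamily A X)
    (β : MorFamily A Y) (δ : ι' ↪o ι)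
    (h : ∀ i j s p, (⟨X (δ i), X (δ j), α (δ i) (δ j) (s.map δ.toEmbedding) p⟩ :
      Σ x y, A.Hom p x y) = ⟨Y i, Y j, β i j s p⟩) {i j : ι'} {s : Finset ι'} {p q : ℤ}
    (hq : p + 1 = q) (e : A.d hq (β i j s p) = β.bd i j s q) :
    A.d hq (α (δ i) (δ j) (s.map δ.toEmbedding) p) =
      α.bd (δ i) (δ j) (s.map δ.toEmbedding) q := by
  obtain rfl : Y = X ∘ δ := funext fun i => (congrArg Sigma.fst (h i i ∅ 0)).symm
  obtain rfl : β = fun i j s p => α (δ i) (δ j) (s.map δ.toEmbedding) p := by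
    funext i j s p
    exact (eq_of_sigma (h i j s p)).symm
  rw [bd_map]
  exact e

end MorFamily

end Horns

/-! ### Gluing along faces -/

section Gluing

/-- Two elements `i`, `j` and a finite subset: the index of a morphism `α(i, s, j)`. -/
abbrev Index (ι : Type) : Type := ι × ι × Finset ι

namespace Index

variable {ι ι' ι'' : Type}

/-- The image of an index under an embedding. -/
def map (δ : ι' ↪ ι) (κ : Index ι') : Index ι := (δ κ.1, δ κ.2.1, κ.2.2.map δ)

theorem map_injective (δ : ι' ↪ ι) : Function.Injective (map δ) := by
  rintro ⟨i, j, s⟩ ⟨i', j', s'⟩ h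
  simpa [map] using h

theorem map_map (δ : ι' ↪ ι) (δ' : ι'' ↪ ι') (κ : Index ι'') :
    (κ.map δ').map δ = κ.map (δ'.trans δ) := by
  simp [map, Finset.map_map]

/-- The index does not involve `m`. -/
def Misses (κ : Index ι) (m : ι) : Prop := κ.1 ≠ m ∧ κ.2.1 ≠ m ∧ m ∉ κ.2.2

theorem map_misses_iff (δ : ι' ↪ ι) (κ : Index ι') (m : ι') :
    (κ.map δ).Misses (δ m) ↔ κ.Misses m := by
  simp [Misses, map]

theorem misses_succAbove {n : ℕ} (m : Fin (n + 1)) (κ : Index (Fin n)) :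
    (κ.map (Fin.succAboveEmb m)).Misses m := by
  refine ⟨Fin.succAbove_ne m _, Fin.succAbove_ne m _, fun h => ?_⟩
  obtain ⟨v, -, hv⟩ := Finset.mem_map.1 h
  exact Fin.succAbove_ne m _ hv

theorem Misses.exists_map {n : ℕ} {m : Fin (n + 1)} {κ : Index (Fin (n + 1))} (h : κ.Misses m) :
    ∃ κ' : Index (Fin n), κ'.map (Fin.succAboveEmb m) = κ := by
  obtain ⟨i, j, s⟩ := κ
  obtain ⟨hi, hj, hs⟩ := h
  obtain ⟨i, rfl⟩ := Fin.exists_succAbove_eq hi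
  obtain ⟨j, rfl⟩ := Fin.exists_succAbove_eq hj
  have h1 : s ⊆ Finset.univ.map (Fin.succAboveEmb m) := by
    intro v hv
    obtain ⟨w, rfl⟩ := Fin.exists_succAbove_eq (x := v) (y := m) (by rintro rfl; exact hs hv)
    exact Finset.mem_map.2 ⟨w, Finset.mem_univ _, rfl⟩
  obtain ⟨t, -, rfl⟩ := Finset.subset_map_iff.1 h1
  exact ⟨(i, j, t), rfl⟩

/-- Functions on the indices of the faces of a horn which agree on common faces come from a function
on the indices of the simplex. -/
theorem exists_glue {n : ℕ} {l : Fin (n + 3)} {Ω : Type*} [Nonempty Ω]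
    (g : ∀ m : Fin (n + 3), m ≠ l → Index (Fin (n + 2)) → Ω)
    (hg : ∀ (i j : Fin (n + 2)) (hi : i.castSucc ≠ l) (hj : j.succ ≠ l), i ≤ j →
      ∀ κ : Index (Fin (n + 1)), g j.succ hj (κ.map (Fin.succAboveEmb i)) =
        g i.castSucc hi (κ.map (Fin.succAboveEmb j))) :
    ∃ G : Index (Fin (n + 3)) → Ω, ∀ m hm κ, G (κ.map (Fin.succAboveEmb m)) = g m hm κ := by
  classical
  have key : ∀ (m m' : Fin (n + 3)) (hm : m ≠ l) (hm' : m' ≠ l) (κ κ' : Index (Fin (n + 2))),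
      m < m' → κ.map (Fin.succAboveEmb m) = κ'.map (Fin.succAboveEmb m') →
        g m hm κ = g m' hm' κ' := by
    intro m m' hm hm' κ κ' hlt h
    obtain ⟨i, rfl⟩ := Fin.exists_castSucc_eq.2 (Fin.ne_last_of_lt hlt)
    obtain ⟨j, rfl⟩ := Fin.exists_succ_eq.2 (Fin.ne_zero_of_lt hlt)
    have hij : i ≤ j := Fin.castSucc_lt_succ_iff.1 hlt
    have e1 : Fin.succAboveEmb j.succ i = i.castSucc :=
      Fin.succAbove_of_castSucc_lt _ _ hlt
    have h1 : κ'.Misses i := by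
      rw [← map_misses_iff (Fin.succAboveEmb j.succ), e1, ← h]
      exact misses_succAbove _ _
    obtain ⟨κ'', rfl⟩ := h1.exists_map
    have h2 : κ = κ''.map (Fin.succAboveEmb j) := by
      apply map_injective (Fin.succAboveEmb i.castSucc)
      rw [h, map_map, map_map]
      congr 1
      ext v : 1
      exact (congrFun (congrArg (fun f => (f.toOrderHom : Fin (n + 1) → Fin (n + 3)))
        (SimplexCategory.δ_comp_δ hij)) v)
    rw [h2]
    exact (hg i j hm hm' hij κ'').symm
  have key' : ∀ (m m' : Fin (n + 3)) (hm : m ≠ l) (hm' : m' ≠ l) (κ κ' : Index (Fin (n + 2))),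
      κ.map (Fin.succAboveEmb m) = κ'.map (Fin.succAboveEmb m') → g m hm κ = g m' hm' κ' := by
    intro m m' hm hm' κ κ' h
    rcases lt_trichotomy m m' with hlt | rfl | hlt
    · exact key _ _ _ _ _ _ hlt h
    · rw [map_injective _ h]
    · exact (key _ _ _ _ _ _ hlt h.symm).symm
  refine ⟨fun κ => if h : ∃ m, ∃ _ : m ≠ l, ∃ κ', map (Fin.succAboveEmb m) κ' = κ then
    g h.choose h.choose_spec.choose h.choose_spec.choose_spec.choose else Classical.arbitrary _, ?_⟩
  intro m hm κ
  have h : ∃ m', ∃ _ : m' ≠ l, ∃ κ', map (Fin.succAboveEmb m') κ' = κ.map (Fin.succAboveEmb m) :=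
    ⟨m, hm, κ, rfl⟩
  refine (dif_pos h).trans ?_
  exact key' _ _ _ _ _ _ h.choose_spec.choose_spec.choose_spec

end Index

namespace NCSimplex

variable {B : Type u} [CommRing B] {A : DGCat B}

/-- The morphism of the simplex with a given index, together with its source and target. -/
noncomputable def tot {n : ℕ} (σ : NCSimplex A n) (κ : Index (Fin (n + 1))) (p : ℤ) :
    Σ x y, A.Hom p x y :=
  ⟨σ.obj κ.1, σ.obj κ.2.1, σ.family κ.1 κ.2.1 κ.2.2 p⟩

theorem family_restrict {m n : ℕ} (σ : NCSimplex A n) (δ : Fin (m + 1) ↪o Fin (n + 1))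
    (i j : Fin (m + 1)) (s : Finset (Fin (m + 1))) (p : ℤ) :
    (σ.restrict δ.toOrderHom).family i j s p =
      σ.family (δ i) (δ j) (s.map δ.toEmbedding) p := by
  have h1 : IsBetween (δ i) (δ j) (s.map δ.toEmbedding) ↔ IsBetween i j s := by
    simp [IsBetween]
  by_cases h : IsBetween i j s ∧ p + s.card = 0
  · have hp : p + (Chain.ofFinset h.1).inner.length = 0 := by
      rw [Chain.ofFinset_length]; exact h.2
    have e1 := (σ.restrict δ.toOrderHom).hom_eq_family (Chain.ofFinset h.1) p hp
      (Chain.ofFinset_nodup h.1)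
    rw [Chain.ofFinset_toFinset] at e1
    rw [← e1]
    have hn : ((Chain.ofFinset h.1).map δ.toOrderHom).vertices.Nodup := by
      have h' : ((Chain.ofFinset h.1).map δ.toOrderHom).vertices =
        (Chain.ofFinset h.1).vertices.map δ := by simp [Chain.vertices, Chain.map]
      rw [h']
      exact (Chain.ofFinset_nodup h.1).map δ.injective
    refine (σ.hom_eq_family _ p _ hn).trans ?_
    congr 1
    simp only [Chain.map]
    ext v
    simp only [List.mem_toFinset, List.mem_map, Finset.mem_map]
    simp [Chain.ofFinset]
  · have h2 : ¬ (IsBetween (δ i) (δ j) (s.map δ.toEmbedding) ∧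
        p + (s.map δ.toEmbedding).card = 0) := by rwa [h1, Finset.card_map]
    exact (family_of_not _ h).trans (family_of_not _ h2).symm

theorem tot_restrict {m n : ℕ} (σ : NCSimplex A n) (δ : Fin (m + 1) ↪o Fin (n + 1))
    (κ : Index (Fin (m + 1))) (p : ℤ) :
    (σ.restrict δ.toOrderHom).tot κ p = σ.tot (κ.map δ.toEmbedding) p :=
  congrArg (fun e => (⟨_, _, e⟩ : Σ x y, A.Hom p x y)) (σ.family_restrict δ _ _ _ p)

end NCSimplex

end Gluing

/-! ### Horns as families of morphisms -/

section HornFilling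

variable {B : Type u} [CommRing B] {A : DGCat B} {n : ℕ}

/-- An index `(i, s, j)` with `s` between `i` and `j` which involves all vertices except possibly
`l` is one of the two extreme ones. -/
theorem IsBetween.misses_or {N : ℕ} {l : Fin (N + 1)} (h0 : 0 ≠ l) (h1 : Fin.last N ≠ l)
    {i j : Fin (N + 1)} {s : Finset (Fin (N + 1))} (hs : IsBetween i j s) :
    (∃ m, m ≠ l ∧ Index.Misses (i, j, s) m) ∨ (i = 0 ∧ j = Fin.last N ∧
      (s = Finset.Ioo 0 (Fin.last N) ∨ s = (Finset.Ioo 0 (Fin.last N)).erase l)) := by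
  by_contra! hc
  obtain ⟨hc, hc'⟩ := hc
  have key : ∀ m, m ≠ l → i = m ∨ j = m ∨ m ∈ s := by
    intro m hm
    have := hc m hm
    simp only [Index.Misses, ne_eq] at this
    tauto
  have hi : i = 0 := by
    rcases key 0 h0 with h | h | h
    · exact h
    · exact absurd hs.1 (by simp [h])
    · exact absurd (hs.2 _ h).1 (by simp)
  have hj : j = Fin.last N := by
    rcases key (Fin.last N) h1 with h | h | h
    · exact absurd hs.1 (by simp [h, Fin.le_last])
    · exact h
    · exact absurd (hs.2 _ h).2 (by simp [Fin.le_last])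
  subst hi hj
  obtain ⟨h1, h2⟩ := hc' rfl rfl
  have hsub : s ⊆ Finset.Ioo 0 (Fin.last N) := fun v hv => Finset.mem_Ioo.2 (hs.2 v hv)
  have hsup : (Finset.Ioo 0 (Fin.last N)).erase l ⊆ s := by
    intro v hv
    obtain ⟨hvl, hv⟩ := Finset.mem_erase.1 hv
    obtain ⟨hv0, hvN⟩ := Finset.mem_Ioo.1 hv
    rcases key v hvl with h | h | h
    · exact absurd hv0 (by simp [← h])
    · exact absurd hvN (by simp [← h])
    · exact h
  by_cases hl : l ∈ s
  · refine h1 (hsub.antisymm fun v hv => ?_)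
    rcases eq_or_ne v l with rfl | hvl
    · exact hl
    · exact hsup (Finset.mem_erase.2 ⟨hvl, hv⟩)
  · exact h2 (Finset.Subset.antisymm
      (fun v hv => Finset.mem_erase.2 ⟨by rintro rfl; exact hl hv, hsub hv⟩) hsup)

theorem exists_sigma_eq {X Y : A.Obj} {p : ℤ} (e : Σ x y, A.Hom p x y) (hX : e.1 = X)
    (hY : e.2.1 = Y) : ∃ b : A.Hom p X Y, (⟨X, Y, b⟩ : Σ x y, A.Hom p x y) = e := by
  subst hX hY
  exact ⟨_, rfl⟩

namespace NCSimplex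

/-- The face of a simplex opposite to the vertex `m`. -/
def face (σ : NCSimplex A (n + 1)) (m : Fin (n + 2)) : NCSimplex A n :=
  σ.restrict (Fin.succAboveOrderEmb m).toOrderHom

theorem tot_face (σ : NCSimplex A (n + 1)) (m : Fin (n + 2)) (κ : Index (Fin (n + 1))) (p : ℤ) :
    (σ.face m).tot κ p = σ.tot (κ.map (Fin.succAboveEmb m)) p :=
  σ.tot_restrict _ _ _

/-- The faces of a horn give objects and a family of morphisms. -/
theorem exists_morFamily {l : Fin (n + 3)} (hl : Fin.last (n + 2) ≠ l)
    (f : ∀ m : Fin (n + 3), m ≠ l → NCSimplex A (n + 1))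
    (hf : ∀ (i j : Fin (n + 2)) (hi : i.castSucc ≠ l) (hj : j.succ ≠ l), i ≤ j →
      (f j.succ hj).face i = (f i.castSucc hi).face j) :
    ∃ (X : Fin (n + 3) → A.Obj) (α : MorFamily A X), ∀ m hm i j s p,
      (⟨X (m.succAbove i), X (m.succAbove j),
        α (m.succAbove i) (m.succAbove j) (s.map (Fin.succAboveEmb m)) p⟩ : Σ x y, A.Hom p x y) =
      ⟨(f m hm).obj i, (f m hm).obj j, (f m hm).family i j s p⟩ := by
  have : Nonempty (∀ p : ℤ, Σ x y, A.Hom p x y) := ⟨(f _ hl).tot (0, 0, ∅)⟩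
  obtain ⟨G, hG⟩ := Index.exists_glue (fun m hm κ => (f m hm).tot κ) fun i j hi hj hij κ => by
    funext p
    rw [← tot_face, ← tot_face, hf i j hi hj hij]
  -- the objects are the sources of the glued morphisms with index `(v, v, ∅)`
  let X : Fin (n + 3) → A.Obj := fun v => (G (v, v, ∅) 0).1
  have hX : ∀ m hm i, X (m.succAbove i) = (f m hm).obj i := fun m hm i =>
    congrArg (fun e => (e 0).1) (hG m hm (i, i, ∅))
  have h : ∀ i j s p, ∃ b : A.Hom p (X i) (X j), (G (i, j, s) p).1 = X i →
      (G (i, j, s) p).2.1 = X j → (⟨X i, X j, b⟩ : Σ x y, A.Hom p x y) = G (i, j, s) p := by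
    intro i j s p
    by_cases h : (G (i, j, s) p).1 = X i ∧ (G (i, j, s) p).2.1 = X j
    · obtain ⟨b, hb⟩ := exists_sigma_eq _ h.1 h.2
      exact ⟨b, fun _ _ => hb⟩
    · exact ⟨0, fun h1 h2 => absurd ⟨h1, h2⟩ h⟩
  choose α hα using h
  refine ⟨X, α, fun m hm i j s p => ?_⟩
  have h := congrFun (hG m hm (i, j, s)) p
  refine (hα _ _ _ p ?_ ?_).trans h
  · exact (congrArg (fun e => e.1) h).trans (hX m hm i).symm
  · exact (congrArg (fun e => e.2.1) h).trans (hX m hm j).symm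

end NCSimplex

namespace MorFamily

section

variable {ι : Type} [LinearOrder ι] {X : ι → A.Obj} (α : MorFamily A X)

/-- The contribution of the member attached to the face without `l` to the right-hand side of the
differential equation. -/
theorem bd_set {i j l : ι} {s : Finset ι} {q : ℤ} (hi : ∀ v ∈ s, i < v ∧ v < j) (hl : l ∈ s)
    (b : A.Hom q (X i) (X j)) : (α.set i j (s.erase l) q b).bd i j s q =
      (α.set i j (s.erase l) q 0).bd i j s q - ((-1 : ℤ) ^ (above s l).card) • b := by
  have h1 (b : A.Hom q (X i) (X j)) (v : ι) (hv : v ∈ s) (p : ℤ) :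
      (α.set i j (s.erase l) q b) v j (above s v) p = α v j (above s v) p :=
    set_of_ne _ (fun h => (hi v hv).1.ne' h.1) _
  have h2 (b : A.Hom q (X i) (X j)) (v : ι) (hv : v ∈ s) (p : ℤ) :
      (α.set i j (s.erase l) q b) i v (below s v) p = α i v (below s v) p :=
    set_of_ne _ (fun h => (hi v hv).2.ne h.2.1) _
  rw [bd, bd, ← Finset.add_sum_erase _ _ hl, ← Finset.add_sum_erase _ _ hl, add_sub_right_comm]
  refine congrArg₂ (· + ·) ?_ (Finset.sum_congr rfl fun v hv => ?_)
  · rw [h1 b l hl, h1 0 l hl, h2 b l hl, h2 0 l hl, set_self, set_self, sub_zero, smul_sub]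
  · obtain ⟨hvl, hv⟩ := Finset.mem_erase.1 hv
    rw [h1 b v hv, h1 0 v hv, h2 b v hv, h2 0 v hv, set_of_ne, set_of_ne] <;>
    · rintro ⟨-, -, h⟩
      exact hvl (Finset.erase_injOn _ hv hl h)

/-- The member of the family attached to a face is determined by the other members and the
differential equation. -/
theorem eq_of_bd {Y : ι → A.Obj} (hXY : X = Y) (β : MorFamily A Y) {i j l : ι} {s : Finset ι}
    {p q : ℤ} (hs : ∀ v ∈ s, i < v ∧ v < j) (hl : l ∈ s)
    (h : ∀ i' j' s' p, ¬ (i' = i ∧ j' = j ∧ s' = s.erase l) →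
      (⟨X i', X j', α i' j' s' p⟩ : Σ x y, A.Hom p x y) = ⟨Y i', Y j', β i' j' s' p⟩)
    (hq : p + 1 = q) (hα : A.d hq (α i j s p) = α.bd i j s q)
    (hβ : A.d hq (β i j s p) = β.bd i j s q) :
    (⟨X i, X j, α i j (s.erase l) q⟩ : Σ x y, A.Hom q x y) = ⟨Y i, Y j, β i j (s.erase l) q⟩ := by
  subst hXY
  have h' : ∀ i' j' s' p, ¬ (i' = i ∧ j' = j ∧ s' = s.erase l) → α i' j' s' p = β i' j' s' p :=
    fun i' j' s' p hn => eq_of_sigma (h i' j' s' p hn)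
  have hne : s ≠ s.erase l := fun h => Finset.notMem_erase l s (h ▸ hl)
  rw [h' i j s p (fun h => hne h.2.2), hβ, bd, bd, ← Finset.add_sum_erase _ _ hl,
    ← Finset.add_sum_erase _ _ hl,
    Finset.sum_congr rfl fun v hv => ?_] at hα
  · have h3 := add_right_cancel hα
    have h1 := (hs l hl).1.ne'
    have h2 := (hs l hl).2.ne
    rw [h' l j _ _ (fun h => h1 h.1), h' i l _ _ (fun h => h2 h.2.1)] at h3
    have h4 := congrArg (((-1 : ℤ) ^ (above s l).card) • ·) h3
    simp only [smul_smul, ← mul_pow, neg_mul_neg, one_mul, one_pow, one_smul] at h4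
    rw [sub_right_inj.1 h4]
  · obtain ⟨hvl, hv⟩ := Finset.mem_erase.1 hv
    have h1 := (hs v hv).1.ne'
    have h2 := (hs v hv).2.ne
    rw [h' v j _ _ (fun h => h1 h.1), h' i v _ _ (fun h => h2 h.2.1), h' i j (s.erase v)]
    rintro ⟨-, -, h⟩
    exact hvl (Finset.erase_injOn _ hv hl h)

end

end MorFamily

end HornFilling

/-! ### Filling of inner horns -/

section Filler

variable {B : Type u} [CommRing B] {A : DGCat B} {n : ℕ}

theorem card_Ioo_zero_last (n : ℕ) : (Finset.Ioo 0 (Fin.last (n + 1))).card = n := by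
  simp [Fin.card_Ioo]

namespace MorFamily

variable {X : Fin (n + 3) → A.Obj} {l : Fin (n + 3)}

/-- A family which satisfies the differential equation away from `l` can be modified at the two
extreme indices, with an arbitrary member at the top index, so as to satisfy it everywhere. -/
theorem exists_extension (h0 : 0 < l) (h1 : l < Fin.last (n + 2)) (α : MorFamily A X)
    (hα : ∀ m, m ≠ l → ∀ i j s, Index.Misses (i, j, s) m → IsBetween i j s → ∀ (p q : ℤ)
      (hq : p + 1 = q), p + s.card = 0 → A.d hq (α i j s p) = α.bd i j s q)
    (b : A.Hom (-((n + 1 : ℕ) : ℤ)) (X 0) (X (Fin.last (n + 2)))) :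
    ∃ β : MorFamily A X, (∀ m, m ≠ l → ∀ i j s, Index.Misses (i, j, s) m → ∀ p,
        β i j s p = α i j s p) ∧
      β 0 (Fin.last (n + 2)) (Finset.Ioo 0 (Fin.last (n + 2))) (-((n + 1 : ℕ) : ℤ)) = b ∧
      ∀ i j s (p q : ℤ) (hq : p + 1 = q), IsBetween i j s → p + s.card = 0 →
        A.d hq (β i j s p) = β.bd i j s q := by
  let L := Fin.last (n + 2)
  let I := Finset.Ioo 0 L
  have hlI : l ∈ I := Finset.mem_Ioo.2 ⟨h0, h1⟩
  have hIb : ∀ v ∈ I, 0 < v ∧ v < L := fun v hv => Finset.mem_Ioo.1 hv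
  have hcI : I.card = n + 1 := card_Ioo_zero_last (n + 1)
  have hne : I.erase l ≠ I := fun h => Finset.notMem_erase l I (h.symm ▸ hlI)
  have hmiss : ∀ m, m ≠ l → ∀ i j s, Index.Misses (i, j, s) m →
      ¬ (i = 0 ∧ j = L ∧ (s = I ∨ s = I.erase l)) := by
    rintro m hm _ _ s ⟨hi, hj, hs⟩ ⟨rfl, rfl, h⟩
    have hmI : m ∈ I := Finset.mem_Ioo.2 ⟨Fin.pos_iff_ne_zero.2 (Ne.symm hi),
      Fin.lt_last_iff_ne_last.2 (Ne.symm hj)⟩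
    rcases h with rfl | rfl
    · exact hs hmI
    · exact hs (Finset.mem_erase.2 ⟨hm, hmI⟩)
  let q₀ : ℤ := -(n : ℤ)
  have hq₀ : -((n + 1 : ℕ) : ℤ) + 1 = q₀ := by simp [q₀]
  let α₁ := α.set 0 L I _ b
  -- the equation at the top index determines the member of the family at the face opposite to `l`
  let γ : A.Hom q₀ (X 0) (X L) := ((-1 : ℤ) ^ (above I l).card) •
    ((α₁.set 0 L (I.erase l) q₀ 0).bd 0 L I q₀ - A.d hq₀ b)
  let β := α₁.set 0 L (I.erase l) q₀ γ
  have hβα : ∀ i j s p, ¬ (i = 0 ∧ j = L ∧ (s = I ∨ s = I.erase l)) → β i j s p = α i j s p :=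
    fun i j s p h => (set_of_ne _ (fun h' => h ⟨h'.1, h'.2.1, Or.inr h'.2.2⟩) _).trans
      (set_of_ne _ (fun h' => h ⟨h'.1, h'.2.1, Or.inl h'.2.2⟩) _)
  have hβm : ∀ m, m ≠ l → ∀ i j s, Index.Misses (i, j, s) m → ∀ p, β i j s p = α i j s p :=
    fun m hm i j s hs p => hβα i j s p (hmiss m hm i j s hs)
  have hβtop : β 0 L I (-((n + 1 : ℕ) : ℤ)) = b :=
    (set_of_ne _ (fun h => hne h.2.2.symm) _).trans (set_self _ _ _ _ _ _)
  have hEm : ∀ m, m ≠ l → ∀ i j s, Index.Misses (i, j, s) m → IsBetween i j s → ∀ (p q : ℤ)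
      (hq : p + 1 = q), p + s.card = 0 → A.d hq (β i j s p) = β.bd i j s q := by
    intro m hm i j s hs hb p q hq hp
    rw [hβm m hm i j s hs, hα m hm i j s hs hb p q hq hp]
    refine bd_congr (fun v hv p => (hβm m hm v j (above s v) ⟨?_, hs.2.1, ?_⟩ p).symm)
      (fun v hv p => (hβm m hm i v (below s v) ⟨hs.1, ?_, ?_⟩ p).symm)
      (fun v hv p => (hβm m hm i j (s.erase v) ⟨hs.1, hs.2.1, ?_⟩ p).symm)
    · rintro rfl
      exact hs.2.2 hv
    · exact fun h => hs.2.2 (mem_above.1 h).1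
    · rintro rfl
      exact hs.2.2 hv
    · exact fun h => hs.2.2 (mem_below.1 h).1
    · exact fun h => hs.2.2 (Finset.mem_of_mem_erase h)
  have hEtop : A.d hq₀ (β 0 L I _) = β.bd 0 L I q₀ := by
    rw [hβtop, bd_set α₁ hIb hlI, smul_smul, ← mul_pow]
    simp
  -- the equation at the face opposite to `l` follows from `d ∘ d = 0` at the top index
  have hEl : ∀ (q : ℤ) (hq : q₀ + 1 = q), A.d hq (β 0 L (I.erase l) q₀) =
      β.bd 0 L (I.erase l) q := by
    intro q hq
    have h := β.d_bd (i := 0) (j := L) (s := I) hq (fun v hv p p' hp hc => ?_)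
      (fun v hv p p' hp hc => ?_)
    · rw [← hEtop, A.d_d, Finset.sum_eq_single l (fun v hv hvl => ?_) (fun h => absurd hlI h)] at h
      · have h' := congrArg (((-1 : ℤ) ^ (above I l).card) • ·) h
        simp only [smul_smul, ← mul_pow, neg_mul_neg, one_mul, one_pow, one_smul, smul_zero] at h'
        exact (sub_eq_zero.1 h'.symm).symm
      · rw [hEm v hvl 0 L (I.erase v) ⟨(hIb v hv).1.ne, (hIb v hv).2.ne', Finset.notMem_erase _ _⟩
          ⟨h0.trans h1, fun w hw => hIb w (Finset.mem_of_mem_erase hw)⟩ _ _ hq, sub_self, smul_zero]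
        rw [Finset.card_erase_of_mem hv, hcI]
        simp [q₀]
    · exact hEm 0 h0.ne v L _ ⟨(hIb v hv).1.ne', (h0.trans h1).ne', fun h =>
        (hIb 0 (mem_above.1 h).1).1.false⟩ ⟨(hIb v hv).2, fun w hw => ⟨(mem_above.1 hw).2,
          (hIb w (mem_above.1 hw).1).2⟩⟩ _ _ hp hc
    · refine hEm L h1.ne' 0 v _ ⟨(h0.trans h1).ne, (hIb v hv).2.ne, fun h =>
        (hIb L (mem_below.1 h).1).2.false⟩ ⟨(hIb v hv).1, fun w hw =>
          ⟨(hIb w (mem_below.1 hw).1).1, (mem_below.1 hw).2⟩⟩ _ _ hp ?_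
      have := card_above_add_card_below hv
      change p + (below I v).card = 0
      simp only [q₀] at hc
      omega
  refine ⟨β, hβm, hβtop, fun i j s p q hq hs hp => ?_⟩
  rcases hs.misses_or h0.ne h1.ne' with ⟨m, hm, hms⟩ | ⟨rfl, rfl, rfl | rfl⟩
  · exact hEm m hm i j s hms hs p q hq hp
  · obtain rfl : p = -((n + 1 : ℕ) : ℤ) := by rw [card_Ioo_zero_last] at hp; omega
    obtain rfl : q = q₀ := by omega
    exact hEtop
  · obtain rfl : p = q₀ := by
      rw [Finset.card_erase_of_mem hlI, hcI] at hp
      simp only [q₀]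
      omega
    exact hEl q hq

end MorFamily

namespace NCSimplex

/-- The top morphism of a simplex, together with its source and target. -/
noncomputable def top (σ : NCSimplex A (n + 1)) : Σ x y, A.Hom (-(n : ℤ)) x y :=
  σ.tot (0, Fin.last (n + 1), Finset.Ioo 0 (Fin.last (n + 1))) (-(n : ℤ))

/-- A filler of an inner horn is determined by its top morphism. -/
theorem eq_of_face_of_top {l : Fin (n + 3)} (h0 : 0 < l) (h1 : l < Fin.last (n + 2))
    {σ τ : NCSimplex A (n + 2)} (hf : ∀ m, m ≠ l → σ.face m = τ.face m) (ht : σ.top = τ.top) :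
    σ = τ := by
  have hmiss : ∀ m, m ≠ l → ∀ κ : Index (Fin (n + 3)), κ.Misses m → ∀ p,
      σ.tot κ p = τ.tot κ p := by
    intro m hm κ hκ p
    obtain ⟨κ, rfl⟩ := hκ.exists_map
    rw [← tot_face, ← tot_face, hf m hm]
  have hobj : σ.obj = τ.obj := by
    funext v
    obtain ⟨m, hm, hv⟩ : ∃ m, m ≠ l ∧ v ≠ m := by
      rcases eq_or_ne v 0 with rfl | hv
      · exact ⟨_, h1.ne', (h0.trans h1).ne⟩
      · exact ⟨0, h0.ne, hv⟩
    exact congrArg Sigma.fst (hmiss m hm (v, v, ∅) ⟨hv, hv, by simp⟩ 0)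
  have hlI : l ∈ Finset.Ioo 0 (Fin.last (n + 2)) := Finset.mem_Ioo.2 ⟨h0, h1⟩
  have hcI : (Finset.Ioo 0 (Fin.last (n + 2))).card = n + 1 := card_Ioo_zero_last (n + 1)
  have hIb : IsBetween 0 (Fin.last (n + 2)) (Finset.Ioo 0 (Fin.last (n + 2))) :=
    ⟨h0.trans h1, fun v hv => Finset.mem_Ioo.1 hv⟩
  have hz : ∀ i j s (p : ℤ), ¬ (IsBetween i j s ∧ p + s.card = 0) →
      σ.tot (i, j, s) p = τ.tot (i, j, s) p := by
    intro i j s p h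
    simp only [tot]
    rw [family_of_not _ h, family_of_not _ h, hobj]
  have h : ∀ i j s (p : ℤ), ¬ (i = 0 ∧ j = Fin.last (n + 2) ∧
      s = (Finset.Ioo 0 (Fin.last (n + 2))).erase l) → σ.tot (i, j, s) p = τ.tot (i, j, s) p := by
    intro i j s p h
    by_cases hb : IsBetween i j s ∧ p + s.card = 0
    · rcases hb.1.misses_or h0.ne h1.ne' with ⟨m, hm, hms⟩ | ⟨rfl, rfl, rfl | rfl⟩
      · exact hmiss m hm _ hms p
      · obtain rfl : p = -((n + 1 : ℕ) : ℤ) := by have := hb.2; omega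
        exact ht
      · exact absurd ⟨rfl, rfl, rfl⟩ h
    · exact hz i j s p hb
  refine ext_family hobj fun i j s p hs hp => ?_
  by_cases hl : i = 0 ∧ j = Fin.last (n + 2) ∧ s = (Finset.Ioo 0 (Fin.last (n + 2))).erase l
  · obtain ⟨rfl, rfl, rfl⟩ := hl
    have hp' : -((n + 1 : ℕ) : ℤ) + 1 = p := by
      rw [Finset.card_erase_of_mem hlI] at hp
      omega
    exact MorFamily.eq_of_bd σ.family hobj τ.family hIb.2 hlI h hp'
      (σ.d_family hIb (by omega) _) (τ.d_family hIb (by omega) _)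
  · exact h i j s p hl

/-- The filling of an inner horn with a prescribed top morphism. -/
theorem exists_filler {l : Fin (n + 3)} (h0 : 0 < l) (h1 : l < Fin.last (n + 2))
    (f : ∀ m : Fin (n + 3), m ≠ l → NCSimplex A (n + 1))
    (hf : ∀ (i j : Fin (n + 2)) (hi : i.castSucc ≠ l) (hj : j.succ ≠ l), i ≤ j →
      (f j.succ hj).face i = (f i.castSucc hi).face j)
    (e : Σ x y, A.Hom (-((n + 1 : ℕ) : ℤ)) x y) (he : e.1 = (f _ h1.ne').obj 0)
    (he' : e.2.1 = (f _ h0.ne).obj (Fin.last (n + 1))) :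
    ∃ σ : NCSimplex A (n + 2), (∀ m hm, σ.face m = f m hm) ∧ σ.top = e := by
  obtain ⟨X, α, hα⟩ := exists_morFamily h1.ne' f hf
  have hX : ∀ m hm i, X (m.succAbove i) = (f m hm).obj i :=
    fun m hm i => congrArg Sigma.fst (hα m hm i i ∅ 0)
  have hX0 : e.1 = X 0 := by
    have h := hX _ h1.ne' 0
    rw [Fin.succAbove_last] at h
    exact he.trans h.symm
  have hXl : e.2.1 = X (Fin.last (n + 2)) := by
    have h := hX _ h0.ne (Fin.last (n + 1))
    rw [Fin.succAbove_zero, Fin.succ_last] at h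
    exact he'.trans h.symm
  obtain ⟨b, rfl⟩ := exists_sigma_eq e hX0 hXl
  obtain ⟨β, hβ, hb, hE⟩ := α.exists_extension h0 h1 (fun m hm i j s hs hb p q hq hp => by
    obtain ⟨⟨i, j, s⟩, h⟩ := hs.exists_map
    obtain ⟨rfl, rfl, rfl⟩ := by simpa only [Index.map, Prod.mk.injEq] using h
    have hb' : IsBetween i j s := by
      obtain ⟨h1, h2⟩ := hb
      refine ⟨(Fin.succAboveOrderEmb m).lt_iff_lt.1 h1, fun v hv => ?_⟩
      have h := h2 _ (Finset.mem_map_of_mem _ hv)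
      exact ⟨(Fin.succAboveOrderEmb m).lt_iff_lt.1 h.1, (Fin.succAboveOrderEmb m).lt_iff_lt.1 h.2⟩
    exact MorFamily.d_eq_bd_of_restrict α (f m hm).family (Fin.succAboveOrderEmb m) (hα m hm) hq
      ((f m hm).d_family hb' (by rwa [Finset.card_map] at hp) hq)) b
  have hcI : (Finset.Ioo 0 (Fin.last (n + 2))).card = n + 1 := card_Ioo_zero_last (n + 1)
  have hfam : ∀ {i j s} {p : ℤ} (_ : IsBetween i j s) (_ : p + s.card = 0),
      (ofFamily β fun i j s p q hq hs hp => hE i j s p q hq hs hp).tot (i, j, s) p =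
        ⟨X i, X j, β i j s p⟩ :=
    fun hs hp => congrArg (fun e => (⟨_, _, e⟩ : Σ x y, A.Hom _ x y)) (family_ofFamily β _ hs hp)
  refine ⟨ofFamily β fun i j s p q hq hs hp => hE i j s p q hq hs hp, fun m hm => ?_, ?_⟩
  · refine ext_family (funext fun i => hX m hm i) fun i j s p hs hp => ?_
    refine (tot_face _ m (i, j, s) p).trans ?_
    rw [← hα m hm]
    refine (hfam (p := p) ?_ ?_).trans ?_
    · refine ⟨(Fin.succAboveOrderEmb m).lt_iff_lt.2 hs.1, fun v hv => ?_⟩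
      obtain ⟨v, hv', rfl⟩ := Finset.mem_map.1 hv
      exact ⟨(Fin.succAboveOrderEmb m).lt_iff_lt.2 (hs.2 v hv').1,
        (Fin.succAboveOrderEmb m).lt_iff_lt.2 (hs.2 v hv').2⟩
    · change p + (s.map (Fin.succAboveEmb m)).card = 0
      rwa [Finset.card_map]
    · exact congrArg (fun e => (⟨_, _, e⟩ : Σ x y, A.Hom _ x y))
        (hβ m hm _ _ _ (Index.misses_succAbove m (i, j, s)) p)
  · refine (hfam ⟨h0.trans h1, fun v hv => Finset.mem_Ioo.1 hv⟩ (by omega)).trans ?_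
    rw [hb]

/-- The edges of a simplex are equivalences if those of all faces but an inner one are. -/
theorem EdgesInvertible.of_face {l : Fin (n + 3)} (h0 : 0 < l) (h1 : l < Fin.last (n + 2))
    {σ : NCSimplex A (n + 2)} (h : ∀ m, m ≠ l → (σ.face m).EdgesInvertible) :
    σ.EdgesInvertible := by
  have key : ∀ (m : Fin (n + 3)) (_ : m ≠ l) (i j : Fin (n + 3)) (hij : i ≤ j), i ≠ m → j ≠ m →
      A.IsEquivalence (σ.hom (Chain.edge hij) 0 (by simp [Chain.edge])) := by
    intro m hm i j hij hi hj
    obtain ⟨i, rfl⟩ := Fin.exists_succAbove_eq hi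
    obtain ⟨j, rfl⟩ := Fin.exists_succAbove_eq hj
    exact h m hm i j ((Fin.succAboveOrderEmb m).le_iff_le.1 hij)
  intro i j hij
  by_cases hi : i = 0
  · by_cases hj : j = Fin.last _
    · subst hi hj
      -- the edge from the first to the last vertex is homotopic to the composite through `l`
      have e1 := key (Fin.last _) h1.ne' 0 l h0.le (h0.trans h1).ne h1.ne
      have e2 := key 0 h0.ne l (Fin.last _) h1.le h0.ne' (h0.trans h1).ne'
      refine (e2.comp₀ e1).of_homotopic (DGCat.Homotopic.symm ?_)
      let c : Chain (n + 2) 0 (Fin.last (n + 2)) := ⟨[l], by simp [Fin.le_last]⟩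
      refine ⟨σ.hom c (-1) (by simp [c]), ?_⟩
      rw [σ.differential c (-1) 0 _ (neg_add_cancel 1)]
      have hs : ∀ f : Fin c.inner.length → A.Hom 0 (σ.obj 0) (σ.obj (Fin.last (n + 2))),
        ∑ s, f s = f ⟨0, by simp [c]⟩ := fun f => Fin.sum_univ_one f
      rw [hs]
      simp only [c, Chain.back, List.drop, List.length_nil, pow_zero, one_smul]
      exact (add_sub_cancel _ _).symm
    · exact key _ h1.ne' i j hij (fun h => hj (Fin.last_le_iff.1 (h ▸ hij))) hj
  · exact key 0 h0.ne i j hij hi (fun h => hi (Fin.le_zero_iff.1 (h ▸ hij)))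

end NCSimplex

end Filler

/-! ### Spaces of morphisms and matching functors -/

section MorphismSpaces

variable {k : Type u} [Field k]

namespace DGFamily

variable (R : DGFamily k)

/-- The functor of all morphisms of degree `p`, together with their sources and targets. -/
def mor (p : ℤ) : CommAlgCat.{u} k ⥤ Type u where
  obj B := Σ x y, (R.obj B).Hom p x y
  map f := ↾fun e => ⟨(R.map f).obj e.1, (R.map f).obj e.2.1, (R.map f).map e.2.2⟩
  map_id B := by
    rw [R.map_id]
    rfl
  map_comp f g := by
    rw [R.map_comp]
    rfl

/-- The functor of pairs of objects. -/
def pairs : CommAlgCat.{u} k ⥤ Type u where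
  obj B := (R.obj B).Obj × (R.obj B).Obj
  map f := ↾fun e => ((R.map f).obj e.1, (R.map f).obj e.2)
  map_id B := by
    rw [R.map_id]
    rfl
  map_comp f g := by
    rw [R.map_comp]
    rfl

/-- The source and the target of a morphism. -/
def ends (p : ℤ) : R.mor p ⟶ R.pairs := natTransOf (fun _ e => (e.1, e.2.1)) fun _ _ => rfl

/-- The differential, as a transformation between the functors of morphisms. -/
def dMor {p q : ℤ} (hq : p + 1 = q) : R.mor p ⟶ R.mor q :=
  natTransOf (fun B e => ⟨e.1, e.2.1, (R.obj B).d hq e.2.2⟩) fun f e =>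
    congrArg (fun b => (⟨_, _, b⟩ : Σ x y, (R.obj _).Hom q x y)) ((R.map f).map_d hq e.2.2).symm

/-- The zero morphism with the same source and target. -/
def zeroMor (p q : ℤ) : R.mor p ⟶ R.mor q :=
  natTransOf (fun _ e => ⟨e.1, e.2.1, 0⟩) fun f _ =>
    congrArg (fun b => (⟨_, _, b⟩ : Σ x y, (R.obj _).Hom q x y)) (map_zero (R.map f).map).symm

variable {R}

/-- The functor of morphisms of a given degree is represented by the total space of a vector bundle
over the scheme of pairs of objects. -/
theorem REPR.exists_bundle (hR : R.REPR) (p : ℤ) : ∃ (O : Over (Spec (.of k)))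
    (V : GeomVectorBundle (O ⊗ O)) (a : R.mor p ⟶ points V.total) (b : R.pairs ⟶ points (O ⊗ O)),
    a ≫ pointsMap V.proj = R.ends p ≫ b ∧ (∀ B, Function.Bijective (b.app B)) ∧
    ∀ B (y : R.pairs.obj B) (v : Pt V.total B), v ≫ V.proj = (b.app B y : Pt (O ⊗ O) B) →
      ∃! x, (R.ends p).app B x = y ∧ a.app B x = v := by
  obtain ⟨O, e, hV⟩ := hR
  obtain ⟨V, t, ht⟩ := hV p
  let a : R.mor p ⟶ points V.total := natTransOf (fun B e => (t e.1 e.2.1 e.2.2).1)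
    fun f e => ht f e.1 e.2.1 e.2.2
  let b : R.pairs ⟶ points (O ⊗ O) := natTransOf
    (fun B y => (lift (e.hom.app B y.1 : Pt O B) (e.hom.app B y.2 : Pt O B) : Pt (O ⊗ O) B))
    (fun {B C} f y => by
      refine CartesianMonoidalCategory.hom_ext (X := O) (Y := O) _ _ ?_ ?_
      · refine (lift_fst _ _).trans ?_
        refine Eq.trans ?_ (Category.assoc _ _ _).symm
        refine Eq.trans ?_ (congrArg _ (lift_fst _ _).symm)
        exact NatTrans.naturality_apply e.hom f y.1
      · refine (lift_snd _ _).trans ?_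
        refine Eq.trans ?_ (Category.assoc _ _ _).symm
        refine Eq.trans ?_ (congrArg _ (lift_snd _ _).symm)
        exact NatTrans.naturality_apply e.hom f y.2)
  have hb : ∀ B, Function.Injective (b.app B) := by
    intro B y y' h
    have h1 := congrArg (fun s : Pt (O ⊗ O) B => s ≫ fst O O) h
    have h2 := congrArg (fun s : Pt (O ⊗ O) B => s ≫ snd O O) h
    have h1' := (lift_fst _ _).symm.trans (h1.trans (lift_fst _ _))
    have h2' := (lift_snd _ _).symm.trans (h2.trans (lift_snd _ _))
    have he := ((isIso_iff_bijective (e.hom.app B)).1 inferInstance).1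
    exact Prod.ext (he h1') (he h2')
  refine ⟨O, V, a, b, ?_, fun B => ⟨hb B, fun s => ?_⟩, fun B y v hv => ?_⟩
  · ext B x
    exact (t x.1 x.2.1 x.2.2).2
  · change Pt (O ⊗ O) B at s
    have he := ((isIso_iff_bijective (e.hom.app B)).1 inferInstance).2
    obtain ⟨y, hy⟩ := he (s ≫ fst O O : Pt O B)
    obtain ⟨y', hy'⟩ := he (s ≫ snd O O : Pt O B)
    refine ⟨(y, y'), CartesianMonoidalCategory.hom_ext (X := O) (Y := O) _ _ ?_ ?_⟩
    · exact (lift_fst _ _).trans hy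
    · exact (lift_snd _ _).trans hy'
  · obtain ⟨x, y⟩ := y
    refine ⟨⟨x, y, (t x y).symm ⟨v, hv⟩⟩, ⟨rfl, ?_⟩, ?_⟩
    · exact congrArg Subtype.val ((t x y).apply_symm_apply ⟨v, hv⟩)
    · rintro ⟨x', y', f⟩ ⟨h, h'⟩
      obtain ⟨rfl, rfl⟩ := Prod.mk.inj h
      have : f = (t x' y').symm ⟨v, hv⟩ := ((t x' y').eq_symm_apply).2 (Subtype.ext h')
      exact congrArg (fun f => (⟨x', y', f⟩ : Σ x y, (R.obj B).Hom p x y)) this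

theorem REPR.isRep_mor (hR : R.REPR) (p : ℤ) : IsRep (R.mor p) := by
  obtain ⟨O, V, a, b, w, hb, h⟩ := hR.exists_bundle p
  have hw (B) (x : (R.mor p).obj B) : (a.app B x : Pt V.total B) ≫ V.proj =
      (b.app B ((R.ends p).app B x) : Pt (O ⊗ O) B) :=
    ConcreteCategory.congr_hom (congrArg (fun t => NatTrans.app t B) w) x
  refine IsRep.of_bijective ⟨V.total, ⟨Iso.refl _⟩⟩ a fun B => ⟨fun x x' hx => ?_, fun v => ?_⟩
  · have h1 : (R.ends p).app B x = (R.ends p).app B x' :=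
      (hb B).1 ((hw B x).symm.trans
        ((congrArg (fun v : Pt V.total B => v ≫ V.proj) hx).trans (hw B x')))
    exact (h B _ _ (hw B x')).unique ⟨h1, hx⟩ ⟨rfl, rfl⟩
  · change Pt V.total B at v
    obtain ⟨y, hy⟩ := (hb B).2 (v ≫ V.proj : Pt (O ⊗ O) B)
    obtain ⟨x, ⟨-, hx⟩, -⟩ := h B y v hy.symm
    exact ⟨x, hx⟩

theorem REPR.isRep_ob (hR : R.REPR) : IsRep R.ob := by
  obtain ⟨O, e, -⟩ := hR
  exact ⟨O, ⟨e⟩⟩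

end DGFamily

section

variable {Y : CommAlgCat.{u} k ⥤ SSet.{u}} {n : ℕ} {l : Fin (n + 3)}

/-- The matching functor of a horn is an equalizer of two transformations between finite products. -/
theorem isRep_match (h : IsRep (level Y n)) (h' : IsRep (level Y (n + 1))) (l : Fin (n + 3)) :
    IsRep (Match Y n l) := by
  let F : CommAlgCat.{u} k ⥤ Type u :=
    piFunctor fun _ : {i : Fin (n + 3) // i ≠ l} => level Y (n + 1)
  let J := {ij : Fin (n + 2) × Fin (n + 2) //
    ij.1.castSucc ≠ l ∧ ij.2.succ ≠ l ∧ ij.1 ≤ ij.2}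
  let G : CommAlgCat.{u} k ⥤ Type u := piFunctor fun _ : J => level Y n
  let a : F ⟶ G := natTransOf (fun B f ij => (Y.obj B).δ ij.1.1 (f ⟨ij.1.2.succ, ij.2.2.1⟩))
    fun φ f => funext fun ij => (SSet.δ_naturality_apply (Y.map φ) _ _).symm
  let b : F ⟶ G := natTransOf (fun B f ij => (Y.obj B).δ ij.1.2 (f ⟨ij.1.1.castSucc, ij.2.1⟩))
    fun φ f => funext fun ij => (SSet.δ_naturality_apply (Y.map φ) _ _).symm
  have hF : IsRep F := IsRep.pi fun _ => h'
  have hG : IsRep G := IsRep.pi fun _ => h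
  let η : Match Y n l ⟶ eqFunctor a b := natTransOf
    (fun B f => ⟨fun i => f.1 i.1 i.2, funext fun ij => f.2 _ _ ij.2.1 ij.2.2.1 ij.2.2.2⟩)
    fun φ f => rfl
  refine (hF.eqFunctor hG a b).of_bijective η fun B => ⟨fun f f' hf => ?_, fun f => ?_⟩
  · refine Subtype.ext (funext fun i => funext fun hi => ?_)
    exact congrFun (congrArg Subtype.val hf) ⟨i, hi⟩
  · exact ⟨⟨fun i hi => f.1 ⟨i, hi⟩, fun i j hi hj hij =>
      congrFun f.2 ⟨(i, j), hi, hj, hij⟩⟩, rfl⟩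

/-- If a simplex is determined by its image in the matching functor and a morphism, which is
arbitrary with prescribed source and target, then the matching map is a base change of the
projection of a vector bundle. -/
theorem gp_of_existsUnique {R : DGFamily k} (hR : R.REPR) {p : ℤ} (hM : IsRep (Match Y n l))
    (a : level Y (n + 2) ⟶ R.mor p) (b : Match Y n l ⟶ R.pairs)
    (w : a ≫ R.ends p = matchMap Y n l ≫ b)
    (h : ∀ B (m : (Match Y n l).obj B) (e : (R.mor p).obj B), (R.ends p).app B e = b.app B m →
      ∃! x, (matchMap Y n l).app B x = m ∧ a.app B x = e) : GP Y n l := by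
  obtain ⟨O, V, a', b', w', -, h'⟩ := hR.exists_bundle p
  have hw' (B) (x : (R.mor p).obj B) : (a'.app B x : Pt V.total B) ≫ V.proj =
      (b'.app B ((R.ends p).app B x) : Pt (O ⊗ O) B) :=
    ConcreteCategory.congr_hom (congrArg (fun t => NatTrans.app t B) w') x
  have hw (B) (x : (level Y (n + 2)).obj B) : (R.ends p).app B (a.app B x) =
      b.app B ((matchMap Y n l).app B x) :=
    ConcreteCategory.congr_hom (congrArg (fun t => NatTrans.app t B) w) x
  obtain ⟨T, ⟨eT⟩⟩ := hM
  obtain ⟨S, eS, f, g, c, hf, hp⟩ := IsRep.pullback (matchMap Y n l) (a ≫ a') (b ≫ b') V.proj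
    (by rw [Category.assoc, w', reassoc_of% w]) (fun B m v hv => by
      obtain ⟨e, ⟨he, he'⟩, hu⟩ := h' B (b.app B m) v hv
      obtain ⟨x, ⟨hx, hx'⟩, hu'⟩ := h B m e he
      refine ⟨x, ⟨hx, (congrArg (a'.app B) hx').trans he'⟩, ?_⟩
      rintro z ⟨hz, hz'⟩
      refine hu' z ⟨hz, hu _ ⟨?_, hz'⟩⟩
      exact (hw B z).trans (congrArg (b.app B) hz)) eT
  have hp' := hp.map (Over.forget _)
  refine ⟨S, T, eS, eT, f, hf, ?_, ?_⟩
  · exact (smooth_isStableUnderBaseChange.{u}).of_isPullback (P := @AlgebraicGeometry.Smooth)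
      hp'.flip V.smooth_proj
  · exact MorphismProperty.of_isPullback (P := @AlgebraicGeometry.Surjective) hp'.flip
      V.surjective_proj

theorem isRep_of_gp (h : GP Y n l) : IsRep (level Y (n + 2)) := by
  obtain ⟨S, -, e, -⟩ := h
  exact ⟨S, ⟨e⟩⟩

/-- All levels are representable if the first two are, since the matching functor of a horn is a finite
limit of functors in lower levels. -/
theorem isSimplicialScheme_of_gp (h0 : IsRep (level Y 0)) (h1 : IsRep (level Y 1))
    (h : ∀ (n : ℕ) (l : Fin (n + 3)), 0 < l → l < Fin.last (n + 2) → IsRep (Match Y n l) →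
      GP Y n l) : IsSimplicialScheme Y ∧
      ∀ (n : ℕ) (l : Fin (n + 3)), 0 < l → l < Fin.last (n + 2) → GP Y n l := by
  have key : ∀ n, IsRep (level Y n) ∧ IsRep (level Y (n + 1)) := by
    intro n
    induction n with
    | zero => exact ⟨h0, h1⟩
    | succ n ih =>
      refine ⟨ih.2, isRep_of_gp (h n 1 ?_ ?_ (isRep_match ih.1 ih.2 1))⟩
      · simp
      · rw [Fin.lt_def]
        simp
  exact ⟨fun n => (key n).1, fun n l hl hl' => h n l hl hl' (isRep_match (key n).1 (key n).2 l)⟩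

end

end MorphismSpaces

/-! ### The simplices of dimension zero and one -/

section Nerve

namespace NCSimplex

variable {B C : Type u} [CommRing B] [CommRing C] {A : DGCat B} {n : ℕ}

theorem family_mapFunctor {φ : B →+* C} {A' : DGCat C} (F : DGFunctor φ A A')
    (σ : NCSimplex A n) (i j : Fin (n + 1)) (s : Finset (Fin (n + 1))) (p : ℤ) :
    (σ.mapFunctor F).family i j s p = F.map (σ.family i j s p) := by
  unfold family
  split_ifs with h
  · rfl
  · exact (map_zero F.map).symm

/-- The morphism from the first to the second vertex of a `1`-simplex. -/
def arrow (σ : NCSimplex A 1) : A.Hom 0 (σ.obj 0) (σ.obj 1) :=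
  σ.hom (Chain.edge (Fin.zero_le 1)) 0 (by simp [Chain.edge])

theorem d_arrow (σ : NCSimplex A 1) : A.d (zero_add 1) σ.arrow = 0 := by
  rw [arrow, σ.differential _ 0 1 _ (zero_add 1)]
  exact Fintype.sum_empty (ι := Fin 0) _

theorem arrow_eq_family (σ : NCSimplex A 1) : σ.arrow = σ.family 0 1 ∅ 0 :=
  σ.hom_eq_family _ _ _ (by simp [Chain.edge, Chain.vertices])

theorem isBetween_fin_two {i j : Fin 2} {s : Finset (Fin 2)} (h : IsBetween i j s) :
    i = 0 ∧ j = 1 ∧ s = ∅ := by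
  obtain ⟨h1, h2⟩ := h
  have : i = 0 ∧ j = 1 := by omega
  refine ⟨this.1, this.2, Finset.eq_empty_of_forall_notMem fun v hv => ?_⟩
  have := h2 v hv
  omega

/-- A simplex of dimension one is determined by its arrow. -/
theorem ext_one {σ τ : NCSimplex A 1}
    (h : (⟨_, _, σ.arrow⟩ : Σ x y, A.Hom 0 x y) = ⟨_, _, τ.arrow⟩) : σ = τ := by
  have h0 : σ.obj 0 = τ.obj 0 := congrArg Sigma.fst h
  have h1 : σ.obj 1 = τ.obj 1 := congrArg (fun e => e.2.1) h
  refine ext_family (funext fun i => ?_) fun i j s p hs hp => ?_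
  · fin_cases i
    · exact h0
    · exact h1
  · obtain ⟨rfl, rfl, rfl⟩ := isBetween_fin_two hs
    obtain rfl : p = 0 := by simpa using hp
    rwa [arrow_eq_family, arrow_eq_family] at h

/-- The arrow of a simplex of dimension one can be any closed morphism of degree `0`. -/
theorem exists_arrow {x y : A.Obj} (f : A.Hom 0 x y) (hf : A.d (zero_add 1) f = 0) :
    ∃ σ : NCSimplex A 1, (⟨_, _, σ.arrow⟩ : Σ x y, A.Hom 0 x y) = ⟨x, y, f⟩ := by
  let α : MorFamily A ![x, y] := MorFamily.set (fun _ _ _ _ => 0) 0 1 ∅ 0 f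
  have hα : α 0 1 ∅ 0 = f := MorFamily.set_self _ _ _ _ _ _
  have h : ∀ (i j : Fin 2) (s : Finset (Fin 2)) (p q : ℤ) (hq : p + 1 = q), IsBetween i j s →
      p + s.card = 0 → A.d hq (α i j s p) = α.bd i j s q := by
    intro i j s p q hq hs hp
    obtain ⟨rfl, rfl, rfl⟩ := isBetween_fin_two hs
    obtain rfl : p = 0 := by simpa using hp
    obtain rfl : q = 1 := by omega
    rw [hα]
    exact hf
  refine ⟨ofFamily α h, ?_⟩
  rw [arrow_eq_family, family_ofFamily α h ⟨by simp, by simp⟩ (by simp), hα]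
  rfl

theorem edgesInvertible_iff_arrow (σ : NCSimplex A 1) :
    σ.EdgesInvertible ↔ A.IsEquivalence σ.arrow := by
  refine ⟨fun h => h 0 1 (Fin.zero_le 1), fun h (i j : Fin 2) hij => ?_⟩
  rcases hij.eq_or_lt with rfl | hlt
  · rw [σ.unit]
    exact DGCat.isEquivalence_id _
  · obtain ⟨rfl, rfl⟩ : i = 0 ∧ j = 1 := by omega
    exact h

theorem eq_of_obj_zero {σ τ : NCSimplex A 0} (h : σ.obj 0 = τ.obj 0) : σ = τ := by
  refine ext_family (funext fun i => ?_) fun i j s p hs hp => ?_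
  · obtain rfl := Subsingleton.elim (α := Fin 1) i 0
    exact h
  · exact absurd hs.1 (by simp [Subsingleton.elim (α := Fin 1) i j])

theorem exists_obj_zero (x : A.Obj) : ∃ σ : NCSimplex A 0, σ.obj 0 = x :=
  ⟨ofFamily (X := fun _ => x) (fun _ _ _ _ => 0) fun i j s p q hq hs hp =>
    absurd hs.1 (by simp [Subsingleton.elim (α := Fin 1) i j]), rfl⟩

theorem edgesInvertible_zero (σ : NCSimplex A 0) : σ.EdgesInvertible := by
  intro i j hij
  obtain rfl := Subsingleton.elim (α := Fin 1) i j
  rw [σ.unit]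
  exact DGCat.isEquivalence_id _

end NCSimplex

end Nerve

/-! ### The matching maps of the nerves -/

namespace DGFamily

variable {k : Type u} [Field k] (R : DGFamily k)

/-- The inclusion of `X` in `X̄`. -/
def inclusion (n : ℕ) : level R.X n ⟶ level R.Xbar n :=
  natTransOf (fun B (σ : {σ : NCSimplex (R.obj B) n // σ.EdgesInvertible}) => σ.1) fun _ _ => rfl

/-- The first vertex. -/
def vertexXbar : level R.Xbar 0 ⟶ R.ob :=
  natTransOf (fun B (σ : NCSimplex (R.obj B) 0) => σ.obj 0) fun _ _ => rfl

/-- The arrow of a `1`-simplex. -/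
def arrowXbar : level R.Xbar 1 ⟶ R.mor 0 :=
  natTransOf (fun B (σ : NCSimplex (R.obj B) 1) => ⟨_, _, σ.arrow⟩) fun _ _ => rfl

/-- The top morphism of a simplex. -/
noncomputable def topXbar (n : ℕ) : level R.Xbar (n + 1) ⟶ R.mor (-(n : ℤ)) :=
  natTransOf (fun B (σ : NCSimplex (R.obj B) (n + 1)) => σ.top) fun f σ =>
    congrArg (fun b => (⟨_, _, b⟩ : Σ x y, (R.obj _).Hom _ x y))
      (NCSimplex.family_mapFunctor (R.map f) σ _ _ _ _)

variable {n : ℕ} {l : Fin (n + 3)}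

/-- The first and the last vertex of an inner horn. -/
def hornEnds (h0 : 0 < l) (h1 : l < Fin.last (n + 2)) : Match R.Xbar n l ⟶ R.pairs :=
  natTransOf (fun B m => ((m.1 _ h1.ne' : NCSimplex (R.obj B) (n + 1)).obj 0,
    (m.1 _ h0.ne : NCSimplex (R.obj B) (n + 1)).obj (Fin.last (n + 1)))) fun _ _ => rfl

/-- The inclusion between the matching functors. -/
def matchInclusion : Match R.X n l ⟶ Match R.Xbar n l :=
  natTransOf (fun B m => ⟨fun i hi =>
      (m.1 i hi : {σ : NCSimplex (R.obj B) (n + 1) // σ.EdgesInvertible}).1,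
    fun i j hi hj hij => congrArg
      (fun σ : {σ : NCSimplex (R.obj B) n // σ.EdgesInvertible} => σ.1) (m.2 i j hi hj hij)⟩)
    fun _ _ => rfl

/-- A filler of an inner horn amounts to a morphism from its first to its last vertex. -/
theorem exists_unique_filler_Xbar (h0 : 0 < l) (h1 : l < Fin.last (n + 2))
    (B : CommAlgCat.{u} k) (m : (Match R.Xbar n l).obj B) (e : (R.mor (-((n + 1 : ℕ) : ℤ))).obj B)
    (he : (R.ends _).app B e = (R.hornEnds h0 h1).app B m) :
    ∃! x, (matchMap R.Xbar n l).app B x = m ∧ (R.topXbar (n + 1)).app B x = e := by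
  obtain ⟨f, hf⟩ := m
  obtain ⟨σ, hσ, ht⟩ := NCSimplex.exists_filler h0 h1 f hf e (congrArg Prod.fst he)
    (congrArg Prod.snd he)
  refine ⟨σ, ⟨Subtype.ext (funext fun i => funext fun hi => hσ i hi), ht⟩, ?_⟩
  rintro (τ : NCSimplex (R.obj B) (n + 2)) ⟨hτ, ht'⟩
  refine NCSimplex.eq_of_face_of_top h0 h1 (fun i hi => ?_) (Eq.trans ht' ht.symm)
  exact (congrFun (congrFun (congrArg Subtype.val hτ) i) hi).trans (hσ i hi).symm

variable {R}

theorem REPR.gp_Xbar (hR : R.REPR) (h0 : 0 < l) (h1 : l < Fin.last (n + 2))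
    (hM : IsRep (Match R.Xbar n l)) : GP R.Xbar n l :=
  gp_of_existsUnique hR hM (R.topXbar (n + 1)) (R.hornEnds h0 h1) (by
    ext B σ
    change NCSimplex (R.obj B) (n + 2) at σ
    have e1 : (Fin.last (n + 2)).succAbove 0 = 0 := by simp
    have e2 : (0 : Fin (n + 3)).succAbove (Fin.last (n + 1)) = Fin.last (n + 2) := by simp
    exact Prod.ext (congrArg σ.obj e1).symm (congrArg σ.obj e2).symm)
    (R.exists_unique_filler_Xbar h0 h1)

theorem REPR.gp_X (hR : R.REPR) (h0 : 0 < l) (h1 : l < Fin.last (n + 2))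
    (hM : IsRep (Match R.X n l)) : GP R.X n l :=
  gp_of_existsUnique hR hM (R.inclusion (n + 2) ≫ R.topXbar (n + 1))
    (R.matchInclusion ≫ R.hornEnds h0 h1) (by
      ext B σ
      change {σ : NCSimplex (R.obj B) (n + 2) // σ.EdgesInvertible} at σ
      have e1 : (Fin.last (n + 2)).succAbove 0 = 0 := by simp
      have e2 : (0 : Fin (n + 3)).succAbove (Fin.last (n + 1)) = Fin.last (n + 2) := by simp
      exact Prod.ext (congrArg σ.1.obj e1).symm (congrArg σ.1.obj e2).symm)
    (fun B m e he => by
      obtain ⟨σ, ⟨hσ, ht⟩, hu⟩ :=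
        R.exists_unique_filler_Xbar h0 h1 B (R.matchInclusion.app B m) e he
      change NCSimplex (R.obj B) (n + 2) at σ
      have hface : ∀ i hi, σ.face i =
          (m.1 i hi : {σ : NCSimplex (R.obj B) (n + 1) // σ.EdgesInvertible}).1 := fun i hi =>
        congrFun (congrFun (congrArg Subtype.val hσ) i) hi
      have hinv : σ.EdgesInvertible := NCSimplex.EdgesInvertible.of_face h0 h1 fun i hi => by
        rw [hface i hi]
        exact (m.1 i hi : {σ : NCSimplex (R.obj B) (n + 1) // σ.EdgesInvertible}).2
      refine ⟨(⟨σ, hinv⟩ : {σ : NCSimplex (R.obj B) (n + 2) // σ.EdgesInvertible}),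
        ⟨Subtype.ext (funext fun i => funext fun hi => Subtype.ext (hface i hi)), ht⟩, ?_⟩
      rintro (τ : {σ : NCSimplex (R.obj B) (n + 2) // σ.EdgesInvertible}) ⟨hτ, ht'⟩
      exact Subtype.ext (hu τ.1 ⟨congrArg (R.matchInclusion.app B) hτ, ht'⟩))

theorem REPR.isRep_Xbar_zero (hR : R.REPR) : IsRep (level R.Xbar 0) :=
  hR.isRep_ob.of_bijective R.vertexXbar fun _ =>
    ⟨fun _ _ h => NCSimplex.eq_of_obj_zero h, fun x => NCSimplex.exists_obj_zero x⟩

theorem REPR.isRep_X_zero (hR : R.REPR) : IsRep (level R.X 0) :=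
  hR.isRep_Xbar_zero.of_bijective (R.inclusion 0) fun _ =>
    ⟨fun _ _ h => Subtype.ext h, fun σ => ⟨⟨σ, NCSimplex.edgesInvertible_zero _⟩, rfl⟩⟩

/-- The closed morphisms of degree `0` form the equalizer of the differential and zero. -/
theorem REPR.isRep_Xbar_one (hR : R.REPR) : IsRep (level R.Xbar 1) := by
  let η : level R.Xbar 1 ⟶ eqFunctor (R.dMor (zero_add 1)) (R.zeroMor 0 1) := natTransOf
    (fun B (σ : NCSimplex (R.obj B) 1) => ⟨R.arrowXbar.app B σ,
      congrArg (fun b => (⟨_, _, b⟩ : Σ x y, (R.obj B).Hom 1 x y)) σ.d_arrow⟩) fun _ _ => rfl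
  refine ((hR.isRep_mor 0).eqFunctor (hR.isRep_mor 1) _ _).of_bijective η fun B =>
    ⟨fun σ τ h => NCSimplex.ext_one (congrArg Subtype.val h), fun f => ?_⟩
  obtain ⟨⟨x, y, f⟩, hf⟩ := f
  obtain ⟨σ, hσ⟩ := NCSimplex.exists_arrow f (MorFamily.eq_of_sigma hf)
  exact ⟨σ, Subtype.ext hσ⟩

end DGFamily

/-! ### Cycles and boundaries over a ring and over a field -/

section LinearAlgebra

open Matrix

theorem LinearMap.exists_comp_comp_self {K V W : Type*} [Field K] [AddCommGroup V] [Module K V]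
    [AddCommGroup W] [Module K W] (f : V →ₗ[K] W) : ∃ g : W →ₗ[K] V, ∀ v, f (g (f v)) = f v := by
  obtain ⟨r, hr⟩ := f.rangeRestrict.exists_rightInverse_of_surjective f.range_rangeRestrict
  obtain ⟨g, hg⟩ := LinearMap.exists_extend r
  refine ⟨g, fun v => ?_⟩
  have h1 : g (f v) = r (f.rangeRestrict v) := LinearMap.congr_fun hg (f.rangeRestrict v)
  rw [h1]
  exact congrArg Subtype.val (LinearMap.congr_fun hr (f.rangeRestrict v))

/-- An exact sequence of vector spaces is contractible in the middle. -/
theorem LinearMap.exists_contraction {K V₁ V₂ V₃ : Type*} [Field K] [AddCommGroup V₁] [Module K V₁]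
    [AddCommGroup V₂] [Module K V₂] [AddCommGroup V₃] [Module K V₃] (f : V₁ →ₗ[K] V₂)
    (g : V₂ →ₗ[K] V₃) (h : ∀ v, g v = 0 → ∃ w, f w = v) :
    ∃ (s : V₂ →ₗ[K] V₁) (s' : V₃ →ₗ[K] V₂), f ∘ₗ s + s' ∘ₗ g = LinearMap.id := by
  obtain ⟨f', hf'⟩ := f.exists_comp_comp_self
  obtain ⟨g', hg'⟩ := g.exists_comp_comp_self
  refine ⟨f' ∘ₗ (LinearMap.id - g' ∘ₗ g), g', ?_⟩
  ext v
  obtain ⟨w, hw⟩ := h (v - g' (g v)) (by rw [map_sub, hg', sub_self])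
  simp only [LinearMap.add_apply, LinearMap.comp_apply, LinearMap.sub_apply, LinearMap.id_apply]
  rw [← hw, hf', hw, sub_add_cancel]

variable {A : Type*} [CommRing A] {m n r : Type*} [Fintype m] [Fintype n] [Fintype r]
  [DecidableEq m] [DecidableEq n]

/-- If an endomorphism `U` preserves the image of `M` and maps `q` to it, then `det U • q` lies in
the image of `M`, by the Cayley–Hamilton theorem. -/
theorem Matrix.exists_mulVec_eq_det_smul (U : Matrix n n A) (M : Matrix n m A) (N : Matrix m m A)
    (hU : U * M = M * N) (q : n → A) (w : m → A) (hq : U *ᵥ q = M *ᵥ w) :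
    ∃ w', M *ᵥ w' = U.det • q := by
  have hpow : ∀ p : Polynomial A, ∃ w', (Polynomial.aeval U p) *ᵥ (U *ᵥ q) = M *ᵥ w' := by
    intro p
    induction p using Polynomial.induction_on' with
    | add p p' hp hp' =>
      obtain ⟨w₁, h₁⟩ := hp
      obtain ⟨w₂, h₂⟩ := hp'
      exact ⟨w₁ + w₂, by rw [map_add, add_mulVec, h₁, h₂, mulVec_add]⟩
    | monomial i a =>
      refine ⟨a • (N ^ i) *ᵥ w, ?_⟩
      have hi : U ^ i * M = M * N ^ i := by
        induction i with
        | zero => simp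
        | succ i ih => rw [pow_succ, Matrix.mul_assoc, hU, ← Matrix.mul_assoc, ih,
            Matrix.mul_assoc, ← pow_succ]
      rw [Polynomial.aeval_monomial, hq, ← Algebra.smul_def, smul_mulVec, mulVec_mulVec, hi,
        mulVec_smul, mulVec_mulVec]
  obtain ⟨w', hw'⟩ := hpow U.charpoly.divX
  have h := U.aeval_self_charpoly
  rw [← U.charpoly.divX_mul_X_add, map_add, map_mul, Polynomial.aeval_X, Polynomial.aeval_C] at h
  have h' := congrArg (· *ᵥ q) h
  simp only [add_mulVec, ← mulVec_mulVec, hw', zero_mulVec] at h'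
  rw [Algebra.algebraMap_eq_smul_one, smul_mulVec, one_mulVec] at h'
  refine ⟨-((-1 : A) ^ Fintype.card n • w'), ?_⟩
  rw [U.det_eq_sign_charpoly_coeff, mulVec_neg, mulVec_smul, mul_smul,
    eq_neg_of_add_eq_zero_right h', smul_neg]

/-- Let `M₁`, `M₂` be matrices over a ring `A` with `M₂ M₁ = 0`, which define an exact sequence over
a field `K`. Then a cycle becomes a boundary after multiplication with an element of `A` that does
not vanish in `K`. To see this one takes the determinant of `M₁ S₀ + S₁ M₂` with indeterminate
matrices `S₀` and `S₁`: it multiplies cycles to boundaries, and one of its coefficients does not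
vanish in `K`, as it takes the value `1` at a contraction over `K`. -/
theorem Matrix.exists_mulVec_eq_smul {K : Type*} [Field K] [DecidableEq r]
    (π : A →+* K) (M₁ : Matrix n m A)
    (M₂ : Matrix r n A) (h : M₂ * M₁ = 0)
    (hK : ∀ v, (M₂.map π) *ᵥ v = 0 → ∃ w, (M₁.map π) *ᵥ w = v) (q : n → A) (hq : M₂ *ᵥ q = 0) :
    ∃ t w, π t ≠ 0 ∧ M₁ *ᵥ w = t • q := by
  obtain ⟨s, s', hs⟩ := LinearMap.exists_contraction (M₁.map π).mulVecLin (M₂.map π).mulVecLin hK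
  have hs' : M₁.map π * s.toMatrix' + s'.toMatrix' * M₂.map π = 1 := by
    have := congrArg LinearMap.toMatrix' hs
    rwa [map_add, LinearMap.toMatrix'_comp, LinearMap.toMatrix'_comp, LinearMap.toMatrix'_id,
      ← Matrix.toLin'_apply', ← Matrix.toLin'_apply', LinearMap.toMatrix'_toLin',
      LinearMap.toMatrix'_toLin'] at this
  let P := MvPolynomial ((m × n) ⊕ (n × r)) A
  let S₀ : Matrix m n P := Matrix.of fun i j => MvPolynomial.X (Sum.inl (i, j))
  let S₁ : Matrix n r P := Matrix.of fun i j => MvPolynomial.X (Sum.inr (i, j))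
  let c : A →+* P := MvPolynomial.C
  let U : Matrix n n P := M₁.map c * S₀ + S₁ * M₂.map c
  have h' : M₂.map c * M₁.map c = 0 := by
    rw [← Matrix.map_mul, h, Matrix.map_zero _ (map_zero c)]
  have hq' : M₂.map c *ᵥ (c ∘ q) = 0 := by
    ext i
    rw [← RingHom.map_mulVec, hq]
    simp
  obtain ⟨w, hw⟩ := U.exists_mulVec_eq_det_smul (M₁.map c) (S₀ * M₁.map c)
    (by simp only [U]; rw [Matrix.add_mul, Matrix.mul_assoc S₁, h', Matrix.mul_zero, add_zero,
      Matrix.mul_assoc]) (c ∘ q) (S₀ *ᵥ (c ∘ q))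
    (by simp only [U]; rw [add_mulVec, ← mulVec_mulVec _ S₁, hq', mulVec_zero, add_zero,
      ← mulVec_mulVec])
  let ev : P →+* K := MvPolynomial.eval₂Hom π
    (Sum.elim (fun ij => s.toMatrix' ij.1 ij.2) (fun ij => s'.toMatrix' ij.1 ij.2))
  have hev : ev U.det = 1 := by
    rw [RingHom.map_det, ← Matrix.det_one (n := n), ← hs']
    congr 1
    have e1 : (M₁.map c).map ev = M₁.map π := by ext; exact MvPolynomial.eval₂_C _ _ _
    have e2 : (M₂.map c).map ev = M₂.map π := by ext; exact MvPolynomial.eval₂_C _ _ _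
    have e3 : S₀.map ev = s.toMatrix' := by ext; exact MvPolynomial.eval₂_X _ _ _
    have e4 : S₁.map ev = s'.toMatrix' := by ext; exact MvPolynomial.eval₂_X _ _ _
    rw [RingHom.mapMatrix_apply, ← e1, ← e2, ← e3, ← e4, ← Matrix.map_mul, ← Matrix.map_mul,
      ← Matrix.map_add _ (map_add ev)]
  obtain ⟨μ, hμ⟩ : ∃ μ, π (U.det.coeff μ) ≠ 0 := by
    by_contra! hc
    have : ev U.det = 0 := by
      change MvPolynomial.eval₂ π _ U.det = 0
      rw [MvPolynomial.eval₂_eq]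
      exact Finset.sum_eq_zero fun μ _ => by rw [hc, zero_mul]
    exact one_ne_zero (hev.symm.trans this)
  refine ⟨U.det.coeff μ, fun j => (w j).coeff μ, hμ, ?_⟩
  ext i
  have h1 : ∑ j, MvPolynomial.C (M₁ i j) * w j = MvPolynomial.C (q i) * U.det :=
    (congrFun hw i).trans (mul_comm _ _)
  calc (M₁ *ᵥ fun j => (w j).coeff μ) i
      = ∑ j, MvPolynomial.coeff μ (MvPolynomial.C (M₁ i j) * w j) :=
        Finset.sum_congr rfl fun j _ => (MvPolynomial.coeff_C_mul μ _ (w j)).symm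
    _ = MvPolynomial.coeff μ (∑ j, MvPolynomial.C (M₁ i j) * w j) :=
        (MvPolynomial.coeff_sum _ _ _).symm
    _ = MvPolynomial.coeff μ (MvPolynomial.C (q i) * U.det) := congrArg _ h1
    _ = q i * MvPolynomial.coeff μ U.det := MvPolynomial.coeff_C_mul μ _ U.det
    _ = _ := mul_comm _ _

end LinearAlgebra

/-! ### Complexes of free modules -/

section BaseChange

variable {A K : Type*} [CommRing A] [Field K] (π : A →+* K)

/-- A map from an `A`-module to a `K`-module which is given by `π : A → K` in suitable finite bases,
so that it identifies the `K`-module with the base change of the `A`-module. -/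
def IsFreeBaseChange {M N : Type*} [AddCommGroup M] [Module A M] [AddCommGroup N] [Module K N]
    (r : M → N) : Prop :=
  ∃ (ι : Type) (_ : Fintype ι) (b : Module.Basis ι A M) (c : Module.Basis ι K N),
    ∀ m i, c.repr (r m) i = π (b.repr m i)

variable {π}
variable {M₁ M₂ M₃ N₁ N₂ N₃ : Type*} [AddCommGroup M₁] [Module A M₁] [AddCommGroup M₂] [Module A M₂]
  [AddCommGroup M₃] [Module A M₃] [AddCommGroup N₁] [Module K N₁] [AddCommGroup N₂] [Module K N₂]
  [AddCommGroup N₃] [Module K N₃] {r₁ : M₁ → N₁} {r₂ : M₂ → N₂} {r₃ : M₃ → N₃}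

theorem IsFreeBaseChange.prodMap (h₁ : IsFreeBaseChange π r₁) (h₂ : IsFreeBaseChange π r₂) :
    IsFreeBaseChange π (Prod.map r₁ r₂) := by
  obtain ⟨ι, _, b, c, h⟩ := h₁
  obtain ⟨ι', _, b', c', h'⟩ := h₂
  refine ⟨ι ⊕ ι', inferInstance, b.prod b', c.prod c', fun m i => ?_⟩
  rcases i with i | i
  · simp [h]
  · simp [h']

/-- A complex of finite free modules over `A` which becomes exact over the field `K`: a cycle is a
boundary after multiplication with an element of `A` that does not vanish in `K`. -/
theorem IsFreeBaseChange.exists_eq_smul (h₁ : IsFreeBaseChange π r₁) (h₂ : IsFreeBaseChange π r₂)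
    (h₃ : IsFreeBaseChange π r₃) (f : M₁ →ₗ[A] M₂) (g : M₂ →ₗ[A] M₃) (hgf : ∀ m, g (f m) = 0)
    (f' : N₁ →ₗ[K] N₂) (g' : N₂ →ₗ[K] N₃) (hf : ∀ m, r₂ (f m) = f' (r₁ m))
    (hg : ∀ m, r₃ (g m) = g' (r₂ m)) (hex : ∀ v, g' v = 0 → ∃ w, f' w = v) (q : M₂)
    (hq : g q = 0) : ∃ t w, π t ≠ 0 ∧ f w = t • q := by
  classical
  obtain ⟨ι₁, _, b₁, c₁, h₁⟩ := h₁
  obtain ⟨ι₂, _, b₂, c₂, h₂⟩ := h₂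
  obtain ⟨ι₃, _, b₃, c₃, h₃⟩ := h₃
  have e₁ (j) : r₁ (b₁ j) = c₁ j := c₁.ext_elem fun i => by
    rw [h₁, b₁.repr_self, c₁.repr_self, Finsupp.single_apply, Finsupp.single_apply]
    split_ifs <;> simp
  have e₂ (j) : r₂ (b₂ j) = c₂ j := c₂.ext_elem fun i => by
    rw [h₂, b₂.repr_self, c₂.repr_self, Finsupp.single_apply, Finsupp.single_apply]
    split_ifs <;> simp
  have m₁ : (LinearMap.toMatrix b₁ b₂ f).map π = LinearMap.toMatrix c₁ c₂ f' := by
    ext i j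
    rw [Matrix.map_apply, LinearMap.toMatrix_apply, LinearMap.toMatrix_apply, ← e₁, ← hf, h₂]
  have m₂ : (LinearMap.toMatrix b₂ b₃ g).map π = LinearMap.toMatrix c₂ c₃ g' := by
    ext i j
    rw [Matrix.map_apply, LinearMap.toMatrix_apply, LinearMap.toMatrix_apply, ← e₂, ← hg, h₃]
  obtain ⟨t, w, ht, hw⟩ := Matrix.exists_mulVec_eq_smul π (LinearMap.toMatrix b₁ b₂ f)
    (LinearMap.toMatrix b₂ b₃ g) (by
      rw [← LinearMap.toMatrix_comp, LinearMap.ext (f := g ∘ₗ f) (g := 0) hgf, map_zero])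
    (fun v hv => by
      have hv' : ⇑(c₂.repr (c₂.equivFun.symm v)) = v := c₂.equivFun.apply_symm_apply v
      rw [m₂, ← hv', LinearMap.toMatrix_mulVec_repr] at hv
      obtain ⟨w, hw⟩ := hex _ (c₃.repr.map_eq_zero_iff.1 (DFunLike.coe_injective hv))
      exact ⟨c₁.repr w, by rw [m₁, LinearMap.toMatrix_mulVec_repr, hw, hv']⟩) (b₂.repr q) (by
      rw [LinearMap.toMatrix_mulVec_repr, hq]
      simp)
  refine ⟨t, b₁.equivFun.symm w, ht, b₂.repr.injective (DFunLike.coe_injective ?_)⟩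
  rw [← LinearMap.toMatrix_mulVec_repr b₁ b₂, map_smul, Finsupp.coe_smul, ← hw]
  congr 1
  exact b₁.equivFun.apply_symm_apply w

end BaseChange

/-! ### Inverses up to homotopy and a scalar -/

section Equivalences

namespace DGCat

variable {B : Type u} [CommRing B] {A : DGCat B} {x y z : A.Obj}

/-- For an equivalence `f : x ⟶ y`, the cone of the composition with `f` is acyclic. -/
theorem IsEquivalence.exists_lift {f : A.Hom 0 x y} (hf : A.IsEquivalence f) (b : A.Hom 1 z x)
    (c : A.Hom 0 z y) (hb : A.d one_add_one_eq_two b = 0)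
    (hbc : A.comp (add_zero 1) f b = A.d (zero_add 1) c) :
    ∃ (a : A.Hom 0 z x) (h : A.Hom (-1) z y), A.d (zero_add 1) a = b ∧
      A.comp₀ f a - A.d (neg_add_cancel 1) h = c := by
  obtain ⟨hf, g, h, k, hg, e₁, e₂⟩ := hf
  -- `b` is the boundary of `g c - k b`
  have h1 : A.d (zero_add 1) (A.comp₀ g c - A.comp (add_neg_cancel 1) k b) = b := by
    have l1 : A.d (zero_add 1) (A.comp₀ g c) = A.comp (add_zero 1) g (A.comp (add_zero 1) f b) := by
      rw [DGCat.comp₀, A.leibniz _ (zero_add 1) (zero_add 1) _ (zero_add 1) (add_zero 1), hg, hbc]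
      simp
    have l2 : A.d (zero_add 1) (A.comp (add_neg_cancel 1) k b) =
        A.comp (add_zero 1) (A.d (neg_add_cancel 1) k) b := by
      rw [A.leibniz _ one_add_one_eq_two (neg_add_cancel 1) _ (add_zero 1) (by norm_num), hb]
      simp
    have l3 : A.comp (add_zero 1) g (A.comp (add_zero 1) f b) =
        b + A.comp (add_zero 1) (A.d (neg_add_cancel 1) k) b := by
      rw [A.assoc (add_zero 1) (zero_add 0) (add_zero 1) (add_zero 1), e₂, map_add,
        LinearMap.add_apply, A.id_comp]
    rw [map_sub, l1, l2, l3, add_sub_cancel_right]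
  let a := A.comp₀ g c - A.comp (add_neg_cancel 1) k b
  let w := A.comp₀ f a - c
  -- the cycle `w` that is left is a boundary up to `f`
  have hw : A.d (zero_add 1) w = 0 := by
    rw [map_sub, DGCat.comp₀, A.leibniz _ (zero_add 1) (zero_add 1) _ (zero_add 1) (add_zero 1), hf,
      h1, hbc]
    simp
  have hgw : A.d (zero_add 1) (A.comp₀ g w) = 0 := d_comp₀ hg hw
  have hfgw : A.comp₀ f (A.comp₀ g w) =
      w + A.d (neg_add_cancel 1) (A.comp (zero_add (-1)) h w) := by
    rw [← comp₀_assoc, DGCat.comp₀, DGCat.comp₀, e₁, map_add, LinearMap.add_apply, A.id_comp,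
      A.leibniz _ (zero_add 1) (neg_add_cancel 1) _ (zero_add 0) (add_neg_cancel 1), hw]
    simp
  refine ⟨a - A.comp₀ g w, -A.comp (zero_add (-1)) h w, ?_, ?_⟩
  · rw [map_sub, h1, hgw, sub_zero]
  · have : A.comp₀ f (a - A.comp₀ g w) = A.comp₀ f a - A.comp₀ f (A.comp₀ g w) := by
      simp [DGCat.comp₀]
    rw [this, hfgw, map_neg]
    simp only [w]
    abel

/-- A closed morphism with a right homotopy inverse, which again has a right homotopy inverse, is an
equivalence; it suffices to have the inverses up to units. -/
theorem isEquivalence_of_right_inverses {f : A.Hom 0 x y} {a : A.Hom 0 y x} {f' : A.Hom 0 x y}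
    (hf : A.d (zero_add 1) f = 0) (ha : A.d (zero_add 1) a = 0) (hf' : A.d (zero_add 1) f' = 0)
    {t t' : B} (ht : IsUnit t) (ht' : IsUnit t') (h : A.Homotopic (A.comp₀ f a) (t • A.id y))
    (h' : A.Homotopic (A.comp₀ a f') (t' • A.id x)) : A.IsEquivalence f := by
  obtain ⟨s, hs⟩ := ht.exists_left_inv
  obtain ⟨s', hs'⟩ := ht'.exists_left_inv
  have h1 : A.Homotopic (A.comp₀ f (s • a)) (A.id y) := by
    have := h.smul s
    rw [smul_smul, hs, one_smul] at this
    simpa [comp₀] using this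
  have h2 : A.Homotopic (A.comp₀ (s • a) (t • s' • f')) (A.id x) := by
    have := h'.smul s'
    rw [smul_smul, hs', one_smul] at this
    have e : A.comp₀ (s • a) (t • s' • f') = s' • A.comp₀ a f' := by
      simp only [comp₀, map_smul, LinearMap.smul_apply]
      rw [smul_comm s' s, ← mul_smul t s, mul_comm t s, hs, one_smul]
    rw [e]
    exact this
  have hsa : A.d (zero_add 1) (s • a) = 0 := by rw [map_smul, ha, smul_zero]
  have hsf : A.d (zero_add 1) (t • s' • f') = 0 := by
    rw [map_smul, map_smul, hf', smul_zero, smul_zero]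
  obtain ⟨-, c, hc, hc1, hc2⟩ := isEquivalence_iff.1 (isEquivalence_of_inverses hsa hsf hf h2 h1)
  refine isEquivalence_of_inverses hf hsa hsa h1 ?_
  have h3 : A.Homotopic f (t • s' • f') := by
    have e1 := (h2.comp₀_left hf).symm
    rw [← comp₀_assoc, comp₀_id] at e1
    have e2 := h1.comp₀_right hsf
    rw [id_comp₀] at e2
    exact e1.trans e2
  exact (h3.comp₀_left hsa).trans h2

end DGCat

variable {B K : Type u} [CommRing B] [Field K] {π : B →+* K} {A : DGCat B} {A' : DGCat K}
  (F : DGFunctor π A A')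

/-- A closed morphism which becomes an equivalence over a field has a right homotopy inverse, up to
an element that does not vanish in the field. -/
theorem DGFunctor.exists_right_inverse {x y : A.Obj} (h : ∀ p ∈ Finset.Icc (-1 : ℤ) 2, ∀ z,
      z = x ∨ z = y → IsFreeBaseChange π (F.map (p := p) (x := y) (y := z)))
    {f : A.Hom 0 x y} (hf : A.d (zero_add 1) f = 0) (hF : A'.IsEquivalence (F.map f)) :
    ∃ (t : B) (a : A.Hom 0 y x), π t ≠ 0 ∧ A.d (zero_add 1) a = 0 ∧
      A.Homotopic (A.comp₀ f a) (t • A.id y) := by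
  have hx (p : ℤ) (hp : p ∈ Finset.Icc (-1 : ℤ) 2) := h p hp x (Or.inl rfl)
  have hy (p : ℤ) (hp : p ∈ Finset.Icc (-1 : ℤ) 2) := h p hp y (Or.inr rfl)
  -- the part of the cone of the composition with `f` in degrees `-1`, `0` and `1`
  obtain ⟨t, ⟨a, e⟩, ht, hw⟩ := IsFreeBaseChange.exists_eq_smul
    ((hx 0 (by simp)).prodMap (hy (-1) (by simp))) ((hx 1 (by simp)).prodMap (hy 0 (by simp)))
    ((hx 2 (by simp)).prodMap (hy 1 (by simp)))
    (((A.d (zero_add 1)).comp (LinearMap.fst B _ _)).prod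
      ((A.comp (zero_add 0) f).comp (LinearMap.fst B _ _) -
        (A.d (neg_add_cancel 1)).comp (LinearMap.snd B _ _)))
    (((A.d one_add_one_eq_two).comp (LinearMap.fst B _ _)).prod
      ((A.comp (add_zero 1) f).comp (LinearMap.fst B _ _) -
        (A.d (zero_add 1)).comp (LinearMap.snd B _ _)))
    (fun ⟨a, e⟩ => by
      have : A.d (zero_add 1) (A.comp (zero_add 0) f a) =
          A.comp (add_zero 1) f (A.d (zero_add 1) a) := by
        rw [A.leibniz _ (zero_add 1) (zero_add 1) _ (zero_add 1) (add_zero 1), hf]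
        simp
      simp [A.d_d, this])
    (((A'.d (zero_add 1)).comp (LinearMap.fst K _ _)).prod
      ((A'.comp (zero_add 0) (F.map f)).comp (LinearMap.fst K _ _) -
        (A'.d (neg_add_cancel 1)).comp (LinearMap.snd K _ _)))
    (((A'.d one_add_one_eq_two).comp (LinearMap.fst K _ _)).prod
      ((A'.comp (add_zero 1) (F.map f)).comp (LinearMap.fst K _ _) -
        (A'.d (zero_add 1)).comp (LinearMap.snd K _ _)))
    (fun ⟨a, e⟩ => by simp [F.map_d, F.map_comp])
    (fun ⟨a, e⟩ => by simp [F.map_d, F.map_comp])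
    (fun ⟨b, c⟩ hbc => by
      obtain ⟨h1, h2⟩ := Prod.mk.inj hbc
      obtain ⟨a, e, h3, h4⟩ := hF.exists_lift b c h1 (sub_eq_zero.1 h2)
      exact ⟨(a, e), Prod.ext h3 h4⟩)
    (0, A.id y) (by simp [A.d_id])
  obtain ⟨h1, h2⟩ := Prod.mk.inj hw
  refine ⟨t, a, ht, by simpa using h1, e, ?_⟩
  exact sub_eq_iff_eq_add.1 h2

end Equivalences

/-! ### Localization of algebras and gluing of points -/

section Localization

variable {k : Type u} [Field k] {B C : CommAlgCat.{u} k}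

/-- The localization of an algebra away from an element. -/
def locAway (B : CommAlgCat.{u} k) (b : B) : CommAlgCat.{u} k :=
  CommAlgCat.of k (Localization.Away b)

/-- The localization morphism. -/
def locMap (b : B) : B ⟶ locAway B b :=
  CommAlgCat.ofHom (IsScalarTower.toAlgHom k B (Localization.Away b))

theorem isUnit_locMap (b : B) : IsUnit ((locMap b).hom b) :=
  IsLocalization.Away.algebraMap_isUnit (S := Localization.Away b) b

theorem exists_locMap_comp {b : B} (φ : B ⟶ C) (h : IsUnit (φ.hom b)) :
    ∃ ψ : locAway B b ⟶ C, locMap b ≫ ψ = φ := by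
  let g : Localization.Away b →+* C := IsLocalization.Away.lift (g := (φ.hom : B →+* C)) b h
  have hg (x : B) : g (algebraMap B (Localization.Away b) x) = φ.hom x :=
    IsLocalization.Away.lift_eq (g := (φ.hom : B →+* C)) b h x
  refine ⟨CommAlgCat.ofHom (AlgHom.mk g fun a => ?_), ?_⟩
  · have := hg (algebraMap k B a)
    rw [← IsScalarTower.algebraMap_apply k B (Localization.Away b)] at this
    exact this.trans (φ.hom.commutes a)
  · ext x
    exact hg x

theorem locMap_ext {b : B} {φ ψ : locAway B b ⟶ C} (h : locMap b ≫ φ = locMap b ≫ ψ) : φ = ψ := by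
  have : (φ.hom : locAway B b →+* C) = ψ.hom :=
    IsLocalization.ringHom_ext (S := Localization.Away b) (Submonoid.powers b) (by
      ext x
      exact congrArg (fun f : B ⟶ C => f.hom x) h)
  ext x
  exact congrArg (fun f : locAway B b →+* C => f x) this

theorem exists_pow_mul_eq_zero {b x : B} (h : (locMap b).hom x = 0) : ∃ N : ℕ, b ^ N * x = 0 := by
  obtain ⟨⟨_, N, rfl⟩, h⟩ := (IsLocalization.map_eq_zero_iff (Submonoid.powers b)
    (Localization.Away b) x).1 h
  exact ⟨N, h⟩

theorem exists_locMap_eq (b : B) (y : locAway B b) :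
    ∃ (N : ℕ) (x : B), (locMap b).hom x = (locMap b).hom b ^ N * y := by
  obtain ⟨N, x, h⟩ := IsLocalization.Away.surj (S := Localization.Away b) b y
  exact ⟨N, x, (mul_comm _ _).trans h |>.symm⟩

variable {S : Over (Spec (.of k))}

/-- A point with values in `B` is determined by its restrictions to the members of a cover by basic
open subsets. -/
theorem pt_ext_of_span {ι : Type u} {c : ι → B} (hc : Ideal.span (Set.range c) = ⊤)
    {s t : Pt S B} (h : ∀ i, s.res (locMap (c i)) = t.res (locMap (c i))) : s = t := by
  ext1
  refine (Scheme.affineOpenCoverOfSpanRangeEqTop (R := .of B) c hc).openCover.hom_ext _ _ fun i => ?_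
  exact congrArg CommaMorphism.left (h i)

/-- Compatible points over the members of a cover by basic open subsets can be glued. -/
theorem exists_pt_of_span {ι : Type u} {c : ι → B} (hc : Ideal.span (Set.range c) = ⊤)
    (s : ∀ i, Pt S (locAway B (c i)))
    (hs : ∀ (i j : ι) (D : CommAlgCat.{u} k) (φ : locAway B (c i) ⟶ D) (ψ : locAway B (c j) ⟶ D),
      locMap (c i) ≫ φ = locMap (c j) ≫ ψ → (s i).res φ = (s j).res ψ) :
    ∃ t : Pt S B, ∀ i, t.res (locMap (c i)) = s i := by
  let 𝒰 := (Scheme.affineOpenCoverOfSpanRangeEqTop (R := .of B) c hc).openCover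
  have hcompat : ∀ i j, Limits.pullback.fst (𝒰.f i) (𝒰.f j) ≫ (s i).left =
      Limits.pullback.snd (𝒰.f i) (𝒰.f j) ≫ (s j).left := by
    intro i j
    -- the intersection of two members of the cover is affine, hence the spectrum of an algebra
    let W : Over (Spec (.of k)) := Over.mk (Limits.pullback.fst (𝒰.f i) (𝒰.f j) ≫
      ((algSpec (.of k)).obj (op (locAway B (c i)))).hom)
    have : IsAffine W.left :=
      inferInstanceAs (IsAffine (Limits.pullback (Spec.map _) (Spec.map _)))
    obtain ⟨D, ⟨e⟩⟩ := exists_algSpec_iso W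
    let p : W ⟶ (algSpec (.of k)).obj (op (locAway B (c i))) :=
      Over.homMk (Limits.pullback.fst (𝒰.f i) (𝒰.f j))
    let q : W ⟶ (algSpec (.of k)).obj (op (locAway B (c j))) :=
      Over.homMk (Limits.pullback.snd (𝒰.f i) (𝒰.f j)) (by
        have h1 := Over.w ((algSpec (.of k)).map (locMap (c i)).op)
        have h2 := Over.w ((algSpec (.of k)).map (locMap (c j)).op)
        have h3 : Limits.pullback.fst (𝒰.f i) (𝒰.f j) ≫
          ((algSpec (.of k)).map (locMap (c i)).op).left = Limits.pullback.snd (𝒰.f i) (𝒰.f j) ≫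
          ((algSpec (.of k)).map (locMap (c j)).op).left := Limits.pullback.condition
        change _ ≫ ((algSpec (.of k)).obj (op (locAway B (c j)))).hom =
          _ ≫ ((algSpec (.of k)).obj (op (locAway B (c i)))).hom
        rw [← h1, ← h2]
        exact (Category.assoc _ _ _).symm.trans
          ((congrArg (· ≫ _) h3.symm).trans (Category.assoc _ _ _)))
    have hpq : p ≫ (algSpec (.of k)).map (locMap (c i)).op =
        q ≫ (algSpec (.of k)).map (locMap (c j)).op := by
      ext1
      exact Limits.pullback.condition
    obtain ⟨φ, hφ⟩ := (algSpec.instFull (R := .of k)).map_surjective (e.hom ≫ p)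
    obtain ⟨ψ, hψ⟩ := (algSpec.instFull (R := .of k)).map_surjective (e.hom ≫ q)
    have h := hs i j D φ.unop ψ.unop (by
      apply Quiver.Hom.op_inj
      apply (algSpec.instFaithful (R := .of k)).map_injective
      refine ((algSpec (.of k)).map_comp φ (locMap (c i)).op).trans
        (Eq.trans ?_ ((algSpec (.of k)).map_comp ψ (locMap (c j)).op).symm)
      rw [hφ, hψ, Category.assoc, Category.assoc, hpq])
    have h' : (e.hom ≫ p) ≫ s i = (e.hom ≫ q) ≫ s j := by
      rw [← hφ, ← hψ]
      exact h
    rw [Category.assoc, Category.assoc, cancel_epi] at h'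
    exact congrArg CommaMorphism.left h'
  refine ⟨Over.homMk (𝒰.glueMorphisms (fun i => (s i).left) hcompat) ?_, fun i => ?_⟩
  · refine 𝒰.hom_ext _ _ fun i => ?_
    refine (Category.assoc _ _ _).symm.trans
      ((congrArg (· ≫ S.hom) (𝒰.ι_glueMorphisms _ hcompat i)).trans ?_)
    exact (Over.w (s i)).trans (Over.w ((algSpec (.of k)).map (locMap (c i)).op)).symm
  · ext1
    exact 𝒰.ι_glueMorphisms _ hcompat i

instance isOpenImmersion_locMap (b : B) :
    IsOpenImmersion ((algSpec (.of k)).map (locMap b).op).left :=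
  inferInstanceAs (IsOpenImmersion (Spec.map (CommRingCat.ofHom
    (algebraMap B (Localization.Away b)))))

theorem range_locMap (b : B) : Set.range ((algSpec (.of k)).map (locMap b).op).left =
    (PrimeSpectrum.basicOpen b : Set (PrimeSpectrum B)) :=
  PrimeSpectrum.localization_away_comap_range (Localization.Away b) b

end Localization

/-! ### Quasi-coherence of the sections of a vector bundle -/

section QuasiCoherence

variable {k : Type u} [Field k] {S : Over (Spec (.of k))}

theorem Pt.res_res {B C D : CommAlgCat.{u} k} (s : Pt S B) (φ : B ⟶ C) (ψ : C ⟶ D) :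
    (s.res φ).res ψ = s.res (φ ≫ ψ) := by
  simp [Pt.res]

theorem Pt.preimage_res {B C : CommAlgCat.{u} k} {s : Pt S B} {U : S.left.Opens}
    (hs : s.left ⁻¹ᵁ U = ⊤) (φ : B ⟶ C) : (s.res φ).left ⁻¹ᵁ U = ⊤ := by
  rw [Pt.res, Over.comp_left, Scheme.Hom.comp_preimage, hs, Scheme.Hom.preimage_top]

namespace GeomVectorBundle

variable (V : GeomVectorBundle S)

/-- The pullback of sections along a morphism of algebras, where the equation for the point is an
argument. -/
noncomputable def pull {B C : CommAlgCat.{u} k} {s : Pt S B} {s' : Pt S C} (φ : B ⟶ C)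
    (h : s.res φ = s') : SectionsOver V.proj s →ₛₗ[(φ.hom : B →+* C)] SectionsOver V.proj s' where
  toFun v := ⟨v.1.res φ, (v.res φ).2.trans h⟩
  map_add' v w := by
    subst h
    exact V.res_add φ s v w
  map_smul' b v := by
    subst h
    exact V.res_smul φ s b v

theorem pull_val {B C : CommAlgCat.{u} k} {s : Pt S B} {s' : Pt S C} (φ : B ⟶ C)
    (h : s.res φ = s') (v : SectionsOver V.proj s) : (V.pull φ h v).1 = v.1.res φ := rfl

theorem pull_pull {B C D : CommAlgCat.{u} k} {s : Pt S B} {s' : Pt S C} {s'' : Pt S D} {φ : B ⟶ C}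
    {ψ : C ⟶ D} {χ : B ⟶ D} (h : s.res φ = s') (h' : s'.res ψ = s'') (h'' : s.res χ = s'')
    (hχ : φ ≫ ψ = χ) (v : SectionsOver V.proj s) : V.pull ψ h' (V.pull φ h v) = V.pull χ h'' v := by
  subst hχ
  exact Subtype.ext (Pt.res_res v.1 φ ψ)

/-- The bundle is trivial over the open subset `U`. -/
def TrivialOn (U : S.left.Opens) : Prop :=
  ∃ (r : ℕ) (t : ∀ {B : CommAlgCat.{u} k} (s : Pt S B), s.left ⁻¹ᵁ U = ⊤ →
      (SectionsOver V.proj s ≃ₗ[B] (Fin r → B))),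
    ∀ {B C : CommAlgCat.{u} k} (f : B ⟶ C) (s : Pt S B) (hs : s.left ⁻¹ᵁ U = ⊤) (s' : Pt S C)
      (hs' : s'.left ⁻¹ᵁ U = ⊤) (h : s.res f = s') (v : SectionsOver V.proj s),
      t s' hs' (V.pull f h v) = fun a => f.hom (t s hs v a)

theorem exists_trivialOn (x : S.left) : ∃ U, x ∈ U ∧ V.TrivialOn U := by
  obtain ⟨U, r, t, hx, ht⟩ := V.locallyTrivial x
  refine ⟨U, hx, r, t, ?_⟩
  rintro B C f s hs _ hs' rfl v
  exact ht f s hs hs' v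

variable {V} {B : CommAlgCat.{u} k} {s : Pt S B}

theorem TrivialOn.exists_pow_smul_eq_zero {U : S.left.Opens} (hU : V.TrivialOn U)
    (hs : s.left ⁻¹ᵁ U = ⊤) (b : B) {s' : Pt S (locAway B b)} (h : s.res (locMap b) = s')
    {v : SectionsOver V.proj s} (hv : V.pull (locMap b) h v = 0) : ∃ N : ℕ, b ^ N • v = 0 := by
  obtain ⟨r, t, ht⟩ := hU
  have hs' : s'.left ⁻¹ᵁ U = ⊤ := h ▸ Pt.preimage_res hs _
  have h0 := ht (locMap b) s hs s' hs' h v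
  rw [hv, map_zero] at h0
  have h1 (a : Fin r) : ∃ N : ℕ, b ^ N * t s hs v a = 0 :=
    exists_pow_mul_eq_zero (congrFun h0 a).symm
  choose N hN using h1
  refine ⟨∑ a, N a, (t s hs).injective ?_⟩
  rw [map_smul, map_zero]
  funext a
  obtain ⟨M, hM⟩ := exists_add_of_le (Finset.single_le_sum (fun i _ => Nat.zero_le (N i))
    (Finset.mem_univ a))
  rw [Pi.smul_apply, smul_eq_mul, hM, add_comm, pow_add, mul_assoc, hN, mul_zero]
  rfl

theorem TrivialOn.exists_pull_eq {U : S.left.Opens} (hU : V.TrivialOn U)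
    (hs : s.left ⁻¹ᵁ U = ⊤) (b : B) {s' : Pt S (locAway B b)} (h : s.res (locMap b) = s')
    (w : SectionsOver V.proj s') :
    ∃ (N : ℕ) (v : SectionsOver V.proj s), V.pull (locMap b) h v = ((locMap b).hom b) ^ N • w := by
  obtain ⟨r, t, ht⟩ := hU
  have hs' : s'.left ⁻¹ᵁ U = ⊤ := h ▸ Pt.preimage_res hs _
  have h1 (a : Fin r) := exists_locMap_eq b (t s' hs' w a)
  choose N x hx using h1
  choose M hM using fun a => exists_add_of_le (Finset.single_le_sum
    (fun i _ => Nat.zero_le (N i)) (Finset.mem_univ a))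
  refine ⟨∑ a, N a, (t s hs).symm fun a => b ^ M a * x a, (t s' hs').injective ?_⟩
  rw [ht (locMap b) s hs s' hs' h, map_smul]
  funext a
  rw [LinearEquiv.apply_symm_apply, Pi.smul_apply, smul_eq_mul, hM a, add_comm, pow_add, map_mul,
    map_pow, hx, mul_assoc]

/-- A bundle becomes trivial over the members of a finite cover by basic open subsets. -/
theorem exists_trivializing_cover (V : GeomVectorBundle S) (s : Pt S B) :
    ∃ (ι : Type u) (_ : Fintype ι) (c : ι → B), Ideal.span (Set.range c) = ⊤ ∧
      ∀ i, ∃ U, (s.res (locMap (c i))).left ⁻¹ᵁ U = ⊤ ∧ V.TrivialOn U := by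
  let T : Set B := {b | ∃ U, (s.res (locMap b)).left ⁻¹ᵁ U = ⊤ ∧ V.TrivialOn U}
  have hT : Ideal.span T = ⊤ := by
    by_contra hne
    obtain ⟨p, hp, hTp⟩ := Ideal.exists_le_maximal _ hne
    let x : PrimeSpectrum B := ⟨p, hp.isPrime⟩
    obtain ⟨U, hxU, hU⟩ := V.exists_trivialOn (s.left x)
    obtain ⟨_, ⟨_, ⟨b, rfl⟩, rfl⟩, hxb, hbU⟩ :=
      PrimeSpectrum.isBasis_basic_opens.exists_subset_of_mem_open (a := x) hxU
        (s.left ⁻¹ᵁ U).isOpen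
    refine hxb (hTp (Ideal.subset_span ⟨U, ?_, hU⟩))
    rw [Pt.res, Over.comp_left, Scheme.Hom.comp_preimage]
    refine top_le_iff.1 fun y _ => hbU ?_
    rw [← range_locMap]
    exact ⟨y, rfl⟩
  obtain ⟨T', hT', hspan⟩ := (Ideal.span_eq_top_iff_finite T).1 hT
  exact ⟨T', inferInstance, fun b => b.1, by simpa using hspan, fun b => hT' b.2⟩

/-- A section which vanishes on a basic open subset is killed by a power of its equation. -/
theorem exists_pow_smul_eq_zero (V : GeomVectorBundle S) (b : B) {s' : Pt S (locAway B b)}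
    (h : s.res (locMap b) = s') {v : SectionsOver V.proj s} (hv : V.pull (locMap b) h v = 0) :
    ∃ N : ℕ, b ^ N • v = 0 := by
  obtain ⟨ι, _, c, hc, hU⟩ := V.exists_trivializing_cover s
  have h1 (i : ι) : ∃ N : ℕ, ((locMap (c i)).hom b) ^ N • V.pull (locMap (c i)) rfl v = 0 := by
    obtain ⟨U, hs, hU⟩ := hU i
    obtain ⟨ψ, hψ⟩ := exists_locMap_comp (b := b)
      (locMap (c i) ≫ locMap ((locMap (c i)).hom b)) (isUnit_locMap _)
    refine hU.exists_pow_smul_eq_zero hs _ rfl ?_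
    rw [V.pull_pull rfl rfl (Pt.res_res _ _ _).symm rfl,
      ← V.pull_pull h (by rw [← h, Pt.res_res, hψ, Pt.res_res]) (Pt.res_res _ _ _).symm hψ, hv,
      map_zero]
  choose N hN using h1
  refine ⟨∑ i, N i, Subtype.ext (pt_ext_of_span hc fun i => ?_)⟩
  obtain ⟨M, hM⟩ := exists_add_of_le (Finset.single_le_sum (fun i _ => Nat.zero_le (N i))
    (Finset.mem_univ i))
  have h2 : V.pull (locMap (c i)) rfl (b ^ (∑ i, N i) • v) = V.pull (locMap (c i)) rfl 0 := by
    rw [LinearMap.map_smulₛₗ, map_zero, hM, add_comm, pow_add]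
    change (locMap (c i)).hom (b ^ M * b ^ N i) • _ = 0
    rw [map_mul, map_pow, map_pow, mul_smul, hN, smul_zero]
  exact congrArg Subtype.val h2

/-- The section `m` over `φ` agrees with `b ^ N • w` wherever `b` is invertible. -/
def AgreesWith (V : GeomVectorBundle S) {b : B} (w : SectionsOver V.proj (s.res (locMap b)))
    {C : CommAlgCat.{u} k} (φ : B ⟶ C) (m : SectionsOver V.proj (s.res φ)) (N : ℕ) : Prop :=
  ∀ (E : CommAlgCat.{u} k) (e : B ⟶ E) (χ : C ⟶ E) (θ : locAway B b ⟶ E) (h₁ : φ ≫ χ = e)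
    (h₂ : locMap b ≫ θ = e), V.pull (s' := s.res e) χ (by rw [Pt.res_res, h₁]) m =
      (e.hom b) ^ N • V.pull (s' := s.res e) θ (by rw [Pt.res_res, h₂]) w

theorem AgreesWith.smul {b : B} {w : SectionsOver V.proj (s.res (locMap b))} {C : CommAlgCat.{u} k}
    {φ : B ⟶ C} {m : SectionsOver V.proj (s.res φ)} {N : ℕ} (h : V.AgreesWith w φ m N) (M : ℕ) :
    V.AgreesWith w φ ((φ.hom b) ^ M • m) (M + N) := by
  intro E e χ θ h₁ h₂
  rw [LinearMap.map_smulₛₗ, h E e χ θ h₁ h₂, pow_add, mul_smul]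
  subst h₁
  congr 1
  exact map_pow χ.hom _ _

/-- A section over a basic open subset extends after multiplication with a power of its equation. -/
theorem exists_pull_eq (V : GeomVectorBundle S) (b : B) {s' : Pt S (locAway B b)}
    (h : s.res (locMap b) = s') (w : SectionsOver V.proj s') :
    ∃ (N : ℕ) (v : SectionsOver V.proj s), V.pull (locMap b) h v = ((locMap b).hom b) ^ N • w := by
  subst h
  obtain ⟨ι, _, c, hc, hU⟩ := V.exists_trivializing_cover s
  -- extensions over the members of the cover
  have h1 (i : ι) : ∃ N m, V.AgreesWith w (locMap (c i)) m N := by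
    obtain ⟨U, hs, hU⟩ := hU i
    obtain ⟨ψ, hψ⟩ := exists_locMap_comp (b := b)
      (locMap (c i) ≫ locMap ((locMap (c i)).hom b)) (isUnit_locMap _)
    obtain ⟨N, m, hm⟩ := hU.exists_pull_eq hs ((locMap (c i)).hom b) rfl
      (V.pull ψ (by rw [Pt.res_res, hψ, Pt.res_res]) w)
    refine ⟨N, m, fun E e χ θ h₁ h₂ => ?_⟩
    obtain ⟨ρ, hρ⟩ := exists_locMap_comp (b := (locMap (c i)).hom b) χ (by
      have : χ.hom ((locMap (c i)).hom b) = θ.hom ((locMap b).hom b) := by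
        have := h₁.trans h₂.symm
        exact congrArg (fun f : B ⟶ E => f.hom b) this
      rw [this]
      exact (isUnit_locMap b).map θ.hom)
    have hψρ : ψ ≫ ρ = θ := by
      apply locMap_ext
      rw [← Category.assoc, hψ, Category.assoc, hρ, h₁, h₂]
    rw [← V.pull_pull rfl (by rw [Pt.res_res, hρ, Pt.res_res, h₁]) (by rw [Pt.res_res, h₁]) hρ,
      hm, LinearMap.map_smulₛₗ, V.pull_pull _ _ (by rw [Pt.res_res, h₂]) hψρ]
    congr 1
    subst h₁
    rw [← hρ]
    exact map_pow ρ.hom _ _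
  choose N₀ m₀ h₀ using h1
  obtain ⟨N, m, hm⟩ : ∃ (N : ℕ) (m : ∀ i, SectionsOver V.proj (s.res (locMap (c i)))),
      ∀ i, V.AgreesWith w (locMap (c i)) (m i) N := by
    choose M hM using fun i => exists_add_of_le (Finset.single_le_sum
      (fun i _ => Nat.zero_le (N₀ i)) (Finset.mem_univ i))
    refine ⟨∑ i, N₀ i, fun i => (((locMap (c i)).hom b) ^ M i) • m₀ i, fun i => ?_⟩
    rw [hM i, add_comm]
    exact (h₀ i).smul (M i)
  -- their differences on the overlaps are killed by a power of `b`
  have hκ (i j : ι) : ∃ κ : locAway B (c i) ⟶ locAway B (c i * c j),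
      locMap (c i) ≫ κ = locMap (c i * c j) := exists_locMap_comp _ (by
    have := isUnit_locMap (c i * c j)
    rw [map_mul] at this
    exact isUnit_of_mul_isUnit_left this)
  have hκ' (i j : ι) : ∃ κ : locAway B (c j) ⟶ locAway B (c i * c j),
      locMap (c j) ≫ κ = locMap (c i * c j) := exists_locMap_comp _ (by
    have := isUnit_locMap (c i * c j)
    rw [map_mul] at this
    exact isUnit_of_mul_isUnit_right this)
  choose κ hκ using hκ
  choose κ' hκ' using hκ'
  have h2 (i j : ι) : ∃ M : ℕ, ((locMap (c i * c j)).hom b) ^ M •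
      (V.pull (s' := s.res (locMap (c i * c j))) (κ i j) (by rw [Pt.res_res, hκ]) (m i) -
        V.pull (κ' i j) (by rw [Pt.res_res, hκ']) (m j)) = 0 := by
    refine V.exists_pow_smul_eq_zero _ rfl ?_
    obtain ⟨θ, hθ⟩ := exists_locMap_comp (b := b)
      (locMap (c i * c j) ≫ locMap ((locMap (c i * c j)).hom b)) (isUnit_locMap _)
    rw [map_sub, V.pull_pull _ _ (by rw [Pt.res_res, Pt.res_res, ← hκ, Category.assoc]) rfl,
      V.pull_pull _ _ (by rw [Pt.res_res, Pt.res_res, ← hκ', Category.assoc]) rfl, sub_eq_zero]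
    apply Subtype.ext
    have a1 := hm i _ _ (κ i j ≫ locMap ((locMap (c i * c j)).hom b)) θ
      (by rw [← Category.assoc, hκ]) hθ
    have a2 := hm j _ _ (κ' i j ≫ locMap ((locMap (c i * c j)).hom b)) θ
      (by rw [← Category.assoc, hκ']) hθ
    have a3 := congrArg Subtype.val (a1.trans a2.symm)
    rw [pull_val, pull_val] at a3 ⊢
    exact a3
  -- so they agree after multiplication with one more power, and can be glued
  choose M₀ hM₀ using h2
  let M := ∑ i, ∑ j, M₀ i j
  have hM (i j : ι) : ((locMap (c i * c j)).hom b) ^ M •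
      (V.pull (s' := s.res (locMap (c i * c j))) (κ i j) (by rw [Pt.res_res, hκ]) (m i) -
        V.pull (κ' i j) (by rw [Pt.res_res, hκ']) (m j)) = 0 := by
    have hle : M₀ i j ≤ M := (Finset.single_le_sum (f := fun j => M₀ i j)
      (fun j _ => Nat.zero_le _) (Finset.mem_univ j)).trans (Finset.single_le_sum
        (f := fun i => ∑ j, M₀ i j) (fun i _ => Nat.zero_le _) (Finset.mem_univ i))
    obtain ⟨L, hL⟩ := exists_add_of_le hle
    rw [hL, add_comm, pow_add, mul_smul, hM₀, smul_zero]
  let m' (i : ι) := ((locMap (c i)).hom b) ^ M • m i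
  have hm' (i : ι) : V.AgreesWith w (locMap (c i)) (m' i) (M + N) := (hm i).smul M
  have hglue (i j : ι) : (m' i).1.res (κ i j) = (m' j).1.res (κ' i j) := by
    have a1 : V.pull (s' := s.res (locMap (c i * c j))) (κ i j) (by rw [Pt.res_res, hκ]) (m' i) =
        V.pull (κ' i j) (by rw [Pt.res_res, hκ']) (m' j) := by
      rw [LinearMap.map_smulₛₗ, LinearMap.map_smulₛₗ, ← sub_eq_zero]
      refine Eq.trans ?_ (hM i j)
      rw [smul_sub]
      congr 2
      · rw [← hκ]
        exact map_pow (κ i j).hom _ _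
      · rw [← hκ']
        exact map_pow (κ' i j).hom _ _
    exact congrArg Subtype.val a1
  obtain ⟨t, ht⟩ := exists_pt_of_span hc (fun i => (m' i).1) (by
    intro i j D φ ψ h
    obtain ⟨χ, hχ⟩ := exists_locMap_comp (b := c i * c j) (locMap (c i) ≫ φ) (by
      rw [map_mul]
      refine IsUnit.mul ((isUnit_locMap (c i)).map φ.hom) ?_
      rw [h]
      exact (isUnit_locMap (c j)).map ψ.hom)
    have e1 : κ i j ≫ χ = φ := by
      apply locMap_ext
      rw [← Category.assoc, hκ, hχ]
    have e2 : κ' i j ≫ χ = ψ := by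
      apply locMap_ext
      rw [← Category.assoc, hκ', hχ, h]
    rw [← e1, ← e2, ← Pt.res_res, ← Pt.res_res, hglue])
  have hts : t ≫ V.proj = s := by
    refine pt_ext_of_span hc fun i => ?_
    rw [← (m' i).2, ← ht i, Pt.res, Pt.res, Category.assoc]
  -- the glued section agrees with `b ^ (M + N) • w` over the induced cover of `Spec B_b`
  refine ⟨M + N, ⟨t, hts⟩, Subtype.ext ?_⟩
  have hc' : Ideal.span (Set.range fun i => (locMap b).hom (c i)) = ⊤ := by
    have := congrArg (Ideal.map (locMap b).hom) hc
    rwa [Ideal.map_span, Ideal.map_top, ← Set.range_comp] at this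
  refine pt_ext_of_span hc' fun i => ?_
  obtain ⟨χ, hχ⟩ := exists_locMap_comp (b := c i)
    (locMap b ≫ locMap ((locMap b).hom (c i))) (isUnit_locMap _)
  have a1 := congrArg Subtype.val (hm' i _ _ χ (locMap ((locMap b).hom (c i))) hχ rfl)
  have a2 : (V.pull χ (by rw [Pt.res_res, hχ]) (m' i)).1 =
      (t.res (locMap b)).res (locMap ((locMap b).hom (c i))) := by
    rw [pull_val, ← ht i, Pt.res_res, hχ, Pt.res_res]
  refine a2.symm.trans (a1.trans ?_)
  have a3 : V.pull (s' := s.res (locMap b ≫ locMap ((locMap b).hom (c i))))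
      (locMap ((locMap b).hom (c i))) (by rw [Pt.res_res]) (((locMap b).hom b) ^ (M + N) • w) =
      ((locMap b ≫ locMap ((locMap b).hom (c i))).hom b) ^ (M + N) •
        V.pull (locMap ((locMap b).hom (c i))) (by rw [Pt.res_res]) w := by
    rw [LinearMap.map_smulₛₗ]
    congr 1
    exact map_pow (locMap ((locMap b).hom (c i))).hom _ _
  exact (congrArg Subtype.val a3).symm

end GeomVectorBundle

end QuasiCoherence

/-! ### Open conditions -/

section OpenConditions

variable {k : Type u} [Field k] {S : Over (Spec (.of k))}

theorem exists_res_eq_of_range_subset {A B : CommAlgCat.{u} k} (j : Pt S A)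
    (hj : IsOpenImmersion j.left) (s : Pt S B) (h : Set.range s.left ⊆ Set.range j.left) :
    ∃ φ : A ⟶ B, j.res φ = s := by
  let l : (algSpec (.of k)).obj (op B) ⟶ (algSpec (.of k)).obj (op A) :=
    Over.homMk (IsOpenImmersion.lift j.left s.left h) (by
      rw [← Over.w j, ← Category.assoc, IsOpenImmersion.lift_fac, Over.w s])
  obtain ⟨φ, hφ⟩ := (algSpec.instFull (R := .of k)).map_surjective l
  refine ⟨φ.unop, ?_⟩
  change (algSpec (.of k)).map φ ≫ j = s
  rw [hφ]
  ext1
  exact IsOpenImmersion.lift_fac _ _ _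

/-- An affine open neighbourhood, as a point with values in its algebra of functions. -/
theorem exists_affine_openPoint (x : S.left) : ∃ (A : CommAlgCat.{u} k) (j : Pt S A),
    IsOpenImmersion j.left ∧ x ∈ Set.range j.left := by
  obtain ⟨U, hU, hxU, -⟩ := exists_isAffineOpen_mem_and_subset (x := x) (U := ⊤) trivial
  have : IsAffine (openOver S U).left := hU
  obtain ⟨A, ⟨e⟩⟩ := exists_algSpec_iso (openOver S U)
  refine ⟨A, e.hom ≫ openOverι S U, ?_, ?_⟩
  · have : IsIso e.hom.left := inferInstanceAs (IsIso ((Over.forget _).map e.hom))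
    exact inferInstanceAs (IsOpenImmersion (e.hom.left ≫ U.ι))
  · let y : (openOver S U).left := (⟨x, hxU⟩ : U)
    refine ⟨e.inv.left y, ?_⟩
    rw [← Scheme.Hom.comp_apply, ← Over.comp_left, Iso.inv_hom_id_assoc]
    rfl

theorem range_res_subset {B C : CommAlgCat.{u} k} (s : Pt S B) (φ : B ⟶ C) :
    Set.range (s.res φ).left ⊆ Set.range s.left := by
  rintro _ ⟨y, rfl⟩
  rw [Pt.res, Over.comp_left, Scheme.Hom.comp_apply]
  exact ⟨_, rfl⟩

/-- A condition on the points of a scheme is open when it can be checked locally on the source and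
when it spreads out from field-valued points of an affine scheme to a neighbourhood. The subfunctor
that it defines is then represented by an open subscheme. -/
theorem IsRep.of_openCondition {F F' : CommAlgCat.{u} k ⥤ Type u} (hF : IsRep F) (η : F' ⟶ F)
    (hη : ∀ B, Function.Injective (η.app B))
    (hloc : ∀ (B : CommAlgCat.{u} k) (x : F.obj B),
      Ideal.span {b | F.map (locMap b) x ∈ Set.range (η.app (locAway B b))} = ⊤ →
        x ∈ Set.range (η.app B))
    (hspread : ∀ (A : CommAlgCat.{u} k) (K : Type u) [Field K] [Algebra k K]
      (π : A ⟶ CommAlgCat.of k K) (x : F.obj A), F.map π x ∈ Set.range (η.app _) →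
      ∃ (A' : CommAlgCat.{u} k) (ψ : A ⟶ A') (π' : A' ⟶ CommAlgCat.of k K), ψ ≫ π' = π ∧
        IsOpenImmersion ((algSpec (.of k)).map ψ.op).left ∧
        F.map ψ x ∈ Set.range (η.app _)) : IsRep F' := by
  obtain ⟨S, ⟨e⟩⟩ := hF
  let P : ∀ B : CommAlgCat.{u} k, Pt S B → Prop :=
    fun B s => ∃ x, ((η ≫ e.hom).app B x : Pt S B) = s
  have hebij (B) : Function.Bijective (e.hom.app B) := (isIso_iff_bijective _).1 inferInstance
  have hnat {B C : CommAlgCat.{u} k} (φ : B ⟶ C) {x : F.obj B} {s : Pt S B}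
      (h : (e.hom.app B x : Pt S B) = s) : (e.hom.app C (F.map φ x) : Pt S C) = s.res φ :=
    (NatTrans.naturality_apply e.hom φ x).trans (congrArg (fun s : Pt S B => s.res φ) h)
  have hP {B} {x : F.obj B} {s : Pt S B} (h : (e.hom.app B x : Pt S B) = s) :
      P B s ↔ x ∈ Set.range (η.app B) :=
    ⟨fun ⟨y, hy⟩ => ⟨y, (hebij B).1 (hy.trans h.symm)⟩,
      fun ⟨y, hy⟩ => ⟨y, (congrArg (e.hom.app B) hy).trans h⟩⟩
  have hsurj (B) (s : Pt S B) : ∃ x, (e.hom.app B x : Pt S B) = s := (hebij B).2 s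
  have hres {B C : CommAlgCat.{u} k} (φ : B ⟶ C) (s : Pt S B) (h : P B s) : P C (s.res φ) := by
    obtain ⟨x, rfl⟩ := h
    exact ⟨F'.map φ x, NatTrans.naturality_apply (η ≫ e.hom) φ x⟩
  -- the union of all affine open subschemes whose inclusion satisfies the condition
  let U : S.left.Opens := ⟨{z | ∃ (A : CommAlgCat.{u} k) (j : Pt S A), IsOpenImmersion j.left ∧
    z ∈ Set.range j.left ∧ P A j}, isOpen_iff_forall_mem_open.2 fun z hz => by
      obtain ⟨A, j, hj, hz, hPj⟩ := hz
      exact ⟨Set.range j.left, fun w hw => ⟨A, j, hj, hw, hPj⟩, j.left.isOpenEmbedding.isOpen_range,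
        hz⟩⟩
  refine IsRep.of_open (η ≫ e.hom) U (fun B x y h => hη B ((hebij B).1 h)) fun B s => ⟨fun h => ?_,
    fun h => ?_⟩
  · refine top_le_iff.1 fun (p : PrimeSpectrum B) _ => ?_
    -- the condition spreads out from the residue field of `p` to a neighbourhood in `S`
    let K := p.asIdeal.ResidueField
    let π₀ : B ⟶ CommAlgCat.of k K := CommAlgCat.ofHom (IsScalarTower.toAlgHom k B K)
    have hrange : Set.range (s.res π₀).left ⊆ {s.left p} := by
      rintro _ ⟨y, rfl⟩
      rw [Pt.res, Over.comp_left, Scheme.Hom.comp_apply]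
      refine congrArg s.left (?_ : PrimeSpectrum.comap (algebraMap B K) y = p)
      have : PrimeSpectrum.comap (algebraMap B K) y ∈
          Set.range (PrimeSpectrum.comap (algebraMap B K)) := ⟨y, rfl⟩
      rw [PrimeSpectrum.residueField_comap] at this
      exact this
    obtain ⟨A, j, hj, hpj⟩ := exists_affine_openPoint (s.left p)
    obtain ⟨π, hπ⟩ := exists_res_eq_of_range_subset j hj (s.res π₀)
      (hrange.trans (Set.singleton_subset_iff.2 hpj))
    obtain ⟨x, hx⟩ := hsurj A j
    obtain ⟨A', ψ, π', h1, h2, h3⟩ := hspread A K π x ((hP ((hnat π hx).trans hπ)).1 (hres π₀ s h))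
    refine ⟨A', j.res ψ, ?_, ?_, (hP (hnat ψ hx)).2 h3⟩
    · exact inferInstanceAs (IsOpenImmersion (_ ≫ _))
    · obtain ⟨y⟩ : Nonempty ((algSpec (.of k)).obj (op (CommAlgCat.of k K))).left :=
        inferInstanceAs (Nonempty (PrimeSpectrum K))
      have : (s.res π₀).left y = s.left p := hrange ⟨y, rfl⟩
      rw [← this, ← hπ, ← h1, ← Pt.res_res]
      exact range_res_subset _ _ ⟨y, rfl⟩
  -- a point which lands in `U` factors locally through the affine open subschemes that form `U`
  · obtain ⟨x, hx⟩ := hsurj B s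
    refine (hP hx).2 (hloc B x ?_)
    by_contra hne
    obtain ⟨p, hp, hTp⟩ := Ideal.exists_le_maximal _ hne
    let y : PrimeSpectrum B := ⟨p, hp.isPrime⟩
    have hy : y ∈ s.left ⁻¹ᵁ U := by
      rw [h]
      trivial
    obtain ⟨A, j, hj, hyj, hPj⟩ := hy
    obtain ⟨_, ⟨_, ⟨b, rfl⟩, rfl⟩, hyb, hb⟩ :=
      PrimeSpectrum.isBasis_basic_opens.exists_subset_of_mem_open (a := y) hyj
        (j.left.isOpenEmbedding.isOpen_range.preimage s.left.continuous)
    refine hyb (hTp (Ideal.subset_span ?_))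
    obtain ⟨φ, hφ⟩ := exists_res_eq_of_range_subset j hj (s.res (locMap b)) (by
      rintro _ ⟨z, rfl⟩
      rw [Pt.res, Over.comp_left, Scheme.Hom.comp_apply]
      refine hb ?_
      rw [← range_locMap]
      exact ⟨z, rfl⟩)
    exact (hP ((hnat _ hx).trans hφ.symm)).1 (hres φ j hPj)

end OpenConditions

/-! ### Linear equations and localization -/

section LocalizationOfModules

variable {B C : Type*} [CommRing B] [CommRing C] {φ : B →+* C} {b : B}
  {M₁ M₂ N₁ N₂ : Type*} [AddCommGroup M₁] [Module B M₁] [AddCommGroup N₁] [Module C N₁]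
  [AddCommGroup M₂] [Module B M₂] [AddCommGroup N₂] [Module C N₂]

/-- The semilinear map `r : M → N` exhibits `N` as the localization of `M` away from `b`, when `C`
is the localization of `B`. -/
structure IsAwayMap (φ : B →+* C) (b : B) (r : M₁ → N₁) : Prop where
  map_sub : ∀ m m', r (m - m') = r m - r m'
  map_smul : ∀ (a : B) m, r (a • m) = φ a • r m
  exists_pow_smul_eq_zero : ∀ m, r m = 0 → ∃ n : ℕ, b ^ n • m = 0
  exists_eq : ∀ w, ∃ (n : ℕ) (m : M₁), r m = φ b ^ n • w

variable {r₁ : M₁ → N₁} {r₂ : M₂ → N₂}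

theorem IsAwayMap.prodMap (h₁ : IsAwayMap φ b r₁) (h₂ : IsAwayMap φ b r₂) :
    IsAwayMap φ b (Prod.map r₁ r₂) where
  map_sub m m' := Prod.ext (h₁.map_sub _ _) (h₂.map_sub _ _)
  map_smul a m := Prod.ext (h₁.map_smul _ _) (h₂.map_smul _ _)
  exists_pow_smul_eq_zero := by
    rintro ⟨m, m'⟩ h
    obtain ⟨n, hn⟩ := h₁.exists_pow_smul_eq_zero m (congrArg Prod.fst h)
    obtain ⟨n', hn'⟩ := h₂.exists_pow_smul_eq_zero m' (congrArg Prod.snd h)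
    refine ⟨n + n', Prod.ext ?_ ?_⟩
    · change b ^ (n + n') • m = 0
      rw [add_comm, pow_add, mul_smul, hn, smul_zero]
    · change b ^ (n + n') • m' = 0
      rw [pow_add, mul_smul, hn', smul_zero]
  exists_eq := by
    rintro ⟨w, w'⟩
    obtain ⟨n, m, h⟩ := h₁.exists_eq w
    obtain ⟨n', m', h'⟩ := h₂.exists_eq w'
    refine ⟨n + n', (b ^ n' • m, b ^ n • m'), Prod.ext ?_ ?_⟩
    · change r₁ (b ^ n' • m) = φ b ^ (n + n') • w
      rw [h₁.map_smul (b ^ n'), h, smul_smul, map_pow, ← pow_add, add_comm]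
    · change r₂ (b ^ n • m') = φ b ^ (n + n') • w'
      rw [h₂.map_smul (b ^ n), h', smul_smul, map_pow, ← pow_add]

/-- A linear equation which is solvable after a localization is solvable for a multiple of the right
hand side. -/
theorem IsAwayMap.exists_pow_smul_mem_range (h₁ : IsAwayMap φ b r₁) (h₂ : IsAwayMap φ b r₂)
    (f : M₁ →ₗ[B] M₂) (f' : N₁ →ₗ[C] N₂) (hf : ∀ m, r₂ (f m) = f' (r₁ m)) (q : M₂)
    (hq : ∃ w, f' w = r₂ q) : ∃ n : ℕ, b ^ n • q ∈ LinearMap.range f := by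
  obtain ⟨w, hw⟩ := hq
  obtain ⟨n, m, hm⟩ := h₁.exists_eq w
  obtain ⟨n', hn'⟩ := h₂.exists_pow_smul_eq_zero (f m - b ^ n • q) (by
    rw [h₂.map_sub, hf, hm, f'.map_smul, hw, h₂.map_smul (b ^ n), map_pow, sub_self])
  refine ⟨n' + n, b ^ n' • m, ?_⟩
  rw [smul_sub, sub_eq_zero] at hn'
  rw [f.map_smul, hn', smul_smul, pow_add]

end LocalizationOfModules

/-! ### Equivalences can be recognized locally -/

namespace DGFamily

variable {k : Type u} [Field k] {R : DGFamily k}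

/-- The representability of the morphisms, in terms of the pullback of sections. -/
theorem REPR.exists_linearEquiv (hR : R.REPR) (p : ℤ) : ∃ (O : Over (Spec (.of k)))
    (V : GeomVectorBundle (O ⊗ O)) (s : ∀ {B} (_ _ : (R.obj B).Obj), Pt (O ⊗ O) B)
    (hs : ∀ {B C : CommAlgCat.{u} k} (f : B ⟶ C) x y,
      (s x y).res f = s ((R.map f).obj x) ((R.map f).obj y))
    (t : ∀ {B} (x y : (R.obj B).Obj), (R.obj B).Hom p x y ≃ₗ[B] SectionsOver V.proj (s x y)),
    ∀ {B C : CommAlgCat.{u} k} (f : B ⟶ C) x y (m : (R.obj B).Hom p x y),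
      t _ _ ((R.map f).map m) = V.pull f (hs f x y) (t x y m) := by
  obtain ⟨O, e, hV⟩ := hR
  obtain ⟨V, t, ht⟩ := hV p
  refine ⟨O, V, fun {B} x y => lift (e.hom.app B x : Pt O B) (e.hom.app B y : Pt O B),
    fun {B C} f x y => ?_, t, fun f x y m => Subtype.ext (ht f x y m)⟩
  refine (comp_lift _ _ _).trans ?_
  exact congrArg₂ (fun a b : Pt O C => lift a b) (NatTrans.naturality_apply e.hom f x).symm
    (NatTrans.naturality_apply e.hom f y).symm

/-- The formation of the modules of morphisms commutes with localization. -/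
theorem REPR.isAwayMap (hR : R.REPR) {B : CommAlgCat.{u} k} (b : B) (p : ℤ) (x y : (R.obj B).Obj) :
    IsAwayMap ((locMap b).hom : B →+* locAway B b) b
      ((R.map (locMap b)).map (p := p) (x := x) (y := y)) := by
  obtain ⟨O, V, s, hs, t, ht⟩ := hR.exists_linearEquiv p
  refine ⟨map_sub _, LinearMap.map_smulₛₗ _, fun m hm => ?_, fun w => ?_⟩
  · obtain ⟨n, hn⟩ := V.exists_pow_smul_eq_zero b (hs (locMap b) x y) (v := t x y m) (by
      rw [← ht, hm, map_zero])
    exact ⟨n, (t x y).injective (by rw [map_smul, hn, map_zero])⟩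
  · obtain ⟨n, v, hv⟩ := V.exists_pull_eq b (hs (locMap b) x y) (t _ _ w)
    refine ⟨n, (t x y).symm v, (t _ _).injective ?_⟩
    rw [ht, LinearEquiv.apply_symm_apply, map_smul]
    exact hv

/-- Being an equivalence can be checked on a cover by basic open subsets. -/
theorem REPR.isEquivalence_of_span (hR : R.REPR) {B : CommAlgCat.{u} k} {x y : (R.obj B).Obj}
    {f : (R.obj B).Hom 0 x y} (hf : (R.obj B).d (zero_add 1) f = 0)
    (h : Ideal.span {b | (R.obj (locAway B b)).IsEquivalence ((R.map (locMap b)).map f)} = ⊤) :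
    (R.obj B).IsEquivalence f := by
  -- the equations `d a = 0`, `f a - d h = 1`, `a f - d g = 1` for `(a, h, g)`
  let Φ (C : CommAlgCat.{u} k) {x y : (R.obj C).Obj} (f : (R.obj C).Hom 0 x y) :
      (R.obj C).Hom 0 y x × (R.obj C).Hom (-1) y y × (R.obj C).Hom (-1) x x →ₗ[C]
        (R.obj C).Hom 1 y x × (R.obj C).Hom 0 y y × (R.obj C).Hom 0 x x :=
    ((R.obj C).d (zero_add 1) ∘ₗ LinearMap.fst C _ _).prod
      (((R.obj C).comp (zero_add 0) f ∘ₗ LinearMap.fst C _ _ -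
          (R.obj C).d (neg_add_cancel 1) ∘ₗ LinearMap.fst C _ _ ∘ₗ LinearMap.snd C _ _).prod
        (((R.obj C).comp (zero_add 0)).flip f ∘ₗ LinearMap.fst C _ _ -
          (R.obj C).d (neg_add_cancel 1) ∘ₗ LinearMap.snd C _ _ ∘ₗ LinearMap.snd C _ _))
  have hΦ (C : CommAlgCat.{u} k) {x y : (R.obj C).Obj} (f : (R.obj C).Hom 0 x y)
      (hf : (R.obj C).d (zero_add 1) f = 0) : (R.obj C).IsEquivalence f ↔
        ∃ w, Φ C f w = (0, (R.obj C).id y, (R.obj C).id x) := by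
    constructor
    · rintro ⟨-, a, h, g, h1, h2, h3⟩
      refine ⟨(a, h, g), Prod.ext h1 (Prod.ext ?_ ?_)⟩
      · exact sub_eq_of_eq_add h2
      · exact sub_eq_of_eq_add h3
    · rintro ⟨⟨a, h, g⟩, hw⟩
      obtain ⟨h1, h2⟩ := Prod.mk.inj hw
      obtain ⟨h2, h3⟩ := Prod.mk.inj h2
      exact ⟨hf, a, h, g, h1, sub_eq_iff_eq_add.1 h2, sub_eq_iff_eq_add.1 h3⟩
  refine (hΦ B f hf).2 (Submodule.mem_of_span_eq_top_of_smul_pow_mem (LinearMap.range (Φ B f)) _ h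
    _ ?_)
  rintro ⟨b, hb⟩
  obtain ⟨w, hw⟩ := (hΦ _ _ (by rw [← (R.map _).map_d, hf, map_zero])).1 hb
  refine IsAwayMap.exists_pow_smul_mem_range
    ((hR.isAwayMap b 0 y x).prodMap ((hR.isAwayMap b (-1) y y).prodMap (hR.isAwayMap b (-1) x x)))
    ((hR.isAwayMap b 1 y x).prodMap ((hR.isAwayMap b 0 y y).prodMap (hR.isAwayMap b 0 x x)))
    (Φ B f) (Φ _ ((R.map (locMap b)).map f)) ?_ _ ⟨w, hw.trans ?_⟩
  · rintro ⟨a, h, g⟩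
    refine Prod.ext ?_ (Prod.ext ?_ ?_)
    · exact (R.map (locMap b)).map_d _ _
    · refine ((R.map (locMap b)).map.map_sub _ _).trans ?_
      rw [LinearMap.comp_apply, LinearMap.comp_apply, (R.map (locMap b)).map_comp,
        (R.map (locMap b)).map_d]
      rfl
    · refine ((R.map (locMap b)).map.map_sub _ _).trans ?_
      rw [LinearMap.comp_apply, LinearMap.comp_apply, LinearMap.flip_apply,
        (R.map (locMap b)).map_comp, (R.map (locMap b)).map_d]
      rfl
  · exact Prod.ext (map_zero _).symm (Prod.ext ((R.map (locMap b)).map_id y).symm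
      ((R.map (locMap b)).map_id x).symm)

end DGFamily

/-! ### Equivalences spread out to neighbourhoods -/

section SpreadingOut

namespace DGCat

variable {B : Type u} [CommRing B] {A : DGCat B} {x y : A.Obj}

/-- A right inverse of an equivalence, up to homotopy and a unit, is an equivalence. -/
theorem IsEquivalence.of_comp₀_homotopic {f : A.Hom 0 x y} {a : A.Hom 0 y x}
    (hf : A.IsEquivalence f) (ha : A.d (zero_add 1) a = 0) {t : B} (ht : IsUnit t)
    (h : A.Homotopic (A.comp₀ f a) (t • A.id y)) : A.IsEquivalence a := by
  obtain ⟨hf, g, hg, h1, h2⟩ := isEquivalence_iff.1 hf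
  obtain ⟨s, hs⟩ := ht.exists_left_inv
  have h3 : A.Homotopic (DGCat.comp₀ A (s • f) a) (A.id y) := by
    have := h.smul s
    rw [smul_smul, hs, one_smul] at this
    simpa [DGCat.comp₀] using this
  have hsf : A.d (zero_add 1) (s • f) = 0 := by rw [map_smul, hf, smul_zero]
  have h4 : A.Homotopic a (t • g) := by
    have e1 := (h2.comp₀_right ha).symm
    rw [id_comp₀, comp₀_assoc] at e1
    refine e1.trans ((h.comp₀_left hg).trans ?_)
    rw [DGCat.comp₀, map_smul]
    exact (congrArg (t • ·) (A.comp_id g)).symm ▸ Homotopic.refl _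
  refine isEquivalence_of_inverses ha hsf hsf ((h4.comp₀_right hsf).trans ?_) h3
  have : DGCat.comp₀ A (t • g) (s • f) = DGCat.comp₀ A g f := by
    simp only [DGCat.comp₀, map_smul, LinearMap.smul_apply]
    rw [smul_smul, hs, one_smul]
  rw [this]
  exact h2

end DGCat

theorem DGFunctor.homotopic_map {B C : Type u} [CommRing B] [CommRing C] {φ : B →+* C} {A : DGCat B}
    {A' : DGCat C} (F : DGFunctor φ A A') {x y : A.Obj} {f g : A.Hom 0 x y}
    (h : A.Homotopic f g) : A'.Homotopic (F.map f) (F.map g) := by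
  obtain ⟨h, rfl⟩ := h
  exact ⟨F.map h, by rw [map_add, F.map_d]⟩

theorem DGFunctor.map_comp₀_homotopic {B C : Type u} [CommRing B] [CommRing C] {φ : B →+* C}
    {A : DGCat B} {A' : DGCat C} (F : DGFunctor φ A A') {x y : A.Obj} {f : A.Hom 0 x y}
    {a : A.Hom 0 y x} {t : B} (h : A.Homotopic (A.comp₀ f a) (t • A.id y)) :
    A'.Homotopic (A'.comp₀ (F.map f) (F.map a)) (φ t • A'.id (F.obj y)) := by
  have := F.homotopic_map h
  rw [DGCat.comp₀, F.map_comp, LinearMap.map_smulₛₗ, F.map_id] at this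
  exact this

namespace DGFamily

variable {k : Type u} [Field k] {R : DGFamily k}

theorem isEquivalence_map_map {B C D : CommAlgCat.{u} k} {φ : B ⟶ C} {ψ : C ⟶ D} {χ : B ⟶ D}
    (h : φ ≫ ψ = χ) {x y : (R.obj B).Obj} (f : (R.obj B).Hom 0 x y) :
    (R.obj D).IsEquivalence ((R.map ψ).map ((R.map φ).map f)) ↔
      (R.obj D).IsEquivalence ((R.map χ).map f) := by
  subst h
  rw [R.map_comp]
  rfl

/-- In a neighbourhood of a field-valued point, the formation of the modules of morphisms is a base
change of free modules. -/
theorem REPR.exists_isFreeBaseChange (hR : R.REPR) {A : CommAlgCat.{u} k} {K : Type u} [Field K]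
    [Algebra k K] (π : A ⟶ CommAlgCat.of k K) (p : ℤ) (x y : (R.obj A).Obj) :
    ∃ b : A, π.hom b ≠ 0 ∧ ∀ (A' : CommAlgCat.{u} k) (ψ : A ⟶ A') (π' : A' ⟶ CommAlgCat.of k K),
      ψ ≫ π' = π → IsUnit (ψ.hom b) →
        IsFreeBaseChange (K := K) (π'.hom : A' →+* K)
          ((R.map π').map (p := p) (x := (R.map ψ).obj x) (y := (R.map ψ).obj y)) := by
  obtain ⟨O, V, s, hs, t, ht⟩ := hR.exists_linearEquiv p
  let z : PrimeSpectrum A := PrimeSpectrum.comap (π.hom : A →+* K) ⊥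
  obtain ⟨U, hzU, r, τ, hτ⟩ := V.exists_trivialOn ((s x y).left z)
  obtain ⟨_, ⟨_, ⟨b, rfl⟩, rfl⟩, hzb, hbU⟩ :=
    PrimeSpectrum.isBasis_basic_opens.exists_subset_of_mem_open (a := z) hzU
      ((s x y).left ⁻¹ᵁ U).isOpen
  have hb : ((s x y).res (locMap b)).left ⁻¹ᵁ U = ⊤ := by
    rw [Pt.res, Over.comp_left, Scheme.Hom.comp_preimage]
    refine top_le_iff.1 fun w _ => hbU ?_
    rw [← range_locMap]
    exact ⟨w, rfl⟩
  refine ⟨b, hzb, fun A' ψ π' hπ hψ => ?_⟩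
  obtain ⟨ψ', rfl⟩ := exists_locMap_comp ψ hψ
  have h1 : (s ((R.map (locMap b ≫ ψ')).obj x) ((R.map (locMap b ≫ ψ')).obj y)).left ⁻¹ᵁ U = ⊤ := by
    rw [← hs, ← Pt.res_res]
    exact Pt.preimage_res hb ψ'
  have h2 := Pt.preimage_res h1 π'
  rw [hs] at h2
  refine ⟨Fin r, inferInstance, Module.Basis.ofEquivFun ((t _ _).trans (τ _ h1)),
    Module.Basis.ofEquivFun (R := K) ((t _ _).trans (τ _ h2)), fun m i => ?_⟩
  have := congrFun (hτ π' _ h1 _ h2 (hs π' _ _) (t _ _ m)) i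
  rw [← ht] at this
  exact this

/-- An equivalence over a field-valued point is an equivalence in a neighbourhood. -/
theorem REPR.exists_isEquivalence_map (hR : R.REPR) {A : CommAlgCat.{u} k} {K : Type u} [Field K]
    [Algebra k K] (π : A ⟶ CommAlgCat.of k K) {x y : (R.obj A).Obj} {f : (R.obj A).Hom 0 x y}
    (hf : (R.obj A).d (zero_add 1) f = 0) (h : (R.obj _).IsEquivalence ((R.map π).map f)) :
    ∃ (A' : CommAlgCat.{u} k) (ψ : A ⟶ A') (π' : A' ⟶ CommAlgCat.of k K), ψ ≫ π' = π ∧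
      IsOpenImmersion ((algSpec (.of k)).map ψ.op).left ∧
      (R.obj A').IsEquivalence ((R.map ψ).map f) := by
  choose b hb hfree using fun p x y => hR.exists_isFreeBaseChange π p x y
  -- a neighbourhood where all relevant bundles are trivial
  let c := ∏ p ∈ Finset.Icc (-1 : ℤ) 2, (b p x x * b p x y) * (b p y x * b p y y)
  have hc : π.hom c ≠ 0 := by
    rw [map_prod]
    refine Finset.prod_ne_zero_iff.2 fun p _ => ?_
    rw [map_mul, map_mul, map_mul]
    exact mul_ne_zero (mul_ne_zero (hb _ _ _) (hb _ _ _)) (mul_ne_zero (hb _ _ _) (hb _ _ _))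
  obtain ⟨π₁, hπ₁⟩ := exists_locMap_comp (b := c) π (IsUnit.mk0 (G₀ := K) _ hc)
  have hunit (p : ℤ) (hp : p ∈ Finset.Icc (-1 : ℤ) 2) :
      (IsUnit ((locMap c).hom (b p x x)) ∧ IsUnit ((locMap c).hom (b p x y))) ∧
        IsUnit ((locMap c).hom (b p y x)) ∧ IsUnit ((locMap c).hom (b p y y)) := by
    have := isUnit_of_dvd_unit (map_dvd (locMap c).hom (Finset.dvd_prod_of_mem _ hp))
      (isUnit_locMap c)
    rwa [map_mul, map_mul, map_mul, IsUnit.mul_iff, IsUnit.mul_iff, IsUnit.mul_iff] at this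
  let f₁ := (R.map (locMap c)).map f
  have hf₁ : (R.obj _).d (zero_add 1) f₁ = 0 := by rw [← (R.map _).map_d, hf, map_zero]
  have h₁ : (R.obj _).IsEquivalence ((R.map π₁).map f₁) := (isEquivalence_map_map hπ₁ f).2 h
  obtain ⟨t, a, ht, ha, hfa⟩ := (R.map π₁).exists_right_inverse (K := K)
    (fun p hp z hz => by
      obtain ⟨⟨u1, u2⟩, u3, u4⟩ := hunit p hp
      rcases hz with rfl | rfl
      · exact hfree p y x _ _ _ hπ₁ u3
      · exact hfree p y y _ _ _ hπ₁ u4) hf₁ h₁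
  have ha₁ : (R.obj _).IsEquivalence ((R.map π₁).map a) :=
    h₁.of_comp₀_homotopic (by rw [← (R.map _).map_d, ha, map_zero]) (IsUnit.mk0 (G₀ := K) _ ht)
      ((R.map π₁).map_comp₀_homotopic hfa)
  obtain ⟨t', f', ht', hf', haf⟩ := (R.map π₁).exists_right_inverse (K := K)
    (fun p hp z hz => by
      obtain ⟨⟨u1, u2⟩, u3, u4⟩ := hunit p hp
      rcases hz with rfl | rfl
      · exact hfree p x y _ _ _ hπ₁ u2
      · exact hfree p x x _ _ _ hπ₁ u1) ha ha₁
  -- a smaller neighbourhood where both inverses are inverses up to units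
  obtain ⟨π₂, hπ₂⟩ := exists_locMap_comp (b := t * t') π₁ (by
    rw [map_mul]
    exact (IsUnit.mk0 (G₀ := K) _ ht).mul (IsUnit.mk0 (G₀ := K) _ ht'))
  have htt := isUnit_locMap (t * t')
  rw [map_mul, IsUnit.mul_iff] at htt
  refine ⟨_, locMap c ≫ locMap (t * t'), π₂, by rw [Category.assoc, hπ₂, hπ₁], ?_, ?_⟩
  · rw [op_comp, Functor.map_comp, Over.comp_left]
    infer_instance
  · refine (isEquivalence_map_map rfl f).1 ?_
    have hd {x y} {g : (R.obj (locAway A c)).Hom 0 x y} (hg : (R.obj _).d (zero_add 1) g = 0) :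
        (R.obj _).d (zero_add 1) ((R.map (locMap (t * t'))).map g) = 0 := by
      rw [← (R.map _).map_d, hg, map_zero]
    exact DGCat.isEquivalence_of_right_inverses (hd hf₁) (hd ha) (hd hf') htt.1 htt.2
      ((R.map _).map_comp₀_homotopic hfa) ((R.map _).map_comp₀_homotopic haf)

/-- The equivalences form an open subscheme of the scheme of closed morphisms. -/
theorem REPR.isRep_X_one (hR : R.REPR) : IsRep (level R.X 1) := by
  have hmem (B) (σ : NCSimplex (R.obj B) 1) : (σ : (level R.Xbar 1).obj B) ∈
      Set.range ((R.inclusion 1).app B) ↔ (R.obj B).IsEquivalence σ.arrow :=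
    ⟨fun ⟨τ, hτ⟩ => σ.edgesInvertible_iff_arrow.1 (by
      rw [← hτ]
      exact Subtype.property (p := fun σ : NCSimplex (R.obj B) 1 => σ.EdgesInvertible) τ),
      fun h => ⟨⟨σ, σ.edgesInvertible_iff_arrow.2 h⟩, rfl⟩⟩
  refine hR.isRep_Xbar_one.of_openCondition (R.inclusion 1) (fun _ _ _ h => Subtype.ext h)
    (fun B σ h => ?_) fun A K _ _ π σ h => ?_
  · change NCSimplex (R.obj B) 1 at σ
    refine (hmem B σ).2 (hR.isEquivalence_of_span σ.d_arrow (Eq.trans ?_ h))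
    congr 1
    ext b
    exact (hmem _ (σ.mapFunctor (R.map (locMap b)))).symm
  · change NCSimplex (R.obj A) 1 at σ
    obtain ⟨A', ψ, π', h1, h2, h3⟩ := hR.exists_isEquivalence_map π σ.d_arrow
      ((hmem _ (σ.mapFunctor (R.map π))).1 h)
    exact ⟨A', ψ, π', h1, h2, (hmem _ (σ.mapFunctor (R.map ψ))).2 h3⟩

end DGFamily

end SpreadingOut

theorem mainTheorem3 {k : Type u} [Field k] (R : DGFamily k) (hR : R.REPR) :
    (IsSimplicialScheme R.X ∧
      ∀ (n : ℕ) (l : Fin (n + 3)), 0 < l → l < Fin.last (n + 2) → GP R.X n l) ∧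
    (IsSimplicialScheme R.Xbar ∧
      ∀ (n : ℕ) (l : Fin (n + 3)), 0 < l → l < Fin.last (n + 2) → GP R.Xbar n l) :=
  ⟨isSimplicialScheme_of_gp hR.isRep_X_zero hR.isRep_X_one fun _ _ => hR.gp_X,
    isSimplicialScheme_of_gp hR.isRep_Xbar_zero hR.isRep_Xbar_one fun _ _ => hR.gp_Xbar⟩
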